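/- **Setting.** For an integer $k\ge 0$ let $H^k=H^k(\mathbb R)$ be the real-valued $L^2$-based Sobolev space with norm $\|g\|_{H^k}=(\sum_{j\le k}\|\partial_x^j g\|_{L^2}^2)^{1/2}$ (for $k\ge1$ elements are identified with their continuous versions), and write $\|u\|_{L^\infty_TH^k}=\sup_{t\in[0,T]}\|u(t)\|_{H^k}$ and $C_TH^k=C([0,T];H^k)$. Let $f=f(z,x,t)$ be real-valued, $z=(z_0,z_1,z_2,z_3)\in\mathbb R^4$, $x\in\mathbb R$, $t\in[-1,1]$, and write $f(\partial_x^3\mathbf v)=f(v,v_x,v_{xx},v_{xxx},x,t)$ (with $z_j=\partial_x^jv$), and similarly for other functions of $(z,x,t)$. Assume: * (A1) $f\in C^1_tC^{11}_zW^{11,\infty}_x$: for $\alpha\le1$, $|\beta|\le11$, $\gamma\le11$ the derivatives $\partial_t^\alpha\partial_z^\beta\partial_x^\gamma f$ exist (the one of order $\gamma=11$ in $x$ as the weak derivative of a Lipschitz function), are continuous in $(z,t)$ for $\gamma\le 10$, and are bounded uniformly in $x\in\mathbb R$, $t\in[-1,1]$ and $z$ in bounded sets. * (A2) There are $g_D(z_0,z_1,z_2,x,t)$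 of class $C^1_tC^0_zL^\infty_x$ and $g_H(z,x,t)$ of class $C^1_tC^2_zL^\infty_x$ (with bounds locally uniform in $z$, as in (A1)) such that $g_H(0,x,t)=0=\partial_{z_j}g_H(0,x,t)$ for $j=0,\dots,3$ and, for every $v\in H^7$ and $t\in[-1,1]$, $$\frac{f_{z_2}}{f_{z_3}}(\partial_x^3\mathbf v)=\partial_x\big[g_D(\partial_x^2\mathbf v)\big]+g_H(\partial_x^3\mathbf v)\quad\text{at all points where } f_{z_3}(\partial_x^3\mathbf v)\ne0 .$$ * (A3) $f(0,x,t)=0$. For $0<T\le1$, $\varepsilon\ge0$ and initial data $u^0$, a *solution* of the regularized equation $$\partial_tu+f(\partial_x^3u,\partial_x^2u,\partial_xu,u,x,t)=-\varepsilon\,\partial_x^4u ,\qquad u(\cdot,0)=u^0, \tag{1}$$ is a function $u\in C_TH^8$ if $\varepsilon>0$, $u\in C_TH^7$ if $\varepsilon=0$, satisfying (1) classically on $[0,T]$. For such $u$ let $$M_\varepsilon(t)=\|u\|_{L^\infty_{t}H^7}+\varepsilon\|u\|_{L^\infty_{t}H^8}\ (\text{second term }0\text{ if }\varepsilon=0),\qquad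 \lambda(\partial_x^3\mathbf u(t))=\Big\|\frac1{f_{z_3}(\partial_x^3\mathbf u(t))}\Big\|_{L^\infty_x}\in[0,\infty],$$ $$k(t)=\sup_{0\le s\le t}\max\{\|u(s)\|_{H^4},\lambda(\partial_x^3\mathbf u(s))\}.$$ **Proposition.** There are a nondecreasing function $C:[0,\infty)\to[0,\infty)$ and a function $T_1:[0,\infty)\to(0,\infty)$, both depending only on $f$, with the following property. Let $0<T\le 1$ and $\varepsilon,\varepsilon'\ge0$, let $u_\varepsilon$ and $u_{\varepsilon'}$ be solutions on $[0,T]$ of (1) with parameters $\varepsilon,\varepsilon'$ and initial data $u^0,u^{0\prime}$ respectively, and let $M\in[0,\infty)$ be such that $\sup_{\tau\in[0,T]}(M_\varepsilon(\tau)+k(\tau))\le M$ holds for $u_\varepsilon$ and the corresponding bound holds for $u_{\varepsilon'}$. Then $$\|u_\varepsilon-u_{\varepsilon'}\|_{L^\infty_TH^3}\le C(M)\,T\,\|u_\varepsilon-u_{\varepsilon'}\|_{L^\infty_TH^3}+(\varepsilon+\varepsilon')C(M)+C(M)\|u^0-u^{0\prime}\|_{H^3},$$ and, with $T_*=\min\{T,T_1(M)\}$,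 $$\|u_\varepsilon-u_{\varepsilon'}\|_{L^\infty_{T_*}H^3}\le 2(\varepsilon+\varepsilon')C(M)+C(M)\|u^0-u^{0\prime}\|_{H^3}.$$ In particular, solutions of (1) with $\varepsilon=0$ are unique in $C_TH^7$: if $0<T\le1$ and $u,u'\in C_TH^7$ are two solutions of (1) with $\varepsilon=0$ and the same initial data, and $\lambda(\partial_x^3\mathbf u(t))$ is bounded on $[0,T]$, then $u(t)=u'(t)$ for all $t\in[0,T]$. -/

import Mathlib

open MeasureTheory Filter Topology Set
open scoped ENNReal NNReal

namespace DispersiveFlow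

/-! ### Sobolev spaces of integer order on the real line -/

/-- `g` is (the continuous version of) an element of `H^k(ℝ)`, real valued: for `j ≤ k` the
derivative `∂^j g` is in `L²`, and for `j < k` the function `∂^j g` is absolutely continuous, i.e. it
is the indefinite integral of `∂^(j+1) g`. Thus `g` is of class `C^(k-1)`, the derivatives of order
below `k` are classical, and the one of order `k` is the weak derivative: it exists as a
classical derivative almost everywhere, and `iteratedDeriv k g` is a version of it. -/
structure MemH (k : ℕ) (g : ℝ → ℝ) : Prop where
  memLp : ∀ j ≤ k, MemLp (iteratedDeriv j g) 2 volume
  integral_eq_sub : ∀ j < k, ∀ a b : ℝ,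
    ∫ x in a..b, iteratedDeriv (j + 1) g x = iteratedDeriv j g b - iteratedDeriv j g a

/-- The `H^k` norm `(∑_{j ≤ k} ‖∂^j g‖²_{L²})^{1/2}`, as an extended number (meaningful if
`MemH k g`). -/
noncomputable def hNorm (k : ℕ) (g : ℝ → ℝ) : ℝ≥0∞ :=
  (∑ j ∈ Finset.range (k + 1), ∫⁻ x, ‖iteratedDeriv j g x‖ₑ ^ 2) ^ (1 / 2 : ℝ)

/-- `u ∈ C([0,T]; H^k(ℝ))`, where `u t x` is the value at time `t` and place `x`. -/
structure MemCH (k : ℕ) (T : ℝ) (u : ℝ → ℝ → ℝ) : Prop where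
  memH : ∀ t ∈ Icc 0 T, MemH k (u t)
  tendsto : ∀ t ∈ Icc 0 T, Tendsto (fun s => hNorm k (u s - u t)) (𝓝[Icc 0 T] t) (𝓝 0)

/-- `‖u‖_{L^∞_{[0,T]} H^k}`. -/
noncomputable def supHNorm (k : ℕ) (T : ℝ) (u : ℝ → ℝ → ℝ) : ℝ≥0∞ :=
  ⨆ t ∈ Icc 0 T, hNorm k (u t)

/-! ### Functions of `(z, x, t)`: partial derivatives and regularity classes -/

/-- The time interval on which the nonlinearity is controlled. -/
def timeInterval : Set ℝ := Icc (-1) 1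

/-- `∂_{z_j} g (z, x, t)`. -/
noncomputable def partialZ {d : ℕ} (j : Fin d) (g : (Fin d → ℝ) → ℝ → ℝ → ℝ)
    (z : Fin d → ℝ) (x t : ℝ) : ℝ :=
  deriv (fun s => g (Function.update z j s) x t) (z j)

/-- `D α β γ = ∂_t^α ∂_z^β ∂_x^γ g` for `α ≤ 1`, `|β| ≤ m` and `γ ≤ n` on
`ℝ^d × ℝ × [-1,1]`, all of these derivatives being classical, continuous in `(z,t)`,
measurable in `x`, and bounded for `z` in bounded sets, uniformly in `x` and `t ∈ [-1,1]`. -/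
structure IsJet {d : ℕ} (m n : ℕ) (g : (Fin d → ℝ) → ℝ → ℝ → ℝ)
    (D : ℕ → (Fin d → ℕ) → ℕ → (Fin d → ℝ) → ℝ → ℝ → ℝ) : Prop where
  zero : ∀ z x, ∀ t ∈ timeInterval, D 0 0 0 z x t = g z x t
  deriv_t : ∀ β γ, ∑ i, β i ≤ m → γ ≤ n → ∀ z x, ∀ t ∈ timeInterval,
    HasDerivWithinAt (fun s => D 0 β γ z x s) (D 1 β γ z x t) timeInterval t
  deriv_z : ∀ α ≤ 1, ∀ β γ, ∑ i, β i < m → γ ≤ n → ∀ i z x, ∀ t ∈ timeInterval,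
    HasDerivAt (fun s => D α β γ (Function.update z i s) x t)
      (D α (β + Pi.single i 1) γ z x t) (z i)
  deriv_x : ∀ α ≤ 1, ∀ β γ, ∑ i, β i ≤ m → γ < n → ∀ z x, ∀ t ∈ timeInterval,
    HasDerivAt (fun y => D α β γ z y t) (D α β (γ + 1) z x t) x
  continuous_zt : ∀ α ≤ 1, ∀ β γ, ∑ i, β i ≤ m → γ ≤ n → ∀ x,
    ContinuousOn (fun p : (Fin d → ℝ) × ℝ => D α β γ p.1 x p.2) (univ ×ˢ timeInterval)
  measurable_x : ∀ α ≤ 1, ∀ β γ, ∑ i, β i ≤ m → γ ≤ n → ∀ z, ∀ t ∈ timeInterval,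
    Measurable (fun x => D α β γ z x t)
  bounded : ∀ α ≤ 1, ∀ β γ, ∑ i, β i ≤ m → γ ≤ n → ∀ R : ℝ, ∃ C : ℝ,
    ∀ z, ‖z‖ ≤ R → ∀ x, ∀ t ∈ timeInterval, |D α β γ z x t| ≤ C

/-- `g ∈ C^1_t C^m_z L^∞_x`, with bounds that are locally uniform in `z`. -/
def RegularL {d : ℕ} (m : ℕ) (g : (Fin d → ℝ) → ℝ → ℝ → ℝ) : Prop :=
  ∃ D, IsJet m 0 g D

/-- `g ∈ C^1_t C^m_z W^{n+1,∞}_x`, with bounds that are locally uniform in `z`. A bounded `(n+1)`-st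
weak derivative in `x` means that the `n`-th derivative in `x` is Lipschitz. -/
def RegularW {d : ℕ} (m n : ℕ) (g : (Fin d → ℝ) → ℝ → ℝ → ℝ) : Prop :=
  ∃ D, IsJet m n g D ∧ ∀ α ≤ 1, ∀ β, ∑ i, β i ≤ m → ∀ R : ℝ, ∃ C : ℝ,
    ∀ z, ‖z‖ ≤ R → ∀ x y, ∀ t ∈ timeInterval, |D α β n z x t - D α β n z y t| ≤ C * |x - y|

/-- `(v, ∂_x v, …, ∂_x^(d-1) v)` at the point `x`. The coordinate `z_j` stands for `∂_x^j v`. -/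
noncomputable def jet (d : ℕ) (v : ℝ → ℝ) (x : ℝ) : Fin d → ℝ :=
  fun j => iteratedDeriv j v x

/-- The nonlinearity `f (z, x, t)`, where `z = (z_0, …, z_3)` stands for `(u, u_x, u_xx, u_xxx)`,
is in `C^1_t C^11_z W^{11,∞}_x`. -/
def ConditionA1 (f : (Fin 4 → ℝ) → ℝ → ℝ → ℝ) : Prop := RegularW 11 10 f

/-- The modified diffusion ratio has the form
`f_{z_2} / f_{z_3} (∂^3 v) = ∂_x [g_D (∂^2 v)] + g_H (∂^3 v)` wherever `f_{z_3} (∂^3 v) ≠ 0`,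
where `g_H` vanishes to second order at `z = 0`. -/
def ConditionA2 (f : (Fin 4 → ℝ) → ℝ → ℝ → ℝ) : Prop :=
  ∃ (gD : (Fin 3 → ℝ) → ℝ → ℝ → ℝ) (gH : (Fin 4 → ℝ) → ℝ → ℝ → ℝ),
    RegularL 0 gD ∧ RegularL 2 gH ∧
    (∀ x, ∀ t ∈ timeInterval, gH 0 x t = 0 ∧ ∀ j, partialZ j gH 0 x t = 0) ∧
    ∀ v, MemH 7 v → ∀ t ∈ timeInterval, ∀ x, partialZ 3 f (jet 4 v x) x t ≠ 0 →
      HasDerivAt (fun y => gD (jet 3 v y) y t)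
        (partialZ 2 f (jet 4 v x) x t / partialZ 3 f (jet 4 v x) x t - gH (jet 4 v x) x t) x

/-- There is no forcing: `f (0, x, t) = 0`. -/
def ConditionA3 (f : (Fin 4 → ℝ) → ℝ → ℝ → ℝ) : Prop :=
  ∀ x, ∀ t ∈ timeInterval, f 0 x t = 0

/-! ### The regularized equation -/

/-- `u` is a solution on `[0,T]` of `∂_t u + f (∂_x^3 u, …, u, x, t) = -ε ∂_x^4 u` with
initial value `u₀`, in the class `C([0,T]; H^8)` if `ε > 0` and `C([0,T]; H^7)` if `ε = 0`. -/
structure IsSolution (f : (Fin 4 → ℝ) → ℝ → ℝ → ℝ) (ε : ℝ≥0) (T : ℝ) (u₀ : ℝ → ℝ)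
    (u : ℝ → ℝ → ℝ) : Prop where
  mem : MemCH (if ε = 0 then 7 else 8) T u
  equation : ∀ t ∈ Icc 0 T, ∀ x,
    HasDerivWithinAt (fun s => u s x)
      (-f (jet 4 (u t) x) x t - (ε : ℝ) * iteratedDeriv 4 (u t) x) (Icc 0 T) t
  initial : u 0 = u₀

/-- `λ (∂^3 v) = ‖1 / f_{z_3} (∂^3 v, ·, t)‖_{L^∞}`, where `1 / 0 = ∞`. -/
noncomputable def dispersion (f : (Fin 4 → ℝ) → ℝ → ℝ → ℝ) (t : ℝ) (v : ℝ → ℝ) : ℝ≥0∞ :=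
  essSup (fun x => ‖partialZ 3 f (jet 4 v x) x t‖ₑ⁻¹) volume

/-- `M_ε(t) = ‖u‖_{L^∞_{[0,t]} H^7} + ε ‖u‖_{L^∞_{[0,t]} H^8}` (with `0 · ∞ = 0`). -/
noncomputable def highNorm (ε : ℝ≥0) (u : ℝ → ℝ → ℝ) (t : ℝ) : ℝ≥0∞ :=
  supHNorm 7 t u + ε * supHNorm 8 t u

/-- `k(t) = sup_{0 ≤ s ≤ t} max (‖u(s)‖_{H^4}, λ(∂^3 u(s)))`. -/
noncomputable def lowNorm (f : (Fin 4 → ℝ) → ℝ → ℝ → ℝ) (u : ℝ → ℝ → ℝ) (t : ℝ) : ℝ≥0∞ :=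
  ⨆ s ∈ Icc 0 t, max (hNorm 4 (u s)) (dispersion f s (u s))

/-- `sup_{τ ∈ [0,T]} (M_ε(τ) + k(τ))`. -/
noncomputable def controlNorm (f : (Fin 4 → ℝ) → ℝ → ℝ → ℝ) (ε : ℝ≥0) (u : ℝ → ℝ → ℝ)
    (T : ℝ) : ℝ≥0∞ :=
  ⨆ τ ∈ Icc 0 T, (highNorm ε u τ + lowNorm f u τ)

end DispersiveFlow

/-! Let w = u - u', p = f_{z_3}, r = f_{z_2}, all along the solution u, and write p' for the total
x-derivative of p. Differentiating the equation three times, the difference of the nonlinear terms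
is p w_6 + (r + 3p') w_5 + m w_4 plus a remainder controlled by the derivatives of w of order at
most three (`Expansion.exists_remainder_bound`). Tested against W = w_3 in L², the second order part
r + 3p' would lose a derivative. The weight ω = |p| exp(2/3 ∫ r/p) repairs this, because (ωp)' =
(2/3) ω (r + 3p') is exactly the relation under which the terms in (W')² cancel on integration by
parts (`neg_integral_le_of_hasDerivAt`). Hence the energy ∫ w² + ∫ ω W², which is equivalent to the
squared H^3 norm, obeys a closed estimate (`Expansion.exists_energy_bound`). The viscous terms are
treated as sources: they carry at most seven derivatives of u and u', so their L² size is O(ε + ε').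

The weight has to be bounded above and below and Lipschitz in time. By (A2) the phase ∫ r/p consists
of boundary values of g_D and an integral of g_H; the latter is bounded because g_H is quadratic at
z = 0 and u lies in H^3 (`RatioStructure.exists_phase_bound`). For the time dependence one needs g_D
to be Lipschitz in z, although it is only assumed continuous. This follows from (A2) itself: alter v
by a compactly supported function with prescribed 2-jet at x₀, and integrate the identity for ∂_x
g_D from x₀ to a point where the two functions agree again (`RatioStructure.exists_lip_z`,
`RatioStructure.exists_phase_lip`).

Since the weight is only Lipschitz in t, the energy is never differentiated. Its increments are
estimated up to an error quadratic in the time step (`Expansion.exists_energy_growth`), which bounds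
the right lower Dini derivative, and Grönwall's inequality applies (`le_exp_mul_of_growth`). The
outcome, `exists_hThreeSq_sub_le`, bounds the squared H^3 norm of w on all of [0,T] by its initial
value and (ε + ε')². This is stronger than both inequalities of the proposition: the first only adds
a nonnegative term, and T₁ = 1 suffices for the second. Uniqueness is the case ε = ε' = 0 with equal
data. -/

namespace DispersiveFlow

/-! ### Elements of `H^k(ℝ)` -/

section Sobolev

variable {k j : ℕ} {g h : ℝ → ℝ}

theorem MemH.mono {l : ℕ} (hg : MemH k g) (hl : l ≤ k) : MemH l g :=
  ⟨fun j hj => hg.memLp j (hj.trans hl), fun j hj => hg.integral_eq_sub j (hj.trans_le hl)⟩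

theorem MemH.locallyIntegrable (hg : MemH k g) (hj : j ≤ k) :
    LocallyIntegrable (iteratedDeriv j g) volume :=
  (hg.memLp j hj).locallyIntegrable (by norm_num)

theorem MemH.intervalIntegrable (hg : MemH k g) (hj : j ≤ k) (a b : ℝ) :
    IntervalIntegrable (iteratedDeriv j g) volume a b :=
  intervalIntegrable_iff.mpr <|
    ((hg.locallyIntegrable hj).integrableOn_isCompact isCompact_uIcc).mono_set uIoc_subset_uIcc

theorem MemH.continuous (hg : MemH k g) (hj : j < k) : Continuous (iteratedDeriv j g) := by
  have h : iteratedDeriv j g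
      = fun b => iteratedDeriv j g 0 + ∫ x in (0 : ℝ)..b, iteratedDeriv (j + 1) g x := by
    ext b; rw [hg.integral_eq_sub j hj]; ring
  rw [h]
  exact continuous_const.add
    (intervalIntegral.continuous_primitive (fun a b => hg.intervalIntegrable hj a b) 0)

theorem MemH.hasDerivAt (hg : MemH k g) (hj : j + 1 < k) (x : ℝ) :
    HasDerivAt (iteratedDeriv j g) (iteratedDeriv (j + 1) g x) x := by
  have h : iteratedDeriv j g
      = fun b => iteratedDeriv j g 0 + ∫ x in (0 : ℝ)..b, iteratedDeriv (j + 1) g x := by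
    ext b; rw [hg.integral_eq_sub j (by omega)]; ring
  have hc := hg.continuous hj
  conv => enter [1]; rw [h]
  exact (intervalIntegral.integral_hasDerivAt_right (hg.intervalIntegrable hj.le 0 x)
    (hc.stronglyMeasurableAtFilter _ _) hc.continuousAt).const_add _

theorem MemH.ae_hasDerivAt (hg : MemH k g) (hj : j < k) :
    ∀ᵐ x, HasDerivAt (iteratedDeriv j g) (iteratedDeriv (j + 1) g x) x := by
  have h : iteratedDeriv j g
      = fun b => iteratedDeriv j g 0 + ∫ x in (0 : ℝ)..b, iteratedDeriv (j + 1) g x := by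
    ext b; rw [hg.integral_eq_sub j hj]; ring
  filter_upwards [LocallyIntegrable.ae_hasDerivAt_integral (hg.locallyIntegrable hj)] with x hx
  conv => enter [1]; rw [h]
  exact (hx 0).const_add _

theorem MemH.contDiff (hg : MemH (k + 1) g) : ContDiff ℝ k g := by
  refine contDiff_nat_iff_iteratedDeriv.2 ⟨fun m hm => hg.continuous (by omega), fun m hm x => ?_⟩
  exact (hg.hasDerivAt (by omega) x).differentiableAt

theorem MemH.iteratedDeriv_sub (hg : MemH k g) (hh : MemH k h) (hj : j < k) (x : ℝ) :
    iteratedDeriv j (g - h) x = iteratedDeriv j g x - iteratedDeriv j h x := by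
  obtain ⟨k, rfl⟩ : ∃ l, k = l + 1 := ⟨k - 1, by omega⟩
  have hjk : ((j : ℕ) : WithTop ℕ∞) ≤ k := by exact_mod_cast Nat.lt_succ_iff.mp hj
  exact _root_.iteratedDeriv_sub (hg.contDiff.of_le hjk).contDiffAt (hh.contDiff.of_le hjk).contDiffAt

/-- At the top order j = k the derivative exists classically only almost everywhere, by Lebesgue
differentiation of the primitive, so additivity can hold only up to a null set there. -/
theorem MemH.ae_iteratedDeriv_sub (hg : MemH k g) (hh : MemH k h) (hj : j ≤ k) :
    iteratedDeriv j (g - h) =ᵐ[volume] iteratedDeriv j g - iteratedDeriv j h := by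
  rcases j with _ | j
  · simp
  · filter_upwards [hg.ae_hasDerivAt hj, hh.ae_hasDerivAt hj] with x h1 h2
    rw [iteratedDeriv_succ]
    have : iteratedDeriv j (g - h) = iteratedDeriv j g - iteratedDeriv j h := by
      ext y; exact hg.iteratedDeriv_sub hh hj y
    rw [this, (h1.sub h2).deriv, Pi.sub_apply]

theorem MemH.sub (hg : MemH k g) (hh : MemH k h) : MemH k (g - h) where
  memLp j hj := ((hg.memLp j hj).sub (hh.memLp j hj)).ae_eq (hg.ae_iteratedDeriv_sub hh hj).symm
  integral_eq_sub j hj a b := by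
    rw [intervalIntegral.integral_congr_ae
      ((hg.ae_iteratedDeriv_sub hh hj).mono fun x hx _ => hx), hg.iteratedDeriv_sub hh hj,
      hg.iteratedDeriv_sub hh hj]
    simp only [Pi.sub_apply]
    rw [intervalIntegral.integral_sub (hg.intervalIntegrable hj a b)
      (hh.intervalIntegrable hj a b), hg.integral_eq_sub j hj, hh.integral_eq_sub j hj]
    ring

theorem MemH.zero (k : ℕ) : MemH k (0 : ℝ → ℝ) where
  memLp j _ := by
    have : iteratedDeriv j (0 : ℝ → ℝ) = 0 := by ext x; simp
    rw [this]; exact MemLp.zero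
  integral_eq_sub j _ a b := by simp

theorem memH_of_contDiff_of_hasCompactSupport (hg : ∀ n : ℕ, ContDiff ℝ n g)
    (hc : HasCompactSupport g) :
    MemH k g := by
  have hcont : ∀ i, Continuous (iteratedDeriv i g) := fun i =>
    (hg i).continuous_iteratedDeriv'
  have hsupp : ∀ i, HasCompactSupport (iteratedDeriv i g) := by
    intro i
    induction i with
    | zero => simpa using hc
    | succ i ih => rw [iteratedDeriv_succ]; exact ih.deriv
  refine ⟨fun j _ => (hcont j).memLp_of_hasCompactSupport (hsupp j), fun j _ a b => ?_⟩
  refine intervalIntegral.integral_eq_sub_of_hasDerivAt (fun x _ => ?_)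
    ((hcont _).intervalIntegrable _ _)
  rw [iteratedDeriv_succ]
  exact (((by exact_mod_cast hg (j + 1) : ContDiff ℝ (j + 1) g).differentiable_iteratedDeriv' j) x).hasDerivAt

theorem MemH.integrable_sq (hg : MemH k g) (hj : j ≤ k) :
    Integrable (fun x => iteratedDeriv j g x ^ 2) volume :=
  (hg.memLp j hj).integrable_sq

theorem MemH.hNorm_eq (hg : MemH k g) :
    hNorm k g = ENNReal.ofReal
      √(∑ j ∈ Finset.range (k + 1), ∫ x, iteratedDeriv j g x ^ 2) := by
  have h1 : ∀ j ∈ Finset.range (k + 1), ∫⁻ x, ‖iteratedDeriv j g x‖ₑ ^ 2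
      = ENNReal.ofReal (∫ x, iteratedDeriv j g x ^ 2) := by
    intro j hj
    rw [ofReal_integral_eq_lintegral_ofReal (hg.integrable_sq (by simpa [Nat.lt_succ_iff] using hj))
      (ae_of_all _ fun x => sq_nonneg _)]
    refine lintegral_congr fun x => ?_
    rw [← sq_abs, ENNReal.ofReal_pow (abs_nonneg _), Real.enorm_eq_ofReal_abs]
  rw [hNorm, Finset.sum_congr rfl h1, ← ENNReal.ofReal_sum_of_nonneg
    fun j _ => integral_nonneg fun x => sq_nonneg _, Real.sqrt_eq_rpow,
    ENNReal.ofReal_rpow_of_nonneg (Finset.sum_nonneg fun j _ => integral_nonneg fun x =>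
      sq_nonneg _) (by norm_num)]

theorem MemH.integral_sq_le (hg : MemH k g) {N : ℝ} (hN : 0 ≤ N) (h : hNorm k g ≤ ENNReal.ofReal N)
    (hj : j ≤ k) : ∫ x, iteratedDeriv j g x ^ 2 ≤ N ^ 2 := by
  rw [hg.hNorm_eq, ENNReal.ofReal_le_ofReal_iff hN, Real.sqrt_le_left hN] at h
  exact (Finset.single_le_sum (f := fun j => ∫ x, iteratedDeriv j g x ^ 2)
    (fun i _ => integral_nonneg fun x => sq_nonneg _)
    (Finset.mem_range.mpr (Nat.lt_succ_of_le hj))).trans h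

/-- Cauchy–Schwarz on a unit interval, in the form of the pointwise inequality |F| ≤ N/2 + F²/(2N).
-/
theorem intervalIntegral_abs_le_of_integral_sq_le {F : ℝ → ℝ} {N : ℝ} (hN : 0 < N)
    (hF : MemLp F 2 volume) (h : ∫ x, F x ^ 2 ≤ N ^ 2) (x : ℝ) :
    ∫ y in x..x + 1, |F y| ≤ N := by
  have hi : Integrable (fun x => F x ^ 2) volume := hF.integrable_sq
  have hFi : IntervalIntegrable F volume x (x + 1) := intervalIntegrable_iff.mpr <|
    ((hF.locallyIntegrable (by norm_num)).integrableOn_isCompact isCompact_uIcc).mono_set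
      uIoc_subset_uIcc
  have h1 : ∫ y in x..x + 1, |F y| ≤ ∫ y in x..x + 1, (N / 2 + F y ^ 2 / (2 * N)) := by
    refine intervalIntegral.integral_mono_on (by linarith) hFi.abs
      ((intervalIntegrable_const).add (hi.intervalIntegrable.div_const _)) fun y _ => ?_
    rw [div_add_div _ _ two_ne_zero (by positivity), le_div_iff₀ (by positivity)]
    nlinarith [sq_nonneg (|F y| - N), sq_abs (F y)]
  have h2 : ∫ y in x..x + 1, F y ^ 2 ≤ N ^ 2 := by
    rw [intervalIntegral.integral_of_le (by linarith)]
    exact (setIntegral_le_integral hi (ae_of_all _ fun y => sq_nonneg _)).trans h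
  rw [intervalIntegral.integral_add intervalIntegrable_const
    (hi.intervalIntegrable.div_const _)] at h1
  simp only [intervalIntegral.integral_div, intervalIntegral.integral_const, add_sub_cancel_left, one_smul] at h1
  have h3 : (∫ y in x..x + 1, F y ^ 2) / (2 * N) ≤ N / 2 := by
    rw [div_le_div_iff₀ (by positivity) two_pos]; nlinarith
  linarith

/-- Sobolev embedding: on [x, x+1] the function differs from its value at x by at most the L¹ norm
of its derivative, and averaging over the interval costs its own L¹ norm; each contributes N. -/
theorem MemH.abs_le (hg : MemH k g) {N : ℝ} (hN : 0 < N) (h : hNorm k g ≤ ENNReal.ofReal N)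
    (hj : j < k) (x : ℝ) : |iteratedDeriv j g x| ≤ 2 * N := by
  have h0 := intervalIntegral_abs_le_of_integral_sq_le hN (hg.memLp j hj.le)
    (hg.integral_sq_le hN.le h hj.le) x
  have h1 := intervalIntegral_abs_le_of_integral_sq_le hN (hg.memLp (j + 1) hj)
    (hg.integral_sq_le hN.le h hj) x
  have h2 : ∀ y ∈ Icc x (x + 1), |iteratedDeriv j g x| ≤ |iteratedDeriv j g y| + N := by
    intro y hy
    have h3 := hg.integral_eq_sub j hj x y
    have h4 : |∫ z in x..y, iteratedDeriv (j + 1) g z| ≤ N := by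
      refine (intervalIntegral.abs_integral_le_integral_abs hy.1).trans (le_trans ?_ h1)
      exact intervalIntegral.integral_mono_interval le_rfl hy.1 hy.2
        (ae_of_all _ fun _ => abs_nonneg _) (hg.intervalIntegrable hj _ _).abs
    rw [h3] at h4
    have := abs_sub_abs_le_abs_sub (iteratedDeriv j g x) (iteratedDeriv j g y)
    rw [abs_sub_comm] at this
    linarith
  have h5 : ∫ y in x..x + 1, |iteratedDeriv j g x| ≤ ∫ y in x..x + 1, (|iteratedDeriv j g y| + N) :=
    intervalIntegral.integral_mono_on (by linarith) intervalIntegrable_const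
      ((hg.intervalIntegrable hj.le _ _).abs.add intervalIntegrable_const) h2
  rw [intervalIntegral.integral_add (hg.intervalIntegrable hj.le _ _).abs
    intervalIntegrable_const] at h5
  simp only [intervalIntegral.integral_const, add_sub_cancel_left, one_smul] at h5
  linarith

end Sobolev

/-! ### Functions of `(z, x, t)` that are locally Lipschitz, uniformly in `x` and `t` -/

/-- Mean value inequality along a path that changes one coordinate at a time, so that only partial
derivatives are needed. With c = 0 it gives Lipschitz bounds, with c the gradient at z a first order
Taylor estimate. -/
theorem abs_sub_sub_sum_mul_le {d : ℕ} {k : (Fin d → ℝ) → ℝ} {p : Fin d → (Fin d → ℝ) → ℝ}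
    (hk : ∀ i z, HasDerivAt (fun s => k (Function.update z i s)) (p i z) (z i))
    (c : Fin d → ℝ) (η : ℝ) (z z' : Fin d → ℝ)
    (h : ∀ w, (∀ j, w j ∈ uIcc (z j) (z' j)) → ∀ i, |p i w - c i| ≤ η) :
    |k z' - k z - ∑ i, c i * (z' i - z i)| ≤ η * ∑ i, |z' i - z i| := by
  have key : ∀ s : Finset (Fin d), |k (s.piecewise z' z) - k z - ∑ i ∈ s, c i * (z' i - z i)|
      ≤ η * ∑ i ∈ s, |z' i - z i| := by
    intro s
    induction s using Finset.induction_on with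
    | empty => simp
    -- The intermediate point has the new coordinates in s and the old ones elsewhere; only
    -- coordinate i moves now, and the linear part c i is subtracted before the mean value
    -- inequality is applied.
    | insert i s hi ih =>
      set w := s.piecewise z' z with hw
      have hwi : w i = z i := by simp [hw, hi]
      have hwj : ∀ j, w j ∈ uIcc (z j) (z' j) := by
        intro j
        by_cases hj : j ∈ s
        · simp [hw, hj]
        · simp [hw, hj]
      have h1 : (insert i s).piecewise z' z = Function.update w i (z' i) := by
        rw [Finset.piecewise_insert]
      have hd : ∀ y ∈ uIcc (z i) (z' i), HasDerivWithinAt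
          (fun y => k (Function.update w i y) - c i * y)
          (p i (Function.update w i y) - c i) (uIcc (z i) (z' i)) y := by
        intro y _
        have := hk i (Function.update w i y)
        simp only [Function.update_idem, Function.update_self] at this
        simpa using (this.fun_sub ((hasDerivAt_id' y).const_mul (c i))).hasDerivWithinAt
      have h2 := (convex_uIcc (z i) (z' i)).norm_image_sub_le_of_norm_hasDerivWithin_le hd
        (C := η) (fun y hy => by
          refine h _ (fun j => ?_) i
          by_cases hj : j = i
          · subst hj; simpa using hy
          · simpa [hj] using hwj j) left_mem_uIcc right_mem_uIcc
      have h3 : Function.update w i (z i) = w := by rw [← hwi, Function.update_eq_self]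
      rw [h3, Real.norm_eq_abs, Real.norm_eq_abs] at h2
      rw [h1, Finset.sum_insert hi, Finset.sum_insert hi, mul_add]
      calc _ = |(k (Function.update w i (z' i)) - c i * z' i - (k w - c i * z i))
            + (k w - k z - ∑ i ∈ s, c i * (z' i - z i))| := by congr 1; ring
        _ ≤ _ := (abs_add_le _ _).trans (add_le_add h2 ih)
  simpa using key Finset.univ

theorem norm_le_of_mem_uIcc {d : ℕ} {z z' w : Fin d → ℝ} {R : ℝ} (hz : ‖z‖ ≤ R) (hz' : ‖z'‖ ≤ R)
    (hw : ∀ j, w j ∈ uIcc (z j) (z' j)) : ‖w‖ ≤ R := by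
  refine (pi_norm_le_iff_of_nonneg ((norm_nonneg _).trans hz)).2 fun j => ?_
  have h1 := (norm_le_pi_norm z j).trans hz
  have h2 := (norm_le_pi_norm z' j).trans hz'
  rw [Real.norm_eq_abs, abs_le] at *
  have := hw j
  rw [mem_uIcc] at this
  rcases this with h | h <;> constructor <;> linarith

theorem norm_sub_le_of_mem_uIcc {d : ℕ} {z z' w : Fin d → ℝ}
    (hw : ∀ j, w j ∈ uIcc (z j) (z' j)) : ‖w - z‖ ≤ ‖z' - z‖ := by
  refine (pi_norm_le_iff_of_nonneg (norm_nonneg _)).2 fun j => ?_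
  refine le_trans ?_ (norm_le_pi_norm (z' - z) j)
  simp only [Pi.sub_apply, Real.norm_eq_abs]
  exact abs_sub_left_of_mem_uIcc (hw j)

theorem sum_abs_le_card_mul_norm {d : ℕ} (z : Fin d → ℝ) : ∑ i, |z i| ≤ d * ‖z‖ := by
  have := Finset.sum_le_card_nsmul Finset.univ (fun i => |z i|) ‖z‖
    (fun i _ => by rw [← Real.norm_eq_abs]; exact norm_le_pi_norm z i)
  simpa using this

/-- `g` is bounded and Lipschitz for `z` in bounded sets, uniformly in `x` and `t`. -/
structure UnifLip {d : ℕ} (g : (Fin d → ℝ) → ℝ → ℝ → ℝ) : Prop where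
  bdd : ∀ R : ℝ, ∃ C : ℝ, ∀ z, ‖z‖ ≤ R → ∀ x, ∀ t ∈ timeInterval, |g z x t| ≤ C
  lip : ∀ R : ℝ, ∃ C : ℝ, 0 ≤ C ∧ ∀ z z', ‖z‖ ≤ R → ‖z'‖ ≤ R → ∀ x x', ∀ t ∈ timeInterval,
    ∀ t' ∈ timeInterval, |g z x t - g z' x' t'| ≤ C * (‖z - z'‖ + |x - x'| + |t - t'|)

section UnifLip

variable {d : ℕ} {g h : (Fin d → ℝ) → ℝ → ℝ → ℝ}

theorem UnifLip.const (c : ℝ) : UnifLip (fun (_ : Fin d → ℝ) _ _ => c) :=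
  ⟨fun _ => ⟨|c|, fun _ _ _ _ _ => le_rfl⟩, fun _ => ⟨0, le_rfl, by simp⟩⟩

theorem UnifLip.coord (j : Fin d) : UnifLip (fun (z : Fin d → ℝ) _ _ => z j) := by
  refine ⟨fun R => ⟨R, fun z hz _ _ _ => ?_⟩, fun R => ⟨1, zero_le_one, fun z z' _ _ x x' t _ t' _ => ?_⟩⟩
  · rw [← Real.norm_eq_abs]; exact (norm_le_pi_norm z j).trans hz
  · have := norm_le_pi_norm (z - z') j
    simp only [Pi.sub_apply, Real.norm_eq_abs] at this
    have h1 := abs_nonneg (x - x')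
    have h2 := abs_nonneg (t - t')
    linarith

theorem UnifLip.add (hg : UnifLip g) (hh : UnifLip h) :
    UnifLip (fun z x t => g z x t + h z x t) := by
  refine ⟨fun R => ?_, fun R => ?_⟩
  · obtain ⟨C, hC⟩ := hg.bdd R
    obtain ⟨C', hC'⟩ := hh.bdd R
    exact ⟨C + C', fun z hz x t ht =>
      (abs_add_le _ _).trans (add_le_add (hC z hz x t ht) (hC' z hz x t ht))⟩
  · obtain ⟨C, hC0, hC⟩ := hg.lip R
    obtain ⟨C', hC0', hC'⟩ := hh.lip R
    refine ⟨C + C', by positivity, fun z z' hz hz' x x' t ht t' ht' => ?_⟩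
    calc _ = |(g z x t - g z' x' t') + (h z x t - h z' x' t')| := by congr 1; ring
      _ ≤ _ := (abs_add_le _ _).trans (add_le_add (hC z z' hz hz' x x' t ht t' ht')
        (hC' z z' hz hz' x x' t ht t' ht'))
      _ = _ := by ring

theorem UnifLip.mul (hg : UnifLip g) (hh : UnifLip h) :
    UnifLip (fun z x t => g z x t * h z x t) := by
  refine ⟨fun R => ?_, fun R => ?_⟩
  · obtain ⟨C, hC⟩ := hg.bdd R
    obtain ⟨C', hC'⟩ := hh.bdd R
    refine ⟨C * C', fun z hz x t ht => ?_⟩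
    rw [abs_mul]
    exact mul_le_mul (hC z hz x t ht) (hC' z hz x t ht) (abs_nonneg _)
      ((abs_nonneg _).trans (hC z hz x t ht))
  · obtain ⟨B, hB⟩ := hg.bdd R
    obtain ⟨B', hB'⟩ := hh.bdd R
    obtain ⟨C, hC0, hC⟩ := hg.lip R
    obtain ⟨C', hC0', hC'⟩ := hh.lip R
    refine ⟨C * |B'| + |B| * C', by positivity, fun z z' hz hz' x x' t ht t' ht' => ?_⟩
    calc _ = |(g z x t - g z' x' t') * h z x t + g z' x' t' * (h z x t - h z' x' t')| := by
          congr 1; ring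
      _ ≤ (C * (‖z - z'‖ + |x - x'| + |t - t'|)) * |B'|
          + |B| * (C' * (‖z - z'‖ + |x - x'| + |t - t'|)) := by
        refine (abs_add_le _ _).trans ?_
        rw [abs_mul, abs_mul]
        have h1 := hC z z' hz hz' x x' t ht t' ht'
        have h2 := hC' z z' hz hz' x x' t ht t' ht'
        have h3 := (hB' z hz x t ht).trans (le_abs_self _)
        have h4 := (hB z' hz' x' t' ht').trans (le_abs_self _)
        gcongr
      _ = _ := by ring

theorem UnifLip.congr (hg : UnifLip g) (hgh : ∀ z x, ∀ t ∈ timeInterval, h z x t = g z x t) :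
    UnifLip h := by
  refine ⟨fun R => ?_, fun R => ?_⟩
  · obtain ⟨C, hC⟩ := hg.bdd R
    exact ⟨C, fun z hz x t ht => by rw [hgh z x t ht]; exact hC z hz x t ht⟩
  · obtain ⟨C, h0, hC⟩ := hg.lip R
    exact ⟨C, h0, fun z z' hz hz' x x' t ht t' ht' => by
      rw [hgh z x t ht, hgh z' x' t' ht']; exact hC z z' hz hz' x x' t ht t' ht'⟩

theorem UnifLip.continuousOn (hg : UnifLip g) :
    ContinuousOn (fun p : (Fin d → ℝ) × ℝ × ℝ => g p.1 p.2.1 p.2.2)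
      (univ ×ˢ univ ×ˢ timeInterval) := by
  rintro ⟨z, x, t⟩ ⟨-, -, ht⟩
  obtain ⟨C, _, hC⟩ := hg.lip (‖z‖ + 1)
  rw [ContinuousWithinAt, tendsto_iff_norm_sub_tendsto_zero]
  have h1 : Tendsto (fun p : (Fin d → ℝ) × ℝ × ℝ =>
      C * (‖p.1 - z‖ + |p.2.1 - x| + |p.2.2 - t|)) (𝓝 (z, x, t)) (𝓝 0) := by
    have : Continuous (fun p : (Fin d → ℝ) × ℝ × ℝ =>
      C * (‖p.1 - z‖ + |p.2.1 - x| + |p.2.2 - t|)) := by fun_prop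
    simpa using this.tendsto (z, x, t)
  refine squeeze_zero' (Eventually.of_forall fun _ => norm_nonneg _) ?_
    (h1.mono_left nhdsWithin_le_nhds)
  have h2 : ∀ᶠ p : (Fin d → ℝ) × ℝ × ℝ in 𝓝 (z, x, t), ‖p.1‖ < ‖z‖ + 1 :=
    (continuous_fst.norm.tendsto (z, x, t)).eventually (gt_mem_nhds (by simp))
  filter_upwards [h2.filter_mono nhdsWithin_le_nhds, self_mem_nhdsWithin] with p hp hpt
  exact hC _ _ hp.le (by linarith) _ _ _ hpt.2.2 _ ht

theorem UnifLip.exists_bound (hg : UnifLip g) (R : ℝ) : ∃ C : ℝ, 0 ≤ C ∧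
    (∀ z, ‖z‖ ≤ R → ∀ x, ∀ t ∈ timeInterval, |g z x t| ≤ C) ∧
    ∀ z z', ‖z‖ ≤ R → ‖z'‖ ≤ R → ∀ x x', ∀ t ∈ timeInterval,
    ∀ t' ∈ timeInterval, |g z x t - g z' x' t'| ≤ C * (‖z - z'‖ + |x - x'| + |t - t'|) := by
  obtain ⟨C, h⟩ := hg.bdd R
  obtain ⟨C', h0, h'⟩ := hg.lip R
  refine ⟨max C C', le_max_of_le_right h0, fun z hz x t ht => (h z hz x t ht).trans (le_max_left _ _),
    fun z z' hz hz' x x' t ht t' ht' => (h' z z' hz hz' x x' t ht t' ht').trans ?_⟩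
  gcongr
  exact le_max_right _ _

end UnifLip

/-! ### Symbols -/

/-- `gz`, `gx` are the partial derivatives of `g` in `z` and `x`, in the form of the chain rule. -/
def HasPartials (g : (Fin 4 → ℝ) → ℝ → ℝ → ℝ) (gz : Fin 4 → (Fin 4 → ℝ) → ℝ → ℝ → ℝ)
    (gx : (Fin 4 → ℝ) → ℝ → ℝ → ℝ) : Prop :=
  ∀ t ∈ timeInterval, ∀ (y : ℝ → Fin 4 → ℝ) (y' : Fin 4 → ℝ) (x : ℝ), HasDerivAt y y' x →
    HasDerivAt (fun s => g (y s) s t) (∑ j, gz j (y x) x t * y' j + gx (y x) x t) x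

/-- Symbols of order `n`: functions with `n` derivatives in `(z, x)` in the class `UnifLip`. -/
def Symb : ℕ → ((Fin 4 → ℝ) → ℝ → ℝ → ℝ) → Prop
  | 0, g => UnifLip g
  | n + 1, g => UnifLip g ∧ ∃ gz gx, (∀ j, Symb n (gz j)) ∧ Symb n gx ∧ HasPartials g gz gx

section Symb

variable {n : ℕ} {g h : (Fin 4 → ℝ) → ℝ → ℝ → ℝ}

theorem Symb.unifLip : ∀ {n : ℕ}, Symb n g → UnifLip g
  | 0, hg => hg
  | _ + 1, hg => hg.1

theorem Symb.of_succ : ∀ {n : ℕ} {g : (Fin 4 → ℝ) → ℝ → ℝ → ℝ}, Symb (n + 1) g → Symb n g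
  | 0, _, hg => hg.1
  | _ + 1, _, ⟨h, gz, gx, hz, hx, hp⟩ => ⟨h, gz, gx, fun j => (hz j).of_succ, hx.of_succ, hp⟩

theorem Symb.mono {m : ℕ} (hg : Symb n g) (hm : m ≤ n) : Symb m g := by
  induction n, hm using Nat.le_induction with
  | base => exact hg
  | succ k _ ih => exact ih hg.of_succ

theorem Symb.const (n : ℕ) (c : ℝ) : Symb n (fun _ _ _ => c) := by
  induction n generalizing c with
  | zero => exact UnifLip.const c
  | succ n ih =>
    refine ⟨UnifLip.const c, fun _ _ _ _ => 0, fun _ _ _ => 0, fun _ => ih 0, ih 0, ?_⟩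
    intro t _ y y' x _
    simpa using hasDerivAt_const x c

theorem Symb.coord (n : ℕ) (j : Fin 4) : Symb n (fun z _ _ => z j) := by
  cases n with
  | zero => exact UnifLip.coord j
  | succ n =>
    refine ⟨UnifLip.coord j, fun i _ _ _ => if i = j then 1 else 0, fun _ _ _ => 0,
      fun _ => Symb.const n _, Symb.const n _, ?_⟩
    intro t _ y y' x hy
    simpa using hasDerivAt_pi.1 hy j

theorem Symb.add (hg : Symb n g) (hh : Symb n h) : Symb n (fun z x t => g z x t + h z x t) := by
  induction n generalizing g h with
  | zero => exact UnifLip.add hg hh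
  | succ n ih =>
    obtain ⟨h1, gz, gx, hz, hx, hp⟩ := hg
    obtain ⟨h1', gz', gx', hz', hx', hp'⟩ := hh
    refine ⟨h1.add h1', _, _, fun j => ih (hz j) (hz' j), ih hx hx', ?_⟩
    intro t ht y y' x hy
    refine ((hp t ht y y' x hy).add (hp' t ht y y' x hy)).congr_deriv ?_
    simp only [add_mul, Finset.sum_add_distrib]
    ring

theorem Symb.mul (hg : Symb n g) (hh : Symb n h) : Symb n (fun z x t => g z x t * h z x t) := by
  induction n generalizing g h with
  | zero => exact UnifLip.mul hg hh
  | succ n ih =>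
    have hg0 := hg.of_succ
    have hh0 := hh.of_succ
    obtain ⟨h1, gz, gx, hz, hx, hp⟩ := hg
    obtain ⟨h1', gz', gx', hz', hx', hp'⟩ := hh
    refine ⟨h1.mul h1', _, _, fun j => (ih (hz j) hh0).add (ih hg0 (hz' j)),
      (ih hx hh0).add (ih hg0 hx'), ?_⟩
    intro t ht y y' x hy
    refine ((hp t ht y y' x hy).mul (hp' t ht y y' x hy)).congr_deriv ?_
    simp only [add_mul, Finset.sum_add_distrib, Finset.sum_mul, Finset.mul_sum, mul_add]
    simp only [mul_comm, mul_left_comm]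
    ring

end Symb

/-! ### From bounded derivatives to uniform Lipschitz estimates -/

section Jets

variable {d m n : ℕ} {g : (Fin d → ℝ) → ℝ → ℝ → ℝ}
  {D : ℕ → (Fin d → ℕ) → ℕ → (Fin d → ℝ) → ℝ → ℝ → ℝ}

theorem sum_add_single (β : Fin d → ℕ) (i : Fin d) :
    ∑ j, (β + Pi.single i 1 : Fin d → ℕ) j = ∑ j, β j + 1 := by
  simp [Finset.sum_add_distrib, Pi.single_apply]

theorem IsJet.exists_lip_z (hD : IsJet m n g D) {α γ : ℕ} (hα : α ≤ 1) {β : Fin d → ℕ}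
    (hβ : ∑ i, β i < m) (hγ : γ ≤ n) (R : ℝ) : ∃ C : ℝ, 0 ≤ C ∧ ∀ z z', ‖z‖ ≤ R → ‖z'‖ ≤ R →
      ∀ x, ∀ t ∈ timeInterval, |D α β γ z x t - D α β γ z' x t| ≤ C * ‖z - z'‖ := by
  have h1 : ∀ i, ∃ C : ℝ, ∀ z, ‖z‖ ≤ R → ∀ x, ∀ t ∈ timeInterval,
      |D α (β + Pi.single i 1) γ z x t| ≤ C := fun i =>
    hD.bounded α hα _ γ (by rw [sum_add_single]; omega) hγ R
  choose C hC using h1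
  refine ⟨(∑ i, |C i|) * d, by positivity, fun z z' hz hz' x t ht => ?_⟩
  have h2 := abs_sub_sub_sum_mul_le (k := fun z => D α β γ z x t)
    (p := fun i z => D α (β + Pi.single i 1) γ z x t)
    (fun i z => hD.deriv_z α hα β γ hβ hγ i z x t ht) 0 (∑ i, |C i|) z' z
    (fun w hw i => by
      have h3 := (hC i w (norm_le_of_mem_uIcc hz' hz hw) x t ht).trans (le_abs_self _)
      simpa using h3.trans (Finset.single_le_sum (f := fun i => |C i|)
        (fun i _ => abs_nonneg _) (Finset.mem_univ i)))
  simp only [Pi.zero_apply, zero_mul, Finset.sum_const_zero, sub_zero] at h2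
  refine h2.trans ?_
  rw [mul_assoc]
  exact mul_le_mul_of_nonneg_left (sum_abs_le_card_mul_norm (z - z')) (by positivity)

theorem IsJet.exists_lip_t (hD : IsJet m n g D) {γ : ℕ} {β : Fin d → ℕ}
    (hβ : ∑ i, β i ≤ m) (hγ : γ ≤ n) (R : ℝ) : ∃ C : ℝ, 0 ≤ C ∧ ∀ z, ‖z‖ ≤ R →
      ∀ x, ∀ t ∈ timeInterval, ∀ t' ∈ timeInterval,
        |D 0 β γ z x t - D 0 β γ z x t'| ≤ C * |t - t'| := by
  obtain ⟨C, hC⟩ := hD.bounded 1 le_rfl β γ hβ hγ R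
  refine ⟨|C|, abs_nonneg _, fun z hz x t ht t' ht' => ?_⟩
  exact (convex_Icc (-1 : ℝ) 1).norm_image_sub_le_of_norm_hasDerivWithin_le
    (fun s hs => hD.deriv_t β γ hβ hγ z x s hs)
    (fun s hs => (hC z hz x s hs).trans (le_abs_self _)) ht' ht

theorem IsJet.exists_lip_x (hD : IsJet m n g D) {γ : ℕ} {β : Fin d → ℕ}
    (hβ : ∑ i, β i ≤ m) (hγ : γ < n) (R : ℝ) : ∃ C : ℝ, ∀ z, ‖z‖ ≤ R →
      ∀ x x', ∀ t ∈ timeInterval, |D 0 β γ z x t - D 0 β γ z x' t| ≤ C * |x - x'| := by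
  obtain ⟨C, hC⟩ := hD.bounded 0 zero_le_one β (γ + 1) hβ hγ R
  refine ⟨C, fun z hz x x' t ht => ?_⟩
  exact convex_univ.norm_image_sub_le_of_norm_hasDerivWithin_le
    (fun y _ => (hD.deriv_x 0 zero_le_one β γ hβ hγ z y t ht).hasDerivWithinAt)
    (fun y _ => hC z hz y t ht) (mem_univ x') (mem_univ x)

/-- Each variable uses a different source: z spends one further z-derivative (hence the strict
inequality for β), t uses the bounded first time derivative, and x uses the next x-derivative or, at
the top order γ = n, the Lipschitz condition. -/
theorem IsJet.unifLip (hD : IsJet m n g D)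
    (hW : ∀ α ≤ 1, ∀ β, ∑ i, β i ≤ m → ∀ R : ℝ, ∃ C : ℝ,
      ∀ z, ‖z‖ ≤ R → ∀ x y, ∀ t ∈ timeInterval, |D α β n z x t - D α β n z y t| ≤ C * |x - y|)
    {β : Fin d → ℕ} (hβ : ∑ i, β i < m) {γ : ℕ} (hγ : γ ≤ n) : UnifLip (D 0 β γ) := by
  refine ⟨hD.bounded 0 zero_le_one β γ hβ.le hγ, fun R => ?_⟩
  obtain ⟨C₁, h₁, hC₁⟩ := hD.exists_lip_z zero_le_one hβ hγ R
  obtain ⟨C₂, h₂, hC₂⟩ := hD.exists_lip_t hβ.le hγ R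
  obtain ⟨C₃, hC₃⟩ : ∃ C : ℝ, ∀ z, ‖z‖ ≤ R →
      ∀ x x', ∀ t ∈ timeInterval, |D 0 β γ z x t - D 0 β γ z x' t| ≤ C * |x - x'| := by
    rcases hγ.lt_or_eq with h | rfl
    · exact hD.exists_lip_x hβ.le h R
    · exact hW 0 zero_le_one β hβ.le R
  refine ⟨C₁ + C₂ + |C₃|, by positivity, fun z z' hz hz' x x' t ht t' ht' => ?_⟩
  have e1 := hC₁ z z' hz hz' x t ht
  have e2 := hC₂ z' hz' x' t ht t' ht'
  have e3 := (hC₃ z' hz' x x' t ht).trans (mul_le_mul_of_nonneg_right (le_abs_self _) (abs_nonneg _))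
  calc _ = |(D 0 β γ z x t - D 0 β γ z' x t) + (D 0 β γ z' x t - D 0 β γ z' x' t)
        + (D 0 β γ z' x' t - D 0 β γ z' x' t')| := by congr 1; ring
    _ ≤ C₁ * ‖z - z'‖ + |C₃| * |x - x'| + C₂ * |t - t'| :=
      (abs_add_three _ _ _).trans (by gcongr)
    _ ≤ _ := by
      have a1 := norm_nonneg (z - z')
      have a2 := abs_nonneg (x - x')
      have a3 := abs_nonneg (t - t')
      have a4 := abs_nonneg C₃
      nlinarith [mul_nonneg h₁ a2, mul_nonneg h₁ a3, mul_nonneg h₂ a1, mul_nonneg h₂ a2,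
        mul_nonneg a4 a1, mul_nonneg a4 a3]

end Jets

/-- Lipschitz partial derivatives make the Taylor remainder quadratic, so g is Fréchet
differentiable in (z, x) and the chain rule along curves follows. -/
theorem hasPartials_of_unifLip {g gx : (Fin 4 → ℝ) → ℝ → ℝ → ℝ}
    {gz : Fin 4 → (Fin 4 → ℝ) → ℝ → ℝ → ℝ} (hz : ∀ j, UnifLip (gz j)) (hx : UnifLip gx)
    (hdz : ∀ i z x, ∀ t ∈ timeInterval,
      HasDerivAt (fun s => g (Function.update z i s) x t) (gz i z x t) (z i))
    (hdx : ∀ z x, ∀ t ∈ timeInterval, HasDerivAt (fun y => g z y t) (gx z x t) x) :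
    HasPartials g gz gx := by
  intro t ht y y' x₀ hy
  set z₀ := y x₀ with hz₀
  let L : (Fin 4 → ℝ) × ℝ →L[ℝ] ℝ :=
    (∑ j, gz j z₀ x₀ t • ContinuousLinearMap.proj j).comp (ContinuousLinearMap.fst ℝ _ _)
      + gx z₀ x₀ t • ContinuousLinearMap.snd ℝ _ _
  have hL : ∀ p : (Fin 4 → ℝ) × ℝ, L p = ∑ j, gz j z₀ x₀ t * p.1 j + gx z₀ x₀ t * p.2 := by
    intro p; simp [L]
  have key : HasFDerivAt (fun p : (Fin 4 → ℝ) × ℝ => g p.1 p.2 t) L (z₀, x₀) := by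
    have h1 : ∀ j, ∃ C : ℝ, 0 ≤ C ∧ _ := fun j => (hz j).lip (‖z₀‖ + 1)
    choose C hC0 hC using h1
    obtain ⟨Cx, hCx0, hCx⟩ := hx.lip (‖z₀‖ + 1)
    have hev : ∀ᶠ p : (Fin 4 → ℝ) × ℝ in 𝓝 (z₀, x₀), ‖p.1‖ < ‖z₀‖ + 1 :=
      (continuous_fst.norm.tendsto (z₀, x₀)).eventually (gt_mem_nhds (by simp))
    refine .of_isLittleO <| Asymptotics.IsBigO.trans_isLittleO
      (g := fun p : (Fin 4 → ℝ) × ℝ => ‖p - (z₀, x₀)‖ ^ 2) ?_ ?_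
    · refine Asymptotics.IsBigO.of_bound ((∑ j, C j) * 4 + Cx * 2) ?_
      filter_upwards [hev] with p hp
      obtain ⟨z, x⟩ := p
      have hzn : ‖z - z₀‖ ≤ ‖(z, x) - (z₀, x₀)‖ := by
        exact norm_fst_le ((z, x) - (z₀, x₀))
      have hxn : |x - x₀| ≤ ‖(z, x) - (z₀, x₀)‖ := by
        exact norm_snd_le ((z, x) - (z₀, x₀))
      set δ := ‖(z, x) - (z₀, x₀)‖ with hδ
      have hδ0 : 0 ≤ δ := norm_nonneg _
      have e1 := abs_sub_sub_sum_mul_le (k := fun z => g z x₀ t) (p := fun i z => gz i z x₀ t)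
        (fun i z => hdz i z x₀ t ht) (fun i => gz i z₀ x₀ t) ((∑ j, C j) * δ) z₀ z
        -- First move z at fixed x₀, then x at fixed z; in both steps the partial derivative stays
        -- within O(δ) of its value at the base point.
        (fun w hw i => by
          have h3 := hC i w z₀ (norm_le_of_mem_uIcc (by simp) hp.le hw) (by simp) x₀ x₀ t ht t ht
          simp only [sub_self, abs_zero, add_zero] at h3
          refine h3.trans (mul_le_mul ?_ ((norm_sub_le_of_mem_uIcc hw).trans hzn) (norm_nonneg _)
            (Finset.sum_nonneg fun j _ => hC0 j))
          exact Finset.single_le_sum (f := C) (fun i _ => hC0 i) (Finset.mem_univ i))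
      have e2 : |g z x t - g z x₀ t - gx z₀ x₀ t * (x - x₀)| ≤ (Cx * (2 * δ)) * |x - x₀| := by
        have hd : ∀ s ∈ uIcc x₀ x, HasDerivWithinAt (fun s => g z s t - gx z₀ x₀ t * s)
            (gx z s t - gx z₀ x₀ t) (uIcc x₀ x) s := fun s _ => by
          simpa using ((hdx z s t ht).fun_sub
            ((hasDerivAt_id' s).const_mul (gx z₀ x₀ t))).hasDerivWithinAt
        have h3 := (convex_uIcc x₀ x).norm_image_sub_le_of_norm_hasDerivWithin_le hd
          (C := Cx * (2 * δ)) (fun s hs => by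
            refine (hCx z z₀ hp.le (by simp) s x₀ t ht t ht).trans ?_
            have := abs_sub_left_of_mem_uIcc hs
            gcongr
            simp only [sub_self, abs_zero]
            linarith) left_mem_uIcc right_mem_uIcc
        rw [Real.norm_eq_abs, Real.norm_eq_abs] at h3
        convert h3 using 2
        ring
      have e3 := sum_abs_le_card_mul_norm (z - z₀)
      simp only [Pi.sub_apply, Nat.cast_ofNat] at e3
      have hS : 0 ≤ ∑ j, C j := Finset.sum_nonneg fun j _ => hC0 j
      rw [hL]
      simp only [Prod.fst_sub, Prod.snd_sub, Pi.sub_apply, norm_pow]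
      calc ‖g z x t - g z₀ x₀ t - (∑ j, gz j z₀ x₀ t * (z j - z₀ j) + gx z₀ x₀ t * (x - x₀))‖
          = |(g z x₀ t - g z₀ x₀ t - ∑ j, gz j z₀ x₀ t * (z j - z₀ j))
            + (g z x t - g z x₀ t - gx z₀ x₀ t * (x - x₀))| := by
              rw [Real.norm_eq_abs]; congr 1; ring
        _ ≤ ((∑ j, C j) * δ) * (4 * δ) + (Cx * (2 * δ)) * δ := by
            refine (abs_add_le _ _).trans (add_le_add (e1.trans ?_) (e2.trans ?_))
            · exact mul_le_mul_of_nonneg_left (e3.trans (by linarith)) (by positivity)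
            · exact mul_le_mul_of_nonneg_left hxn (by positivity)
        _ = _ := by rw [Real.norm_of_nonneg hδ0]; ring
    · have := (Asymptotics.isLittleO_norm_pow_id (E' := (Fin 4 → ℝ) × ℝ) (n := 2) (by norm_num))
      have h4 : Tendsto (fun p : (Fin 4 → ℝ) × ℝ => p - (z₀, x₀)) (𝓝 (z₀, x₀)) (𝓝 0) := by
        have : Continuous (fun p : (Fin 4 → ℝ) × ℝ => p - (z₀, x₀)) := by fun_prop
        simpa using this.tendsto (z₀, x₀)
      exact this.comp_tendsto h4
  have h5 : HasDerivAt (fun s => (y s, s)) (y', (1 : ℝ)) x₀ := hy.prodMk (hasDerivAt_id x₀)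
  have h6 := HasFDerivAt.comp_hasDerivAt (f := fun s => (y s, s)) x₀ key h5
  rw [hL] at h6
  simp only [mul_one] at h6
  exact h6

/-- The partial derivatives of `f` of first and second order, as symbols. -/
theorem ConditionA1.exists_partials {f : (Fin 4 → ℝ) → ℝ → ℝ → ℝ} (hf : ConditionA1 f) :
    ∃ (fz : Fin 4 → (Fin 4 → ℝ) → ℝ → ℝ → ℝ) (fx : (Fin 4 → ℝ) → ℝ → ℝ → ℝ)
      (fzz : Fin 4 → Fin 4 → (Fin 4 → ℝ) → ℝ → ℝ → ℝ) (fzx : Fin 4 → (Fin 4 → ℝ) → ℝ → ℝ → ℝ)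
      (fxx : (Fin 4 → ℝ) → ℝ → ℝ → ℝ),
      UnifLip f ∧ HasPartials f fz fx ∧ (∀ j, HasPartials (fz j) (fzz j) (fzx j)) ∧
      HasPartials fx fzx fxx ∧ (∀ i j, fzz i j = fzz j i) ∧
      (∀ j, Symb 8 (fz j)) ∧ Symb 8 fx ∧ (∀ i j, Symb 8 (fzz i j)) ∧ (∀ j, Symb 8 (fzx j)) ∧
      Symb 8 fxx ∧ ∀ j z x, ∀ t ∈ timeInterval, partialZ j f z x t = fz j z x t := by
  obtain ⟨D, hD, hW⟩ := hf
  have hlip : ∀ β γ, ∑ i, β i < 11 → γ ≤ 10 → UnifLip (D 0 β γ) := fun β γ hβ hγ =>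
    hD.unifLip hW hβ hγ
  -- The chain rule at (β, γ) asks for Lipschitz partials one order higher; since Lipschitz
  -- continuity in z already costs one of the eleven z-derivatives, ten remain.
  have hpart : ∀ β γ, ∑ i, β i < 10 → γ < 10 →
      HasPartials (D 0 β γ) (fun j => D 0 (β + Pi.single j 1) γ) (D 0 β (γ + 1)) :=
    fun β γ hβ hγ => hasPartials_of_unifLip
      (fun j => hlip _ _ (by rw [sum_add_single]; omega) hγ.le) (hlip _ _ (by omega) hγ)
      (fun i z x t ht => hD.deriv_z 0 zero_le_one β γ (by omega) hγ.le i z x t ht)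
      (fun z x t ht => hD.deriv_x 0 zero_le_one β γ (by omega) hγ z x t ht)
  have hsymb : ∀ n β γ, ∑ i, β i + n ≤ 10 → γ + n ≤ 10 → Symb n (D 0 β γ) := by
    intro n
    induction n with
    | zero => exact fun β γ hβ hγ => hlip β γ (by omega) (by omega)
    | succ n ih => exact fun β γ hβ hγ => ⟨hlip β γ (by omega) (by omega), _, _,
        fun j => ih _ _ (by rw [sum_add_single]; omega) (by omega), ih _ _ (by omega) (by omega),
        hpart β γ (by omega) (by omega)⟩
  have h0 : ∑ i : Fin 4, (0 : Fin 4 → ℕ) i = 0 := by simp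
  have h1 : ∀ j : Fin 4, ∑ i, (0 + Pi.single j 1 : Fin 4 → ℕ) i = 1 := fun j => by
    rw [sum_add_single]; simp
  have h2 : ∀ i j : Fin 4, ∑ l, (0 + Pi.single i 1 + Pi.single j 1 : Fin 4 → ℕ) l = 2 := fun i j => by
    rw [sum_add_single, h1]
  refine ⟨fun j => D 0 (0 + Pi.single j 1) 0, D 0 0 1,
    fun i j => D 0 (0 + Pi.single i 1 + Pi.single j 1) 0,
    fun i => D 0 (0 + Pi.single i 1) 1, D 0 0 2,
    (hlip 0 0 (by simp) (by simp)).congr fun z x t ht => (hD.zero z x t ht).symm, ?_,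
    fun j => hpart _ 0 (by rw [h1]; norm_num) (by norm_num), hpart 0 1 (by simp) (by norm_num),
    fun i j => by simp only [add_right_comm], fun j => hsymb _ _ _ (by rw [h1]; norm_num) (by norm_num),
    hsymb _ _ _ (by simp) (by norm_num), fun i j => hsymb _ _ _ (by rw [h2]) (by norm_num),
    fun j => hsymb _ _ _ (by rw [h1]; norm_num) (by norm_num),
    hsymb _ _ _ (by simp) (by norm_num), ?_⟩
  · intro t ht y y' x hy
    have := hpart 0 0 (by simp) (by norm_num) t ht y y' x hy
    refine this.congr_of_eventuallyEq (Eventually.of_forall fun s => ?_)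
    exact (hD.zero _ _ _ ht).symm
  · intro j z x t ht
    have := hD.deriv_z 0 zero_le_one 0 0 (by simp) (by norm_num) j z x t ht
    refine Eq.trans ?_ this.deriv
    rw [partialZ]
    congr 1
    ext s
    exact (hD.zero _ _ _ ht).symm

/-! ### Total derivatives of symbols along functions -/

theorem hasDerivAt_iteratedDeriv {n j : ℕ} {u : ℝ → ℝ} (hu : ContDiff ℝ n u) (hj : j < n) (x : ℝ) :
    HasDerivAt (iteratedDeriv j u) (iteratedDeriv (j + 1) u x) x := by
  rw [iteratedDeriv_succ]
  exact (hu.differentiable_iteratedDeriv j (by exact_mod_cast hj) x).hasDerivAt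

theorem hasDerivAt_jet {d : ℕ} {u : ℝ → ℝ} (hu : ContDiff ℝ d u) (x : ℝ) :
    HasDerivAt (jet d u) (fun j : Fin d => iteratedDeriv (j + 1) u x) x :=
  hasDerivAt_pi.2 fun j => hasDerivAt_iteratedDeriv hu j.2 x

theorem norm_jet_le {d : ℕ} {u : ℝ → ℝ} {x K : ℝ} (hK : 0 ≤ K)
    (h : ∀ j < d, |iteratedDeriv j u x| ≤ K) : ‖jet d u x‖ ≤ K :=
  (pi_norm_le_iff_of_nonneg hK).2 fun j => h j j.2

/-- The part of the total derivative that does not contain `∂_x^4 u`. -/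
def lowerTotal (gz : Fin 4 → (Fin 4 → ℝ) → ℝ → ℝ → ℝ) (gx : (Fin 4 → ℝ) → ℝ → ℝ → ℝ)
    (z : Fin 4 → ℝ) (x t : ℝ) : ℝ :=
  gz 0 z x t * z 1 + gz 1 z x t * z 2 + gz 2 z x t * z 3 + gx z x t

theorem HasPartials.hasDerivAt {g gx : (Fin 4 → ℝ) → ℝ → ℝ → ℝ}
    {gz : Fin 4 → (Fin 4 → ℝ) → ℝ → ℝ → ℝ} (h : HasPartials g gz gx) {t : ℝ}
    (ht : t ∈ timeInterval) {u : ℝ → ℝ} (hu : ContDiff ℝ 4 u) (x : ℝ) :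
    HasDerivAt (fun x => g (jet 4 u x) x t)
      (lowerTotal gz gx (jet 4 u x) x t + gz 3 (jet 4 u x) x t * iteratedDeriv 4 u x) x := by
  refine (h t ht (jet 4 u) _ x (hasDerivAt_jet (d := 4) (by exact_mod_cast hu) x)).congr_deriv ?_
  rw [Fin.sum_univ_four]
  simp only [lowerTotal, jet]
  simp
  ring

theorem Symb.lowerTotal {n : ℕ} {gx : (Fin 4 → ℝ) → ℝ → ℝ → ℝ}
    {gz : Fin 4 → (Fin 4 → ℝ) → ℝ → ℝ → ℝ} (hz : ∀ j, Symb n (gz j)) (hx : Symb n gx) :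
    Symb n (lowerTotal gz gx) :=
  ((((hz 0).mul (Symb.coord n 1)).add ((hz 1).mul (Symb.coord n 2))).add
    ((hz 2).mul (Symb.coord n 3))).add hx

theorem Symb.exists_hasDerivAt {n : ℕ} {g : (Fin 4 → ℝ) → ℝ → ℝ → ℝ} (hg : Symb (n + 1) g) :
    ∃ l p, Symb n l ∧ Symb n p ∧ ∀ t ∈ timeInterval, ∀ u : ℝ → ℝ, ContDiff ℝ 4 u → ∀ x,
      HasDerivAt (fun x => g (jet 4 u x) x t)
        (l (jet 4 u x) x t + p (jet 4 u x) x t * iteratedDeriv 4 u x) x := by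
  obtain ⟨-, gz, gx, hz, hx, hp⟩ := hg
  exact ⟨_, _, Symb.lowerTotal hz hx, hz 3, fun t ht u hu x => hp.hasDerivAt ht hu x⟩

/-- The total derivatives up to order three of `f` along a function `u`, written in terms of
symbols. Here `p = f_{z_3}`, `r = f_{z_2}`, and `k + q ∂_x^4 u` is the total derivative of `p`. -/
structure Expansion (f : (Fin 4 → ℝ) → ℝ → ℝ → ℝ) where
  (p r k q l₀ l₁ h₀ h₁ h₂ h₃ : (Fin 4 → ℝ) → ℝ → ℝ → ℝ)
  unifLip : UnifLip f
  symb_p : Symb 3 p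
  symb_r : Symb 2 r
  symb_k : Symb 1 k
  symb_q : Symb 1 q
  symb_l₀ : Symb 1 l₀
  symb_l₁ : Symb 1 l₁
  symb_h₀ : Symb 1 h₀
  symb_h₁ : Symb 1 h₁
  symb_h₂ : Symb 1 h₂
  symb_h₃ : Symb 1 h₃
  partial_p : ∀ z x, ∀ t ∈ timeInterval, partialZ 3 f z x t = p z x t
  partial_r : ∀ z x, ∀ t ∈ timeInterval, partialZ 2 f z x t = r z x t
  deriv_p : ∀ t ∈ timeInterval, ∀ u : ℝ → ℝ, ContDiff ℝ 4 u → ∀ x,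
    HasDerivAt (fun x => p (jet 4 u x) x t)
      (k (jet 4 u x) x t + q (jet 4 u x) x t * iteratedDeriv 4 u x) x
  deriv_one : ∀ t ∈ timeInterval, ∀ u : ℝ → ℝ, ContDiff ℝ 4 u → ∀ x,
    HasDerivAt (fun x => f (jet 4 u x) x t)
      (l₀ (jet 4 u x) x t + p (jet 4 u x) x t * iteratedDeriv 4 u x) x
  deriv_two : ∀ t ∈ timeInterval, ∀ u : ℝ → ℝ, ContDiff ℝ 5 u → ∀ x,
    HasDerivAt (fun x => l₀ (jet 4 u x) x t + p (jet 4 u x) x t * iteratedDeriv 4 u x)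
      (l₁ (jet 4 u x) x t + (r (jet 4 u x) x t + 2 * k (jet 4 u x) x t) * iteratedDeriv 4 u x
        + q (jet 4 u x) x t * iteratedDeriv 4 u x ^ 2
        + p (jet 4 u x) x t * iteratedDeriv 5 u x) x
  deriv_three : ∀ t ∈ timeInterval, ∀ u : ℝ → ℝ, ContDiff ℝ 6 u → ∀ x,
    HasDerivAt (fun x => l₁ (jet 4 u x) x t
        + (r (jet 4 u x) x t + 2 * k (jet 4 u x) x t) * iteratedDeriv 4 u x
        + q (jet 4 u x) x t * iteratedDeriv 4 u x ^ 2
        + p (jet 4 u x) x t * iteratedDeriv 5 u x)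
      (p (jet 4 u x) x t * iteratedDeriv 6 u x
        + (r (jet 4 u x) x t + 3 * (k (jet 4 u x) x t + q (jet 4 u x) x t * iteratedDeriv 4 u x))
          * iteratedDeriv 5 u x
        + h₀ (jet 4 u x) x t + h₁ (jet 4 u x) x t * iteratedDeriv 4 u x
        + h₂ (jet 4 u x) x t * iteratedDeriv 4 u x ^ 2
        + h₃ (jet 4 u x) x t * iteratedDeriv 4 u x ^ 3) x

/-- What matters is the coefficient of the second highest derivative. Writing D f = l₀ + p u_4 and D
p = k + q u_4, the symmetry of second partials gives ∂_{z_3} l₀ = r + k. Hence u_4 enters D² f with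
the coefficient r + 2k + q u_4, and u_5 enters D³ f with r + 3 D p. -/
theorem ConditionA1.nonempty_expansion {f : (Fin 4 → ℝ) → ℝ → ℝ → ℝ} (hf : ConditionA1 f) :
    Nonempty (Expansion f) := by
  obtain ⟨fz, fx, fzz, fzx, fxx, hlip, hP, hPz, hPx, hsymm, hz, hx, hzz, hzx, hxx, hpart⟩ :=
    hf.exists_partials
  have hk : Symb 8 (lowerTotal (fzz 3) (fzx 3)) := Symb.lowerTotal (hzz 3) (hzx 3)
  obtain ⟨m, hm⟩ : ∃ m : Fin 3 → (Fin 4 → ℝ) → ℝ → ℝ → ℝ, m =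
      fun j => lowerTotal (fzz j.castSucc) (fzx j.castSucc) := ⟨_, rfl⟩
  have hmS : ∀ j, Symb 8 (m j) := fun j => by rw [hm]; exact Symb.lowerTotal (hzz _) (hzx _)
  let l₁ : (Fin 4 → ℝ) → ℝ → ℝ → ℝ := fun z x t =>
    m 0 z x t * z 1 + fz 0 z x t * z 2 + (m 1 z x t * z 2 + fz 1 z x t * z 3)
      + m 2 z x t * z 3 + lowerTotal fzx fxx z x t
  have hl₁ : Symb 8 l₁ :=
    ((((((hmS 0).mul (Symb.coord 8 1)).add ((hz 0).mul (Symb.coord 8 2))).add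
      (((hmS 1).mul (Symb.coord 8 2)).add ((hz 1).mul (Symb.coord 8 3))))).add
      ((hmS 2).mul (Symb.coord 8 3))).add (Symb.lowerTotal hzx hxx)
  have hdl₀ : ∀ t ∈ timeInterval, ∀ u : ℝ → ℝ, ContDiff ℝ 4 u → ∀ x,
      HasDerivAt (fun x => lowerTotal fz fx (jet 4 u x) x t)
        (l₁ (jet 4 u x) x t + (fz 2 (jet 4 u x) x t + lowerTotal (fzz 3) (fzx 3) (jet 4 u x) x t)
          * iteratedDeriv 4 u x) x := by
    intro t ht u hu x
    have e : ∀ j : Fin 4, HasDerivAt (fun x => jet 4 u x j) (iteratedDeriv (j + 1) u x) x :=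
      hasDerivAt_pi.1 (hasDerivAt_jet (d := 4) (by exact_mod_cast hu) x)
    refine ((((((hPz 0).hasDerivAt ht hu x).fun_mul (e 1)).fun_add
      (((hPz 1).hasDerivAt ht hu x).fun_mul (e 2))).fun_add
      (((hPz 2).hasDerivAt ht hu x).fun_mul (e 3))).fun_add (hPx.hasDerivAt ht hu x)).congr_deriv ?_
    -- Symmetry of the mixed partials turns the u_4 coefficient of D l₀ into r plus the lower total
    -- derivative of p.
    simp only [l₁, hm, lowerTotal, hsymm 3 0, hsymm 3 1, hsymm 3 2]
    simp only [jet]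
    have h3 : ((3 : Fin 4) : ℕ) = 3 := rfl
    simp only [h3, Fin.castSucc_zero, Fin.castSucc_one, Fin.val_one, Fin.val_two, Fin.reduceCastSucc,
      Fin.isValue, Nat.reduceAdd]
    ring
  obtain ⟨a₁, b₁, ha₁, hb₁, hab₁⟩ := hl₁.exists_hasDerivAt
  obtain ⟨a₂, b₂, ha₂, hb₂, hab₂⟩ := ((hz 2).add ((Symb.const 8 2).mul hk)).exists_hasDerivAt
  obtain ⟨a₃, b₃, ha₃, hb₃, hab₃⟩ := (hzz 3 3).exists_hasDerivAt
  refine ⟨⟨fz 3, fz 2, lowerTotal (fzz 3) (fzx 3), fzz 3 3, lowerTotal fz fx, l₁,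
    a₁, fun z x t => b₁ z x t + a₂ z x t, fun z x t => b₂ z x t + a₃ z x t, b₃,
    hlip, (hz 3).mono (by norm_num), (hz 2).mono (by norm_num), hk.mono (by norm_num),
    (hzz 3 3).mono (by norm_num), (Symb.lowerTotal hz hx).mono (by norm_num),
    hl₁.mono (by norm_num), ha₁.mono (by norm_num), (hb₁.add ha₂).mono (by norm_num),
    (hb₂.add ha₃).mono (by norm_num), hb₃.mono (by norm_num), hpart 3, hpart 2,
    fun t ht u hu x => (hPz 3).hasDerivAt ht hu x, fun t ht u hu x => hP.hasDerivAt ht hu x,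
    fun t ht u hu x => ?_, fun t ht u hu x => ?_⟩⟩
  · have hu4 : ContDiff ℝ 4 u := hu.of_le (by norm_num)
    have e4 := hasDerivAt_iteratedDeriv (n := 5) (j := 4) (by exact_mod_cast hu) (by norm_num) x
    refine ((hdl₀ t ht u hu4 x).fun_add
      (((hPz 3).hasDerivAt ht hu4 x).fun_mul e4)).congr_deriv ?_
    ring
  · have hu4 : ContDiff ℝ 4 u := hu.of_le (by norm_num)
    have e4 := hasDerivAt_iteratedDeriv (n := 6) (j := 4) (by exact_mod_cast hu) (by norm_num) x
    have e5 := hasDerivAt_iteratedDeriv (n := 6) (j := 5) (by exact_mod_cast hu) (by norm_num) x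
    refine ((((hab₁ t ht u hu4 x).fun_add ((hab₂ t ht u hu4 x).fun_mul e4)).fun_add
      ((hab₃ t ht u hu4 x).fun_mul (e4.fun_pow 2))).fun_add
      (((hPz 3).hasDerivAt ht hu4 x).fun_mul e5)).congr_deriv ?_
    simp only [Nat.add_one_sub_one, pow_one, Nat.cast_ofNat]
    ring

/-! ### Families of functions with uniformly bounded derivatives -/

/-- The functions `A c`, `c ∈ S`, have derivatives up to order `n`, which are bounded uniformly. -/
def BddDerivs {ι : Type*} (S : Set ι) : ℕ → (ι → ℝ → ℝ) → Prop
  | 0, A => ∃ C, ∀ c ∈ S, ∀ x, |A c x| ≤ C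
  | n + 1, A => (∃ C, ∀ c ∈ S, ∀ x, |A c x| ≤ C) ∧
      ∃ A' : ι → ℝ → ℝ, (∀ c ∈ S, ∀ x, HasDerivAt (A c) (A' c x) x) ∧ BddDerivs S n A'

section BddDerivs

variable {ι : Type*} {S : Set ι} {n : ℕ} {A B : ι → ℝ → ℝ}

theorem BddDerivs.exists_bound : ∀ {n : ℕ} {A : ι → ℝ → ℝ}, BddDerivs S n A →
    ∃ C, ∀ c ∈ S, ∀ x, |A c x| ≤ C
  | 0, _, h => h
  | _ + 1, _, h => h.1

theorem BddDerivs.of_succ : ∀ {n : ℕ} {A : ι → ℝ → ℝ}, BddDerivs S (n + 1) A → BddDerivs S n A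
  | 0, _, h => h.1
  | _ + 1, _, ⟨h, A', hd, hA⟩ => ⟨h, A', hd, hA.of_succ⟩

theorem BddDerivs.mono {m : ℕ} (h : BddDerivs S n A) (hm : m ≤ n) : BddDerivs S m A := by
  induction n, hm using Nat.le_induction with
  | base => exact h
  | succ k _ ih => exact ih h.of_succ

theorem BddDerivs.congr (h : BddDerivs S n A) (hAB : ∀ c ∈ S, ∀ x, B c x = A c x) :
    BddDerivs S n B := by
  cases n with
  | zero =>
    obtain ⟨C, hC⟩ := h
    exact ⟨C, fun c hc x => by rw [hAB c hc]; exact hC c hc x⟩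
  | succ n =>
    obtain ⟨⟨C, hC⟩, A', hd, h'⟩ := h
    refine ⟨⟨C, fun c hc x => by rw [hAB c hc]; exact hC c hc x⟩, A', fun c hc x => ?_, h'⟩
    have : B c = A c := funext (hAB c hc)
    rw [this]
    exact hd c hc x

theorem BddDerivs.const {a : ι → ℝ} {C : ℝ} (ha : ∀ c ∈ S, |a c| ≤ C) (n : ℕ) :
    BddDerivs S n (fun c _ => a c) := by
  induction n generalizing a C with
  | zero => exact ⟨C, fun c hc _ => ha c hc⟩
  | succ n ih =>
    exact ⟨⟨C, fun c hc _ => ha c hc⟩, fun _ _ => 0, fun c _ x => hasDerivAt_const x (a c),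
      ih (a := fun _ => 0) (C := 0) (by simp)⟩

theorem BddDerivs.add (hA : BddDerivs S n A) (hB : BddDerivs S n B) :
    BddDerivs S n (fun c x => A c x + B c x) := by
  induction n generalizing A B with
  | zero =>
    obtain ⟨C, hC⟩ := hA
    obtain ⟨C', hC'⟩ := hB
    exact ⟨C + C', fun c hc x => (abs_add_le _ _).trans (add_le_add (hC c hc x) (hC' c hc x))⟩
  | succ n ih =>
    obtain ⟨⟨C, hC⟩, A', hd, hA'⟩ := hA
    obtain ⟨⟨C', hC'⟩, B', hd', hB'⟩ := hB
    exact ⟨⟨C + C', fun c hc x => (abs_add_le _ _).trans (add_le_add (hC c hc x) (hC' c hc x))⟩,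
      _, fun c hc x => (hd c hc x).add (hd' c hc x), ih hA' hB'⟩

theorem BddDerivs.mul (hA : BddDerivs S n A) (hB : BddDerivs S n B) :
    BddDerivs S n (fun c x => A c x * B c x) := by
  have key : ∀ {A B : ι → ℝ → ℝ}, (∃ C, ∀ c ∈ S, ∀ x, |A c x| ≤ C) →
      (∃ C, ∀ c ∈ S, ∀ x, |B c x| ≤ C) → ∃ C, ∀ c ∈ S, ∀ x, |A c x * B c x| ≤ C := by
    rintro A B ⟨C, hC⟩ ⟨C', hC'⟩
    refine ⟨C * C', fun c hc x => ?_⟩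
    rw [abs_mul]
    exact mul_le_mul (hC c hc x) (hC' c hc x) (abs_nonneg _) ((abs_nonneg _).trans (hC c hc x))
  induction n generalizing A B with
  | zero => exact key hA hB
  | succ n ih =>
    have hA0 := hA.of_succ
    have hB0 := hB.of_succ
    obtain ⟨hC, A', hd, hA'⟩ := hA
    obtain ⟨hC', B', hd', hB'⟩ := hB
    exact ⟨key hC hC', _, fun c hc x => (hd c hc x).mul (hd' c hc x),
      (ih hA' hB0).add (ih hA0 hB')⟩

theorem BddDerivs.const_mul (hA : BddDerivs S n A) (r : ℝ) :
    BddDerivs S n (fun c x => r * A c x) :=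
  (BddDerivs.const (a := fun _ => r) (C := |r|) (fun _ _ => le_rfl) n).mul hA

theorem BddDerivs.inv (hA : BddDerivs S n A) (h0 : ∀ c ∈ S, ∀ x, A c x ≠ 0)
    (h : ∃ C, ∀ c ∈ S, ∀ x, |(A c x)⁻¹| ≤ C) : BddDerivs S n (fun c x => (A c x)⁻¹) := by
  induction n generalizing A with
  | zero => exact h
  | succ n ih =>
    have hA0 := hA.of_succ
    obtain ⟨hC, A', hd, hA'⟩ := hA
    refine ⟨h, fun c x => -1 * A' c x * ((A c x)⁻¹ * (A c x)⁻¹), fun c hc x => ?_,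
      (hA'.const_mul (-1)).mul ((ih hA0 h0 h).mul (ih hA0 h0 h))⟩
    refine ((hd c hc x).inv (h0 c hc x)).congr_deriv ?_
    have := h0 c hc x
    field_simp

/-- Bootstrap for the linear equation A' = B A: each derivative of B yields one more of A. Applied
to the exponential of the phase, where only the phase itself has to be bounded separately. -/
theorem BddDerivs.of_hasDerivAt_mul (hB : BddDerivs S n B)
    (hd : ∀ c ∈ S, ∀ x, HasDerivAt (A c) (B c x * A c x) x)
    (h : ∃ C, ∀ c ∈ S, ∀ x, |A c x| ≤ C) : BddDerivs S (n + 1) A := by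
  induction n generalizing B with
  | zero => exact ⟨h, _, hd, hB.mul h⟩
  | succ n ih => exact ⟨h, _, hd, hB.mul (ih hB.of_succ hd)⟩

variable {U : ι → ℝ → ℝ} {τ : ι → ℝ} {K : ℝ}

theorem BddDerivs.iteratedDeriv (hU : ∀ c ∈ S, ContDiff ℝ 6 (U c))
    (hK : ∀ c ∈ S, ∀ j ≤ 6, ∀ x, |iteratedDeriv j (U c) x| ≤ K) {j : ℕ} (hj : j + n ≤ 6) :
    BddDerivs S n (fun c => _root_.iteratedDeriv j (U c)) := by
  induction n generalizing j with
  | zero => exact ⟨K, fun c hc x => hK c hc j (by omega) x⟩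
  | succ n ih => exact ⟨⟨K, fun c hc x => hK c hc j (by omega) x⟩, _,
      fun c hc x => hasDerivAt_iteratedDeriv (n := 6) (by exact_mod_cast hU c hc) (by omega) x,
      ih (j := j + 1) (by omega)⟩

/-- The first total derivative brings in u_4 and each further one raises the order by one, so three
total derivatives stay within the six bounded derivatives of u. -/
theorem Symb.bddDerivs {g : (Fin 4 → ℝ) → ℝ → ℝ → ℝ} (hg : Symb n g) (hn : n ≤ 3)
    (hτ : ∀ c ∈ S, τ c ∈ timeInterval) (hU : ∀ c ∈ S, ContDiff ℝ 6 (U c))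
    (hK : ∀ c ∈ S, ∀ j ≤ 6, ∀ x, |iteratedDeriv j (U c) x| ≤ K) :
    BddDerivs S n (fun c x => g (jet 4 (U c) x) x (τ c)) := by
  have hbd : ∀ {g : (Fin 4 → ℝ) → ℝ → ℝ → ℝ}, UnifLip g →
      ∃ C, ∀ c ∈ S, ∀ x, |g (jet 4 (U c) x) x (τ c)| ≤ C := by
    intro g hg
    obtain ⟨C, hC⟩ := hg.bdd |K|
    exact ⟨C, fun c hc x => hC _ (norm_jet_le (abs_nonneg _) fun j hj =>
      (hK c hc j (by omega) x).trans (le_abs_self _)) x _ (hτ c hc)⟩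
  induction n generalizing g with
  | zero => exact hbd hg
  | succ n ih =>
    obtain ⟨l, p, hl, hp, hd⟩ := hg.exists_hasDerivAt
    exact ⟨hbd hg.unifLip, _, fun c hc x => hd _ (hτ c hc) _ ((hU c hc).of_le (by norm_num)) x,
      (ih hl (by omega)).add ((ih hp (by omega)).mul (BddDerivs.iteratedDeriv hU hK (by omega)))⟩

end BddDerivs

/-! ### Functions of jets -/

/-- `A` is bounded and Lipschitz as a function of `(y_0, …, y_N)`, locally uniformly in `y`. -/
def JetLip (N : ℕ) (A : (ℕ → ℝ) → ℝ → ℝ → ℝ) : Prop :=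
  ∀ K : ℝ, ∃ C : ℝ, 0 ≤ C ∧ ∀ y y' : ℕ → ℝ, (∀ j ≤ N, |y j| ≤ K) → (∀ j ≤ N, |y' j| ≤ K) →
    ∀ x, ∀ t ∈ timeInterval, |A y x t| ≤ C ∧
      |A y x t - A y' x t| ≤ C * ∑ j ∈ Finset.range (N + 1), |y j - y' j|

section JetLip

variable {N : ℕ} {A B : (ℕ → ℝ) → ℝ → ℝ → ℝ}

theorem JetLip.const (N : ℕ) (c : ℝ) : JetLip N (fun _ _ _ => c) := fun _ =>
  ⟨|c|, abs_nonneg _, fun y y' _ _ x t _ => ⟨le_rfl, by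
    rw [sub_self, abs_zero]; positivity⟩⟩

theorem JetLip.coord {j : ℕ} (hj : j ≤ N) : JetLip N (fun y _ _ => y j) := fun K =>
  ⟨max 1 |K|, by positivity, fun y y' hy _ x t _ =>
    ⟨((hy j hj).trans (le_abs_self _)).trans (le_max_right _ _), by
      have h := Finset.single_le_sum (f := fun j => |y j - y' j|) (fun _ _ => abs_nonneg _)
        (Finset.mem_range.2 (Nat.lt_succ_of_le hj))
      exact h.trans (le_mul_of_one_le_left (Finset.sum_nonneg fun _ _ => abs_nonneg _)
        (le_max_left _ _))⟩⟩

theorem JetLip.add (hA : JetLip N A) (hB : JetLip N B) :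
    JetLip N (fun y x t => A y x t + B y x t) := fun K => by
  obtain ⟨C, h0, hC⟩ := hA K
  obtain ⟨C', h0', hC'⟩ := hB K
  refine ⟨C + C', by positivity, fun y y' hy hy' x t ht => ?_⟩
  obtain ⟨a, b⟩ := hC y y' hy hy' x t ht
  obtain ⟨a', b'⟩ := hC' y y' hy hy' x t ht
  refine ⟨(abs_add_le _ _).trans (add_le_add a a'), ?_⟩
  calc _ = |(A y x t - A y' x t) + (B y x t - B y' x t)| := by congr 1; ring
    _ ≤ _ := (abs_add_le _ _).trans (add_le_add b b')
    _ = _ := by ring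

theorem JetLip.mul (hA : JetLip N A) (hB : JetLip N B) :
    JetLip N (fun y x t => A y x t * B y x t) := fun K => by
  obtain ⟨C, h0, hC⟩ := hA K
  obtain ⟨C', h0', hC'⟩ := hB K
  refine ⟨2 * (C * C'), by positivity, fun y y' hy hy' x t ht => ?_⟩
  obtain ⟨a, b⟩ := hC y y' hy hy' x t ht
  obtain ⟨a', b'⟩ := hC' y y' hy hy' x t ht
  obtain ⟨a₁, -⟩ := hC y' y hy' hy x t ht
  have hS : 0 ≤ ∑ j ∈ Finset.range (N + 1), |y j - y' j| := Finset.sum_nonneg fun _ _ => abs_nonneg _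
  constructor
  · rw [abs_mul]
    exact (mul_le_mul a a' (abs_nonneg _) h0).trans (by nlinarith [mul_nonneg h0 h0'])
  · calc _ = |(A y x t - A y' x t) * B y x t + A y' x t * (B y x t - B y' x t)| := by
          congr 1; ring
      _ ≤ (C * ∑ j ∈ Finset.range (N + 1), |y j - y' j|) * C'
          + C * (C' * ∑ j ∈ Finset.range (N + 1), |y j - y' j|) := by
        refine (abs_add_le _ _).trans ?_
        rw [abs_mul, abs_mul]
        gcongr
      _ = _ := by ring

theorem JetLip.pow (hA : JetLip N A) (n : ℕ) : JetLip N (fun y x t => A y x t ^ n) := by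
  induction n with
  | zero => simpa using JetLip.const N 1
  | succ n ih => simpa only [pow_succ] using ih.mul hA

theorem UnifLip.jetLip {d : ℕ} {g : (Fin d → ℝ) → ℝ → ℝ → ℝ} (hg : UnifLip g) (hN : d ≤ N + 1) :
    JetLip N (fun y x t => g (fun j => y j) x t) := fun K => by
  obtain ⟨C, h0, hb, hl⟩ := hg.exists_bound |K|
  have hn : ∀ y : ℕ → ℝ, (∀ j ≤ N, |y j| ≤ K) → ‖(fun j : Fin d => y j)‖ ≤ |K| := fun y hy =>
    (pi_norm_le_iff_of_nonneg (abs_nonneg _)).2 fun j =>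
      (hy j (by omega)).trans (le_abs_self _)
  refine ⟨C, h0, fun y y' hy hy' x t ht => ⟨hb _ (hn y hy) x t ht, ?_⟩⟩
  refine (hl _ _ (hn y hy) (hn y' hy') x x t ht t ht).trans ?_
  simp only [sub_self, abs_zero, add_zero]
  refine mul_le_mul_of_nonneg_left ?_ h0
  refine (pi_norm_le_iff_of_nonneg (Finset.sum_nonneg fun _ _ => abs_nonneg _)).2 fun j => ?_
  exact Finset.single_le_sum (f := fun j => |y j - y' j|) (fun _ _ => abs_nonneg _)
        (Finset.mem_range.2 (by omega))

end JetLip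

/-- All derivatives of `u` at `x`. -/
noncomputable def jets (u : ℝ → ℝ) (x : ℝ) : ℕ → ℝ := fun j => iteratedDeriv j u x

/-! ### Total derivatives, phase and weight along a function -/

namespace Expansion

variable {f : (Fin 4 → ℝ) → ℝ → ℝ → ℝ} (X : Expansion f)

/-- The total derivative of `f` of order `i ≤ 3`, as a function of the jet. -/
def total : ℕ → (ℕ → ℝ) → ℝ → ℝ → ℝ
  | 0, y, x, t => f (fun j => y j) x t
  | 1, y, x, t => X.l₀ (fun j => y j) x t + X.p (fun j => y j) x t * y 4
  | 2, y, x, t => X.l₁ (fun j => y j) x t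
      + (X.r (fun j => y j) x t + 2 * X.k (fun j => y j) x t) * y 4
      + X.q (fun j => y j) x t * y 4 ^ 2 + X.p (fun j => y j) x t * y 5
  | 3, y, x, t => X.p (fun j => y j) x t * y 6
      + (X.r (fun j => y j) x t + 3 * (X.k (fun j => y j) x t + X.q (fun j => y j) x t * y 4)) * y 5
      + X.h₀ (fun j => y j) x t + X.h₁ (fun j => y j) x t * y 4 + X.h₂ (fun j => y j) x t * y 4 ^ 2
      + X.h₃ (fun j => y j) x t * y 4 ^ 3
  | _, _, _, _ => 0

theorem hasDerivAt_total {i : ℕ} (hi : i < 3) {t : ℝ} (ht : t ∈ timeInterval) {u : ℝ → ℝ}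
    (hu : ContDiff ℝ 6 u) (x : ℝ) :
    HasDerivAt (fun x => X.total i (jets u x) x t) (X.total (i + 1) (jets u x) x t) x := by
  interval_cases i
  · exact X.deriv_one t ht u (hu.of_le (by norm_num)) x
  · exact X.deriv_two t ht u (hu.of_le (by norm_num)) x
  · exact X.deriv_three t ht u hu x

theorem jetLip_total {i : ℕ} (hi : i ≤ 3) : JetLip (i + 3) (X.total i) := by
  have c : ∀ N (a : ℝ), JetLip N (fun _ _ _ => a) := JetLip.const
  interval_cases i
  · exact X.unifLip.jetLip (by norm_num)
  · exact (X.symb_l₀.unifLip.jetLip (by norm_num)).add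
      ((X.symb_p.unifLip.jetLip (by norm_num)).mul (JetLip.coord (by norm_num)))
  · exact (((X.symb_l₁.unifLip.jetLip (by norm_num)).add
      (((X.symb_r.unifLip.jetLip (by norm_num)).add
        ((c _ 2).mul (X.symb_k.unifLip.jetLip (by norm_num)))).mul (JetLip.coord (by norm_num)))).add
      ((X.symb_q.unifLip.jetLip (by norm_num)).mul ((JetLip.coord (by norm_num)).pow 2))).add
      ((X.symb_p.unifLip.jetLip (by norm_num)).mul (JetLip.coord (by norm_num)))
  · exact ((((((X.symb_p.unifLip.jetLip (by norm_num)).mul (JetLip.coord (by norm_num))).add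
      (((X.symb_r.unifLip.jetLip (by norm_num)).add ((c _ 3).mul
        ((X.symb_k.unifLip.jetLip (by norm_num)).add ((X.symb_q.unifLip.jetLip (by norm_num)).mul
          (JetLip.coord (by norm_num)))))).mul (JetLip.coord (by norm_num)))).add
      (X.symb_h₀.unifLip.jetLip (by norm_num))).add
      ((X.symb_h₁.unifLip.jetLip (by norm_num)).mul (JetLip.coord (by norm_num)))).add
      ((X.symb_h₂.unifLip.jetLip (by norm_num)).mul ((JetLip.coord (by norm_num)).pow 2))).add
      ((X.symb_h₃.unifLip.jetLip (by norm_num)).mul ((JetLip.coord (by norm_num)).pow 3))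

/-- The integral of the modified diffusion ratio. -/
noncomputable def phase (u : ℝ → ℝ) (t x : ℝ) : ℝ :=
  ∫ y in (0 : ℝ)..x, X.r (jet 4 u y) y t / X.p (jet 4 u y) y t

/-- The weight `|f_{z_3}| exp (2/3 ∫ f_{z_2} / f_{z_3})` of the energy. -/
noncomputable def weight (u : ℝ → ℝ) (t x : ℝ) : ℝ :=
  |X.p (jet 4 u x) x t| * Real.exp (2 / 3 * X.phase u t x)

end Expansion

/-- `u ∈ H^7` and the derivatives of `u` of order at most six are bounded by `K`. -/
structure HighBound (K : ℝ) (u : ℝ → ℝ) : Prop where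
  memH : MemH 7 u
  le : ∀ j ≤ 6, ∀ x, |iteratedDeriv j u x| ≤ K

namespace Expansion

variable {f : (Fin 4 → ℝ) → ℝ → ℝ → ℝ} (X : Expansion f)

/-- The dispersion coefficient is bounded below and the phase is bounded. -/
structure NonDegenerate (K : ℝ) (u : ℝ → ℝ) (t : ℝ) : Prop where
  inv_le : ∀ x, K⁻¹ ≤ |X.p (jet 4 u x) x t|
  phase_le : ∀ x, |X.phase u t x| ≤ K

/-- Coefficient of `∂_x^4 (u - u')` in the difference of the third total derivatives. -/
noncomputable def coeffOne (u u' : ℝ → ℝ) (t x : ℝ) : ℝ :=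
  3 * (X.q (jet 4 u x) x t * iteratedDeriv 5 u' x) + X.h₁ (jet 4 u x) x t
    + X.h₂ (jet 4 u x) x t * (iteratedDeriv 4 u x + iteratedDeriv 4 u' x)
    + X.h₃ (jet 4 u x) x t * (iteratedDeriv 4 u x * iteratedDeriv 4 u x
      + (iteratedDeriv 4 u x * iteratedDeriv 4 u' x + iteratedDeriv 4 u' x * iteratedDeriv 4 u' x))

/-- Coefficient of `∂_x^5 (u - u')` in the difference of the third total derivatives. -/
noncomputable def coeffTwo (u : ℝ → ℝ) (t x : ℝ) : ℝ :=
  X.r (jet 4 u x) x t + 3 * (X.k (jet 4 u x) x t + X.q (jet 4 u x) x t * iteratedDeriv 4 u x)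

theorem hasDerivAt_phase {u : ℝ → ℝ} {t : ℝ} (hu : ContDiff ℝ 4 u) (ht : t ∈ timeInterval)
    (hne : ∀ x, X.p (jet 4 u x) x t ≠ 0) (x : ℝ) :
    HasDerivAt (X.phase u t) (X.r (jet 4 u x) x t / X.p (jet 4 u x) x t) x := by
  obtain ⟨_, _, -, -, hr⟩ := X.symb_r.exists_hasDerivAt
  have hcont : Continuous (fun x => X.r (jet 4 u x) x t / X.p (jet 4 u x) x t) :=
    continuous_iff_continuousAt.2 fun x => (hr t ht u hu x).continuousAt.div
      (X.deriv_p t ht u hu x).continuousAt (hne x)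
  exact intervalIntegral.integral_hasDerivAt_right (hcont.intervalIntegrable _ _)
    (hcont.stronglyMeasurableAtFilter _ _) hcont.continuousAt

/-- Supplies the hypotheses of the weighted integration by parts with constants depending on K
alone. In the first derivative, ω = σ p exp(2φ/3) with φ' = r/p gives (ωp)' = σ (2pp' + (2/3) p r)
exp(2φ/3) = (2/3) ω (r + 3p'). -/
theorem exists_weight_derivs {K : ℝ} (hK : 0 < K) : ∃ C : ℝ, 1 ≤ C ∧
    ∀ u u' t, HighBound K u → HighBound K u' → t ∈ timeInterval → X.NonDegenerate K u t →
      (∀ x, C⁻¹ ≤ X.weight u t x ∧ X.weight u t x ≤ C) ∧ Continuous (X.weight u t) ∧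
      ∃ q₁ q₂ m₁ : ℝ → ℝ,
        (∀ x, HasDerivAt (fun x => X.weight u t x * X.p (jet 4 u x) x t)
          (2 / 3 * (X.weight u t x * X.coeffTwo u t x)) x) ∧
        (∀ x, HasDerivAt (fun x => X.weight u t x * X.coeffTwo u t x) (q₁ x) x) ∧
        (∀ x, HasDerivAt q₁ (q₂ x) x) ∧
        (∀ x, HasDerivAt (fun x => X.weight u t x * X.coeffOne u u' t x) (m₁ x) x) ∧
        (∀ x, |X.p (jet 4 u x) x t| ≤ C ∧ |X.coeffTwo u t x| ≤ C ∧ |X.coeffOne u u' t x| ≤ C ∧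
          |q₁ x| ≤ C ∧ |q₂ x| ≤ C ∧ |m₁ x| ≤ C) := by
  -- All admissible triples (u, u', t) form one family, so that each bound below is uniform by
  -- construction.
  let S : Set ((ℝ → ℝ) × (ℝ → ℝ) × ℝ) := {c | HighBound K c.1 ∧ HighBound K c.2.1 ∧
    c.2.2 ∈ timeInterval ∧ X.NonDegenerate K c.1 c.2.2}
  have hU : ∀ c ∈ S, ContDiff ℝ 6 c.1 := fun c hc => hc.1.memH.contDiff
  have hU' : ∀ c ∈ S, ContDiff ℝ 6 c.2.1 := fun c hc => hc.2.1.memH.contDiff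
  have hUK : ∀ c ∈ S, ∀ j ≤ 6, ∀ x, |iteratedDeriv j c.1 x| ≤ K := fun c hc => hc.1.le
  have hUK' : ∀ c ∈ S, ∀ j ≤ 6, ∀ x, |iteratedDeriv j c.2.1 x| ≤ K := fun c hc => hc.2.1.le
  have hτ : ∀ c ∈ S, c.2.2 ∈ timeInterval := fun c hc => hc.2.2.1
  have bd : ∀ {n : ℕ} {g : (Fin 4 → ℝ) → ℝ → ℝ → ℝ}, Symb n g → n ≤ 3 →
      BddDerivs S n (fun c x => g (jet 4 c.1 x) x c.2.2) := fun hg hn =>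
    hg.bddDerivs hn hτ hU hUK
  have hp3 := bd X.symb_p le_rfl
  have hne : ∀ c ∈ S, ∀ x, X.p (jet 4 c.1 x) x c.2.2 ≠ 0 := fun c hc x h => by
    have := hc.2.2.2.inv_le x
    rw [h, abs_zero] at this
    exact absurd this (not_le.2 (inv_pos.2 hK))
  have hinv := hp3.inv hne ⟨K, fun c hc x => by
    rw [abs_inv]; exact inv_le_of_inv_le₀ hK (hc.2.2.2.inv_le x)⟩
  have hr2 := bd X.symb_r (by norm_num)
  have hratio : BddDerivs S 2 (fun c x => X.r (jet 4 c.1 x) x c.2.2 / X.p (jet 4 c.1 x) x c.2.2) :=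
    (hr2.mul (hinv.mono (by norm_num))).congr fun c _ x => div_eq_mul_inv _ _
  have hphase : ∀ c ∈ S, ∀ x, HasDerivAt (fun x => X.phase c.1 c.2.2 x)
      (X.r (jet 4 c.1 x) x c.2.2 / X.p (jet 4 c.1 x) x c.2.2) x := by
    intro c hc x
    exact X.hasDerivAt_phase ((hU c hc).of_le (by norm_num)) (hτ c hc) (hne c hc) x
  have hexp : BddDerivs S 3 (fun c x => Real.exp (2 / 3 * X.phase c.1 c.2.2 x)) := by
    refine (hratio.const_mul (2 / 3)).of_hasDerivAt_mul (fun c hc x => ?_)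
      ⟨Real.exp (2 / 3 * K), fun c hc x => ?_⟩
    · refine ((hphase c hc x).const_mul (2 / 3)).exp.congr_deriv ?_
      ring
    · rw [abs_of_pos (Real.exp_pos _), Real.exp_le_exp]
      have := (abs_le.1 (hc.2.2.2.phase_le x)).2
      linarith
  -- A continuous nowhere vanishing p has a constant sign, read off at x = 0; hence |p| = σ p is as
  -- smooth as p.
  let σ : (ℝ → ℝ) × (ℝ → ℝ) × ℝ → ℝ := fun c => if 0 < X.p (jet 4 c.1 0) 0 c.2.2 then 1 else -1
  have hσ : ∀ c ∈ S, ∀ x, |X.p (jet 4 c.1 x) x c.2.2| = σ c * X.p (jet 4 c.1 x) x c.2.2 := by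
    intro c hc x
    obtain ⟨-, A', hd, -⟩ := hp3
    have hcont : Continuous (fun x => X.p (jet 4 c.1 x) x c.2.2) :=
      continuous_iff_continuousAt.2 fun x => (hd c hc x).continuousAt
    by_cases h0 : 0 < X.p (jet 4 c.1 0) 0 c.2.2
    · have : 0 < X.p (jet 4 c.1 x) x c.2.2 := by
        by_contra h
        obtain ⟨y, hy⟩ := mem_range_of_exists_le_of_exists_ge hcont
          ⟨x, not_lt.1 h⟩ ⟨0, h0.le⟩
        exact hne c hc y hy
      simp [σ, h0, abs_of_pos this]
    · have : X.p (jet 4 c.1 x) x c.2.2 < 0 := by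
        by_contra h
        obtain ⟨y, hy⟩ := mem_range_of_exists_le_of_exists_ge hcont
          ⟨0, not_lt.1 h0⟩ ⟨x, not_lt.1 h⟩
        exact hne c hc y hy
      simp [σ, h0, abs_of_neg this]
  have hσb : ∀ c ∈ S, |σ c| ≤ 1 := fun c _ => by
    simp only [σ]; split_ifs <;> simp
  have hw : BddDerivs S 3 (fun c x => X.weight c.1 c.2.2 x) :=
    (((BddDerivs.const hσb 3).mul hp3).mul hexp).congr fun c hc x => by
      rw [weight, hσ c hc]
  have hk1 := bd X.symb_k (by norm_num)
  have hq1 := bd X.symb_q (by norm_num)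
  have hh1 := bd X.symb_h₁ (by norm_num)
  have hh2 := bd X.symb_h₂ (by norm_num)
  have hh3 := bd X.symb_h₃ (by norm_num)
  have hu4 : BddDerivs S 1 (fun c => iteratedDeriv 4 c.1) :=
    BddDerivs.iteratedDeriv hU hUK (by norm_num)
  have hu4' : BddDerivs S 1 (fun c => iteratedDeriv 4 c.2.1) :=
    BddDerivs.iteratedDeriv hU' hUK' (by norm_num)
  have hu5' : BddDerivs S 1 (fun c => iteratedDeriv 5 c.2.1) :=
    BddDerivs.iteratedDeriv hU' hUK' (by norm_num)
  have hc1 : BddDerivs S 1 (fun c x => X.coeffOne c.1 c.2.1 c.2.2 x) :=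
    ((((hq1.mul hu5').const_mul 3).add hh1).add (hh2.mul (hu4.add hu4'))).add
      (hh3.mul ((hu4.mul hu4).add ((hu4.mul hu4').add (hu4'.mul hu4'))))
  -- Two derivatives are needed here, while k and q are recorded with one only. The expression k + q
  -- u_4 is the derivative of p, which has three, and uniqueness of derivatives transfers the bound.
  have hc2 : BddDerivs S 2 (fun c x => X.coeffTwo c.1 c.2.2 x) := by
    obtain ⟨-, A', hd, hA'⟩ := hp3
    refine (hr2.add (hA'.const_mul 3)).congr fun c hc x => ?_
    rw [coeffTwo, (hd c hc x).unique (X.deriv_p _ (hτ c hc) _ ((hU c hc).of_le (by norm_num)) x)]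
  obtain ⟨-, q₁, hq₁, hq₁b, q₂, hq₂, hq₂b⟩ := (hw.mono (m := 2) (by norm_num)).mul hc2
  obtain ⟨-, m₁, hm₁, hm₁b⟩ := (hw.mono (m := 1) (by norm_num)).mul hc1
  obtain ⟨C₁, hC₁⟩ := hp3.exists_bound
  obtain ⟨C₂, hC₂⟩ := hc2.exists_bound
  obtain ⟨C₃, hC₃⟩ := hc1.exists_bound
  obtain ⟨C₄, hC₄⟩ := hq₁b
  obtain ⟨C₅, hC₅⟩ := hq₂b
  obtain ⟨C₆, hC₆⟩ := hm₁b
  obtain ⟨C₇, hC₇⟩ := hw.exists_bound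
  -- L is the lower bound for the weight that comes from |p| ≥ 1/K and a phase of at least -K.
  set L := K⁻¹ * Real.exp (-(2 / 3 * K)) with hL
  have hL0 : 0 < L := by positivity
  set C := 1 + |C₁| + |C₂| + |C₃| + |C₄| + |C₅| + |C₆| + |C₇| + L⁻¹ with hC
  have hLi : 0 < L⁻¹ := by positivity
  have h1 := abs_nonneg C₁
  have h2 := abs_nonneg C₂
  have h3 := abs_nonneg C₃
  have h4 := abs_nonneg C₄
  have h5 := abs_nonneg C₅
  have h6 := abs_nonneg C₆
  have h7 := abs_nonneg C₇
  have h1' := le_abs_self C₁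
  have h2' := le_abs_self C₂
  have h3' := le_abs_self C₃
  have h4' := le_abs_self C₄
  have h5' := le_abs_self C₅
  have h6' := le_abs_self C₆
  have h7' := le_abs_self C₇
  refine ⟨C, by linarith, fun u u' t hu hu' ht hN => ?_⟩
  have hcS : ((u, u', t) : (ℝ → ℝ) × (ℝ → ℝ) × ℝ) ∈ S := ⟨hu, hu', ht, hN⟩
  refine ⟨fun x => ⟨?_, ?_⟩, ?_, q₁ (u, u', t), q₂ (u, u', t), m₁ (u, u', t), fun x => ?_,
    hq₁ _ hcS, hq₂ _ hcS, hm₁ _ hcS, fun x => ⟨?_, ?_, ?_, ?_, ?_, ?_⟩⟩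
  · refine (inv_le_of_inv_le₀ hL0 (by linarith)).trans ?_
    rw [weight, hL]
    have := (abs_le.1 (hN.phase_le x)).1
    exact mul_le_mul (hN.inv_le x) (Real.exp_le_exp.2 (by linarith)) (Real.exp_pos _).le
      (abs_nonneg _)
  · have := (le_abs_self _).trans (hC₇ _ hcS x)
    simp only at this
    linarith
  · obtain ⟨-, A', hd, -⟩ := hw
    exact continuous_iff_continuousAt.2 fun x => (hd _ hcS x).continuousAt
  · have hpd := X.deriv_p t ht u ((hU _ hcS).of_le (by norm_num)) x
    have hed : HasDerivAt (fun x => Real.exp (2 / 3 * X.phase u t x)) _ x :=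
      ((hphase _ hcS x).const_mul (2 / 3)).exp
    have heq : (fun x => X.weight u t x * X.p (jet 4 u x) x t) = fun x =>
        (σ (u, u', t) * X.p (jet 4 u x) x t * Real.exp (2 / 3 * X.phase u t x))
          * X.p (jet 4 u x) x t := by
      ext y; rw [weight, hσ _ hcS]
    rw [heq, weight, hσ _ hcS, coeffTwo]
    refine (((hpd.const_mul (σ (u, u', t))).fun_mul hed).fun_mul hpd).congr_deriv ?_
    have := hne _ hcS x
    simp only at this ⊢
    field_simp
    ring
  · exact (hC₁ _ hcS x).trans (by linarith)
  · exact (hC₂ _ hcS x).trans (by linarith)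
  · exact (hC₃ _ hcS x).trans (by linarith)
  · exact (hC₄ _ hcS x).trans (by linarith)
  · exact (hC₅ _ hcS x).trans (by linarith)
  · exact (hC₆ _ hcS x).trans (by linarith)

end Expansion

theorem abs_mul_le_mul_mul {a m A B d : ℝ} (ha : |a| ≤ A * d) (hm : |m| ≤ B) :
    |a * m| ≤ A * B * d := by
  rw [abs_mul]
  calc |a| * |m| ≤ (A * d) * B := mul_le_mul ha hm (abs_nonneg _) ((abs_nonneg _).trans ha)
    _ = _ := by ring

theorem HighBound.contDiff {K : ℝ} {u : ℝ → ℝ} (hu : HighBound K u) : ContDiff ℝ 6 u :=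
  hu.memH.contDiff

namespace Expansion

variable {f : (Fin 4 → ℝ) → ℝ → ℝ → ℝ} (X : Expansion f)

/-- The third total derivative is linear in the top order derivatives, up to a term that is
controlled by the derivatives of order at most three. -/
theorem exists_remainder_bound (K : ℝ) : ∃ C : ℝ, 0 ≤ C ∧
    ∀ u u' t, HighBound K u → HighBound K u' → t ∈ timeInterval → ∀ x,
      |X.total 3 (jets u x) x t - X.total 3 (jets u' x) x t
        - (X.p (jet 4 u x) x t * (iteratedDeriv 6 u x - iteratedDeriv 6 u' x)
          + X.coeffTwo u t x * (iteratedDeriv 5 u x - iteratedDeriv 5 u' x)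
          + X.coeffOne u u' t x * (iteratedDeriv 4 u x - iteratedDeriv 4 u' x))|
      ≤ C * ∑ j ∈ Finset.range 4, |iteratedDeriv j u x - iteratedDeriv j u' x| := by
  have key : ∀ {g : (Fin 4 → ℝ) → ℝ → ℝ → ℝ}, UnifLip g → ∃ C : ℝ, 0 ≤ C ∧
      ∀ u u' t, HighBound K u → HighBound K u' → t ∈ timeInterval → ∀ x,
        |g (jet 4 u x) x t - g (jet 4 u' x) x t|
          ≤ C * ∑ j ∈ Finset.range 4, |iteratedDeriv j u x - iteratedDeriv j u' x| := by
    intro g hg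
    obtain ⟨C, h0, hC⟩ := hg.jetLip (N := 3) (by norm_num) K
    exact ⟨C, h0, fun u u' t hu hu' ht x => (hC (jets u x) (jets u' x)
      (fun j hj => hu.le j (by omega) x) (fun j hj => hu'.le j (by omega) x) x t ht).2⟩
  obtain ⟨Cp, cp, hp⟩ := key X.symb_p.unifLip
  obtain ⟨Cr, cr, hr⟩ := key X.symb_r.unifLip
  obtain ⟨Ck, ck, hk⟩ := key X.symb_k.unifLip
  obtain ⟨Cq, cq, hq⟩ := key X.symb_q.unifLip
  obtain ⟨C0, c0, h0⟩ := key X.symb_h₀.unifLip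
  obtain ⟨C1, c1, h1⟩ := key X.symb_h₁.unifLip
  obtain ⟨C2, c2, h2⟩ := key X.symb_h₂.unifLip
  obtain ⟨C3, c3, h3⟩ := key X.symb_h₃.unifLip
  set L := max K 0 with hL
  have hL0 : 0 ≤ L := le_max_right _ _
  refine ⟨Cp * L + Cr * L + Ck * (3 * L) + Cq * (3 * (L * L)) + C0 + C1 * L + C2 * L ^ 2
    + C3 * L ^ 3, by positivity, fun u u' t hu hu' ht x => ?_⟩
  set d := ∑ j ∈ Finset.range 4, |iteratedDeriv j u x - iteratedDeriv j u' x| with hd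
  have b4 := (hu'.le 4 (by norm_num) x).trans (le_max_left K 0)
  have b5 := (hu'.le 5 (by norm_num) x).trans (le_max_left K 0)
  have b6 := (hu'.le 6 (by norm_num) x).trans (le_max_left K 0)
  rw [← hL] at b4 b5 b6
  have e1 := abs_mul_le_mul_mul (hp u u' t hu hu' ht x) b6
  have e2 := abs_mul_le_mul_mul (hr u u' t hu hu' ht x) b5
  have e3 := abs_mul_le_mul_mul (m := 3 * iteratedDeriv 5 u' x) (B := 3 * L)
    (hk u u' t hu hu' ht x) (by rw [abs_mul, abs_of_pos (by norm_num : (0 : ℝ) < 3)]; linarith)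
  have e4 := abs_mul_le_mul_mul (m := 3 * (iteratedDeriv 4 u' x * iteratedDeriv 5 u' x))
    (B := 3 * (L * L)) (hq u u' t hu hu' ht x) (by
      rw [abs_mul, abs_mul, abs_of_pos (by norm_num : (0 : ℝ) < 3)]
      gcongr)
  have e5 := h0 u u' t hu hu' ht x
  have e6 := abs_mul_le_mul_mul (h1 u u' t hu hu' ht x) b4
  have e7 := abs_mul_le_mul_mul (m := iteratedDeriv 4 u' x ^ 2) (B := L ^ 2)
    (h2 u u' t hu hu' ht x) (by rw [abs_pow]; gcongr)
  have e8 := abs_mul_le_mul_mul (m := iteratedDeriv 4 u' x ^ 3) (B := L ^ 3)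
    (h3 u u' t hu hu' ht x) (by rw [abs_pow]; gcongr)
  rw [← hd] at e1 e2 e3 e4 e5 e6 e7 e8
  rw [abs_le] at e1 e2 e3 e4 e5 e6 e7 e8
  -- Every product is split so that the differences of u_4, u_5, u_6 carry coefficients at u (with
  -- some factors from u' in the coefficient of w_4). What is left are differences of symbols,
  -- Lipschitz in the 3-jet, times bounded derivatives of u'.
  have hid : X.total 3 (jets u x) x t - X.total 3 (jets u' x) x t
        - (X.p (jet 4 u x) x t * (iteratedDeriv 6 u x - iteratedDeriv 6 u' x)
          + X.coeffTwo u t x * (iteratedDeriv 5 u x - iteratedDeriv 5 u' x)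
          + X.coeffOne u u' t x * (iteratedDeriv 4 u x - iteratedDeriv 4 u' x))
      = (X.p (jet 4 u x) x t - X.p (jet 4 u' x) x t) * iteratedDeriv 6 u' x
        + (X.r (jet 4 u x) x t - X.r (jet 4 u' x) x t) * iteratedDeriv 5 u' x
        + (X.k (jet 4 u x) x t - X.k (jet 4 u' x) x t) * (3 * iteratedDeriv 5 u' x)
        + (X.q (jet 4 u x) x t - X.q (jet 4 u' x) x t)
          * (3 * (iteratedDeriv 4 u' x * iteratedDeriv 5 u' x))
        + (X.h₀ (jet 4 u x) x t - X.h₀ (jet 4 u' x) x t)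
        + (X.h₁ (jet 4 u x) x t - X.h₁ (jet 4 u' x) x t) * iteratedDeriv 4 u' x
        + (X.h₂ (jet 4 u x) x t - X.h₂ (jet 4 u' x) x t) * iteratedDeriv 4 u' x ^ 2
        + (X.h₃ (jet 4 u x) x t - X.h₃ (jet 4 u' x) x t) * iteratedDeriv 4 u' x ^ 3 := by
    change X.p (jet 4 u x) x t * iteratedDeriv 6 u x + X.coeffTwo u t x * iteratedDeriv 5 u x
        + X.h₀ (jet 4 u x) x t + X.h₁ (jet 4 u x) x t * iteratedDeriv 4 u x
        + X.h₂ (jet 4 u x) x t * iteratedDeriv 4 u x ^ 2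
        + X.h₃ (jet 4 u x) x t * iteratedDeriv 4 u x ^ 3
      - (X.p (jet 4 u' x) x t * iteratedDeriv 6 u' x + X.coeffTwo u' t x * iteratedDeriv 5 u' x
        + X.h₀ (jet 4 u' x) x t + X.h₁ (jet 4 u' x) x t * iteratedDeriv 4 u' x
        + X.h₂ (jet 4 u' x) x t * iteratedDeriv 4 u' x ^ 2
        + X.h₃ (jet 4 u' x) x t * iteratedDeriv 4 u' x ^ 3) - _ = _
    simp only [coeffTwo, coeffOne]
    ring
  rw [hid, abs_le]
  constructor <;> linarith

end Expansion

/-! ### Integration by parts for the weighted operator -/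

/-- Bound for `|a b|` by squares, for use under the integral. -/
theorem abs_mul_le_add_sq {a b : ℝ} : |a * b| ≤ a ^ 2 + b ^ 2 := by
  rw [abs_le]
  constructor <;> nlinarith [sq_nonneg (a + b), sq_nonneg (a - b)]

theorem sum_abs_sq_le (N : ℕ) (y : ℕ → ℝ) :
    (∑ j ∈ Finset.range N, |y j|) ^ 2 ≤ N * ∑ j ∈ Finset.range N, y j ^ 2 := by
  have := sq_sum_le_card_mul_sum_sq (s := Finset.range N) (f := fun j => |y j|)
  simpa using this

/-- A weighted third order operator `p ∂^3 + q ∂^2 + m ∂` with `p' = 2 q / 3` does not lose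
derivatives in `L²`. -/
theorem neg_integral_le_of_hasDerivAt {W W₁ W₂ W₃ p q q₁ q₂ m m₁ ρ s : ℝ → ℝ} {C : ℝ} (hC : 0 ≤ C)
    (hW : ∀ x, HasDerivAt W (W₁ x) x) (hW₁ : ∀ x, HasDerivAt W₁ (W₂ x) x)
    (hW₂ : ∀ x, HasDerivAt W₂ (W₃ x) x)
    (hp : ∀ x, HasDerivAt p (2 / 3 * q x) x) (hq : ∀ x, HasDerivAt q (q₁ x) x)
    (hq₁ : ∀ x, HasDerivAt q₁ (q₂ x) x) (hm : ∀ x, HasDerivAt m (m₁ x) x)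
    (hpC : ∀ x, |p x| ≤ C) (hqC : ∀ x, |q x| ≤ C) (hmC : ∀ x, |m x| ≤ C)
    (hq₁C : ∀ x, |q₁ x| ≤ C) (hq₂C : ∀ x, |q₂ x| ≤ C) (hm₁C : ∀ x, |m₁ x| ≤ C)
    (iW : Integrable (fun x => W x ^ 2)) (iW₁ : Integrable (fun x => W₁ x ^ 2))
    (iW₂ : Integrable (fun x => W₂ x ^ 2)) (iW₃ : Integrable (fun x => W₃ x ^ 2))
    (hρ : Integrable ρ) (hs : Integrable s) (hρs : ∀ x, |ρ x| ≤ s x) :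
    -∫ x, (W x * (p x * W₃ x + q x * W₂ x + m x * W₁ x) + ρ x)
      ≤ C * (∫ x, W x ^ 2) + ∫ x, s x := by
  -- B collects the boundary terms of the integrations by parts. In its derivative W₁² has the
  -- coefficient -p'/2 + q/3, which vanishes since p' = 2q/3, and W W₂ has p' + q/3 = q. Only a
  -- multiple of W² separates B' from the integrand.
  set B : ℝ → ℝ := fun x => p x * (W x * W₂ x) - 1 / 2 * (p x * (W₁ x * W₁ x))
    + 1 / 3 * (q x * (W x * W₁ x)) - 1 / 6 * (q₁ x * (W x * W x)) + 1 / 2 * (m x * (W x * W x))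
    with hB
  set B' : ℝ → ℝ := fun x => W x * (p x * W₃ x + q x * W₂ x + m x * W₁ x)
    - (1 / 6 * q₂ x - 1 / 2 * m₁ x) * W x ^ 2 with hB'
  have hBd : ∀ x, HasDerivAt B (B' x) x := by
    intro x
    refine ((((((hp x).fun_mul ((hW x).fun_mul (hW₂ x))).fun_sub
      (((hp x).fun_mul ((hW₁ x).fun_mul (hW₁ x))).const_mul (1 / 2))).fun_add
      (((hq x).fun_mul ((hW x).fun_mul (hW₁ x))).const_mul (1 / 3))).fun_sub
      (((hq₁ x).fun_mul ((hW x).fun_mul (hW x))).const_mul (1 / 6))).fun_add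
      (((hm x).fun_mul ((hW x).fun_mul (hW x))).const_mul (1 / 2))).congr_deriv ?_
    simp only [hB']
    ring
  have hBc : Continuous B := continuous_iff_continuousAt.2 fun x => (hBd x).continuousAt
  have hBm : AEStronglyMeasurable B' volume := by
    have : B' = deriv B := by ext x; exact (hBd x).deriv.symm
    rw [this]
    exact (measurable_deriv B).aestronglyMeasurable
  have hS : Integrable (fun x => 5 * C * (W x ^ 2 + W₁ x ^ 2 + W₂ x ^ 2 + W₃ x ^ 2)) :=
    (((iW.add iW₁).add iW₂).add iW₃).const_mul _
  have key : ∀ {a b c d : ℝ}, |c| ≤ C → a ^ 2 + b ^ 2 ≤ d → |c * (a * b)| ≤ C * d := by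
    intro a b c d hc hd
    rw [abs_mul]
    exact mul_le_mul hc (abs_mul_le_add_sq.trans hd) (abs_nonneg _) hC
  have hBi : Integrable B := by
    refine hS.mono' hBc.aestronglyMeasurable (ae_of_all _ fun x => ?_)
    have n0 := sq_nonneg (W x)
    have n1 := sq_nonneg (W₁ x)
    have n2 := sq_nonneg (W₂ x)
    have n3 := sq_nonneg (W₃ x)
    have e1 := abs_le.1 (key (d := W x ^ 2 + W₂ x ^ 2) (hpC x) (le_refl (W x ^ 2 + W₂ x ^ 2)))
    have e2 := abs_le.1 (key (hpC x) (le_refl (W₁ x ^ 2 + W₁ x ^ 2)))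
    have e3 := abs_le.1 (key (hqC x) (le_refl (W x ^ 2 + W₁ x ^ 2)))
    have e4 := abs_le.1 (key (hq₁C x) (le_refl (W x ^ 2 + W x ^ 2)))
    have e5 := abs_le.1 (key (hmC x) (le_refl (W x ^ 2 + W x ^ 2)))
    have m0 := mul_nonneg hC n0
    have m1 := mul_nonneg hC n1
    have m2 := mul_nonneg hC n2
    have m3 := mul_nonneg hC n3
    rw [Real.norm_eq_abs, abs_le]
    simp only [hB]
    constructor <;> linarith
  have hB'i : Integrable B' := by
    refine hS.mono' hBm (ae_of_all _ fun x => ?_)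
    have n0 := sq_nonneg (W x)
    have n1 := sq_nonneg (W₁ x)
    have n2 := sq_nonneg (W₂ x)
    have n3 := sq_nonneg (W₃ x)
    have e1 := abs_le.1 (key (hpC x) (le_refl (W x ^ 2 + W₃ x ^ 2)))
    have e2 := abs_le.1 (key (hqC x) (le_refl (W x ^ 2 + W₂ x ^ 2)))
    have e3 := abs_le.1 (key (hmC x) (le_refl (W x ^ 2 + W₁ x ^ 2)))
    have e4 := abs_le.1 (key (hq₂C x) (le_refl (W x ^ 2 + W x ^ 2)))
    have e5 := abs_le.1 (key (hm₁C x) (le_refl (W x ^ 2 + W x ^ 2)))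
    have m0 := mul_nonneg hC n0
    have m1 := mul_nonneg hC n1
    have m2 := mul_nonneg hC n2
    have m3 := mul_nonneg hC n3
    rw [Real.norm_eq_abs, abs_le]
    simp only [hB']
    constructor <;> linarith
  have h0 : ∫ x, B' x = 0 := integral_eq_zero_of_hasDerivAt_of_integrable hBd hB'i hBi
  have hpt : ∀ x, -(W x * (p x * W₃ x + q x * W₂ x + m x * W₁ x) + ρ x)
      ≤ -B' x + (C * W x ^ 2 + s x) := by
    intro x
    have e1 := abs_le.1 (hq₂C x)
    have e2 := abs_le.1 (hm₁C x)
    have e3 := abs_le.1 (hρs x)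
    have n0 := sq_nonneg (W x)
    simp only [hB']
    nlinarith
  have hI : Integrable (fun x => W x * (p x * W₃ x + q x * W₂ x + m x * W₁ x) + ρ x) := by
    have hm₁i : Integrable (fun x => (1 / 6 * q₂ x - 1 / 2 * m₁ x) * W x ^ 2) := by
      have m2 : Measurable q₂ := by
        have : q₂ = deriv q₁ := by ext x; exact (hq₁ x).deriv.symm
        rw [this]; exact measurable_deriv _
      have m1 : Measurable m₁ := by
        have : m₁ = deriv m := by ext x; exact (hm x).deriv.symm
        rw [this]; exact measurable_deriv _
      refine (iW.bdd_mul (c := C) ((m2.const_mul _).sub (m1.const_mul _)).aestronglyMeasurable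
        (ae_of_all _ fun x => ?_))
      have e1 := abs_le.1 (hq₂C x)
      have e2 := abs_le.1 (hm₁C x)
      rw [Real.norm_eq_abs, abs_le]
      constructor <;> linarith
    refine ((hB'i.add hm₁i).add hρ).congr (ae_of_all _ fun x => ?_)
    simp only [hB', Pi.add_apply]
    ring
  rw [← integral_neg]
  calc _ ≤ ∫ x, (-B' x + (C * W x ^ 2 + s x)) :=
        integral_mono hI.neg (hB'i.neg.add ((iW.const_mul C).add hs)) hpt
    _ = _ := by
      have e1 : ∫ x, (-B' x + (C * W x ^ 2 + s x)) = (∫ x, -B' x) + ∫ x, (C * W x ^ 2 + s x) :=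
        integral_add hB'i.neg ((iW.const_mul C).add hs)
      have e2 : ∫ x, (C * W x ^ 2 + s x) = (∫ x, C * W x ^ 2) + ∫ x, s x :=
        integral_add (iW.const_mul C) hs
      rw [e1, e2, integral_neg, h0, integral_const_mul]
      ring

/-! ### The energy estimate at a fixed time -/

/-- The square of the `H^3` norm. -/
noncomputable def hThreeSq (w : ℝ → ℝ) : ℝ := ∑ j ∈ Finset.range 4, ∫ x, iteratedDeriv j w x ^ 2

theorem hThreeSq_nonneg (w : ℝ → ℝ) : 0 ≤ hThreeSq w :=
  Finset.sum_nonneg fun _ _ => integral_nonneg fun _ => sq_nonneg _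

theorem integral_le_hThreeSq (w : ℝ → ℝ) {j : ℕ} (hj : j ≤ 3) :
    ∫ x, iteratedDeriv j w x ^ 2 ≤ hThreeSq w :=
  Finset.single_le_sum (f := fun j => ∫ x, iteratedDeriv j w x ^ 2)
    (fun _ _ => integral_nonneg fun _ => sq_nonneg _) (Finset.mem_range.2 (by omega))

/-- Integration by parts turns ∫ w_{j+1}² into -∫ w_j w_{j+2}, and Young's inequality does the rest.
-/
theorem MemH.integral_sq_le_half {k j : ℕ} {w : ℝ → ℝ} (hw : MemH k w) (hj : j + 2 < k) :
    2 * ∫ x, iteratedDeriv (j + 1) w x ^ 2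
      ≤ (∫ x, iteratedDeriv j w x ^ 2) + ∫ x, iteratedDeriv (j + 2) w x ^ 2 := by
  have m0 := hw.memLp j (by omega)
  have m1 := hw.memLp (j + 1) (by omega)
  have m2 := hw.memLp (j + 2) (by omega)
  have i01 : Integrable (fun x => iteratedDeriv j w x * iteratedDeriv (j + 1) w x) :=
    m0.integrable_mul m1
  have i02 : Integrable (fun x => iteratedDeriv j w x * iteratedDeriv (j + 2) w x) :=
    m0.integrable_mul m2
  have i11 : Integrable (fun x => iteratedDeriv (j + 1) w x ^ 2) := m1.integrable_sq
  have i00 : Integrable (fun x => iteratedDeriv j w x ^ 2) := m0.integrable_sq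
  have i22 : Integrable (fun x => iteratedDeriv (j + 2) w x ^ 2) := m2.integrable_sq
  have h0 : ∫ x, (iteratedDeriv (j + 1) w x ^ 2 + iteratedDeriv j w x * iteratedDeriv (j + 2) w x)
      = 0 := by
    refine integral_eq_zero_of_hasDerivAt_of_integrable
      (f := fun x => iteratedDeriv j w x * iteratedDeriv (j + 1) w x) (fun x => ?_)
      (i11.add i02) i01
    refine ((hw.hasDerivAt (j := j) (by omega) x).fun_mul
      (hw.hasDerivAt (j := j + 1) (by omega) x)).congr_deriv ?_
    ring
  have h1 : ∫ x, (2 * iteratedDeriv (j + 1) w x ^ 2) ≤ ∫ x, ((iteratedDeriv j w x ^ 2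
      + iteratedDeriv (j + 2) w x ^ 2) + 2 * (iteratedDeriv (j + 1) w x ^ 2
        + iteratedDeriv j w x * iteratedDeriv (j + 2) w x)) := by
    refine integral_mono (i11.const_mul 2) ((i00.add i22).add ((i11.add i02).const_mul 2))
      fun x => ?_
    simp only
    nlinarith [sq_nonneg (iteratedDeriv j w x + iteratedDeriv (j + 2) w x)]
  have h2 : ∫ x, ((iteratedDeriv j w x ^ 2
      + iteratedDeriv (j + 2) w x ^ 2) + 2 * (iteratedDeriv (j + 1) w x ^ 2
        + iteratedDeriv j w x * iteratedDeriv (j + 2) w x))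
      = (∫ x, (iteratedDeriv j w x ^ 2 + iteratedDeriv (j + 2) w x ^ 2))
        + ∫ x, 2 * (iteratedDeriv (j + 1) w x ^ 2
          + iteratedDeriv j w x * iteratedDeriv (j + 2) w x) :=
    integral_add (i00.add i22) ((i11.add i02).const_mul 2)
  rw [h2, integral_const_mul, integral_const_mul, h0, integral_add i00 i22] at h1
  linarith

/-- Adding the two interpolation inequalities bounds the squares of orders one and two by those of
orders zero and three. This is why the energy needs only those two. -/
theorem MemH.hThreeSq_le {w : ℝ → ℝ} (hw : MemH 7 w) :
    hThreeSq w ≤ 2 * ((∫ x, iteratedDeriv 0 w x ^ 2) + ∫ x, iteratedDeriv 3 w x ^ 2) := by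
  have h1 := hw.integral_sq_le_half (j := 0) (by norm_num)
  have h2 := hw.integral_sq_le_half (j := 1) (by norm_num)
  simp only [hThreeSq, Finset.sum_range_succ, Finset.sum_range_zero] at *
  norm_num at h1 h2 ⊢
  linarith

namespace Expansion

variable {f : (Fin 4 → ℝ) → ℝ → ℝ → ℝ} (X : Expansion f)

/-- The difference of the total derivatives along two functions. -/
noncomputable def diffTotal (i : ℕ) (u u' : ℝ → ℝ) (t x : ℝ) : ℝ :=
  X.total i (jets u x) x t - X.total i (jets u' x) x t

theorem continuousOn_total {α : Type*} [TopologicalSpace α] {S : Set α} {Y : α → ℕ → ℝ}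
    {ξ τ : α → ℝ} {i : ℕ} (hi : i ≤ 3) (hY : ∀ j ≤ i + 3, ContinuousOn (fun a => Y a j) S)
    (hξ : ContinuousOn ξ S) (hτ : ContinuousOn τ S) (hτI : ∀ a ∈ S, τ a ∈ timeInterval) :
    ContinuousOn (fun a => X.total i (Y a) (ξ a) (τ a)) S := by
  have hs : ∀ {g : (Fin 4 → ℝ) → ℝ → ℝ → ℝ}, UnifLip g →
      ContinuousOn (fun a => g (fun j => Y a j) (ξ a) (τ a)) S := by
    intro g hg
    have h1 : ContinuousOn (fun a => ((fun j : Fin 4 => Y a j), ξ a, τ a)) S :=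
      (continuousOn_pi.2 fun j : Fin 4 => hY j (by omega)).prodMk (hξ.prodMk hτ)
    exact hg.continuousOn.comp h1 fun a ha => ⟨trivial, trivial, hτI a ha⟩
  have sp := hs X.symb_p.unifLip
  have sr := hs X.symb_r.unifLip
  have sk := hs X.symb_k.unifLip
  have sq := hs X.symb_q.unifLip
  interval_cases i
  · exact hs X.unifLip
  · have h4 := hY 4 (by norm_num)
    exact (hs X.symb_l₀.unifLip).add (sp.mul h4)
  · have h4 := hY 4 (by norm_num)
    have h5 := hY 5 (by norm_num)
    exact (((hs X.symb_l₁.unifLip).add ((sr.add (continuousOn_const.mul sk)).mul h4)).add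
      (sq.mul (h4.pow 2))).add (sp.mul h5)
  · have h4 := hY 4 (by norm_num)
    have h5 := hY 5 (by norm_num)
    have h6 := hY 6 (by norm_num)
    exact (((((sp.mul h6).add ((sr.add (continuousOn_const.mul (sk.add (sq.mul h4)))).mul h5)).add
      (hs X.symb_h₀.unifLip)).add ((hs X.symb_h₁.unifLip).mul h4)).add
      ((hs X.symb_h₂.unifLip).mul (h4.pow 2))).add ((hs X.symb_h₃.unifLip).mul (h4.pow 3))

theorem continuous_total {i : ℕ} (hi : i ≤ 3) {K t : ℝ} {u : ℝ → ℝ} (hu : HighBound K u)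
    (ht : t ∈ timeInterval) : Continuous (fun x => X.total i (jets u x) x t) :=
  continuousOn_univ.1 <| X.continuousOn_total hi
    (fun _ _ => (hu.memH.continuous (by omega)).continuousOn)
    continuousOn_id continuousOn_const fun _ _ => ht

theorem exists_diffTotal_bound (K : ℝ) {i : ℕ} (hi : i ≤ 3) : ∃ C : ℝ, 0 ≤ C ∧
    ∀ u u' t, HighBound K u → HighBound K u' → t ∈ timeInterval →
      (∀ x, |X.diffTotal i u u' t x|
        ≤ C * ∑ j ∈ Finset.range (i + 4), |iteratedDeriv j (u - u') x|) ∧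
      MemLp (X.diffTotal i u u' t) 2 volume ∧
      ∫ x, X.diffTotal i u u' t x ^ 2
        ≤ C * ∑ j ∈ Finset.range (i + 4), ∫ x, iteratedDeriv j (u - u') x ^ 2 := by
  obtain ⟨C, h0, hC⟩ := X.jetLip_total hi K
  refine ⟨max C (C ^ 2 * (i + 4 : ℕ)), le_max_of_le_left h0, fun u u' t hu hu' ht => ?_⟩
  have hw := hu.memH.sub hu'.memH
  have hb : ∀ x, |X.diffTotal i u u' t x|
      ≤ C * ∑ j ∈ Finset.range (i + 4), |iteratedDeriv j (u - u') x| := by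
    intro x
    have := (hC (jets u x) (jets u' x) (fun j hj => hu.le j (by omega) x)
      (fun j hj => hu'.le j (by omega) x) x t ht).2
    refine this.trans (le_of_eq ?_)
    congr 1
    refine Finset.sum_congr rfl fun j hj => ?_
    rw [hu.memH.iteratedDeriv_sub hu'.memH (by have := Finset.mem_range.1 hj; omega)]
    rfl
  have hsq : ∀ x, X.diffTotal i u u' t x ^ 2
      ≤ C ^ 2 * (i + 4 : ℕ) * ∑ j ∈ Finset.range (i + 4), iteratedDeriv j (u - u') x ^ 2 := by
    intro x
    have h1 := pow_le_pow_left₀ (abs_nonneg _) (hb x) 2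
    rw [sq_abs, mul_pow] at h1
    refine h1.trans ?_
    rw [mul_assoc]
    exact mul_le_mul_of_nonneg_left (sum_abs_sq_le _ _) (sq_nonneg _)
  have hi' : Integrable (fun x => C ^ 2 * (i + 4 : ℕ) *
      ∑ j ∈ Finset.range (i + 4), iteratedDeriv j (u - u') x ^ 2) := by
    refine (integrable_finsetSum _ fun j hj => ?_).const_mul _
    exact hw.integrable_sq (by have := Finset.mem_range.1 hj; omega)
  have hcont : Continuous (X.diffTotal i u u' t) :=
    (X.continuous_total hi hu ht).sub (X.continuous_total hi hu' ht)
  have hint : Integrable (fun x => X.diffTotal i u u' t x ^ 2) :=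
    hi'.mono' (hcont.pow 2).aestronglyMeasurable (ae_of_all _ fun x => by
      rw [Real.norm_of_nonneg (sq_nonneg _)]; exact hsq x)
  refine ⟨fun x => (hb x).trans ?_, (memLp_two_iff_integrable_sq hcont.aestronglyMeasurable).2 hint,
    (integral_mono hint hi' hsq).trans ?_⟩
  · exact mul_le_mul_of_nonneg_right (le_max_left _ _) (Finset.sum_nonneg fun _ _ => abs_nonneg _)
  · rw [integral_const_mul, integral_finsetSum _ fun j hj =>
      hw.integrable_sq (by have := Finset.mem_range.1 hj; omega)]
    exact mul_le_mul_of_nonneg_right (le_max_right _ _)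
      (Finset.sum_nonneg fun _ _ => integral_nonneg fun _ => sq_nonneg _)

/-- The time derivative of the energy with the weight held fixed, where s₀ and s₃ stand for the
viscous terms. The top order part is `neg_integral_le_of_hasDerivAt` with coefficients multiplied by
the weight; everything else is Cauchy–Schwarz, since D⁰ f involves no more than three derivatives.
-/
theorem exists_energy_bound {K : ℝ} (hK : 0 < K) : ∃ C : ℝ, 0 ≤ C ∧
    ∀ u u' t, HighBound K u → HighBound K u' → t ∈ timeInterval → X.NonDegenerate K u t →
      ∀ s₀ s₃ : ℝ → ℝ, MemLp s₀ 2 volume → MemLp s₃ 2 volume →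
      ∫ x, (2 * (iteratedDeriv 0 (u - u') x * (-X.diffTotal 0 u u' t x + s₀ x))
        + X.weight u t x * (2 * (iteratedDeriv 3 (u - u') x * (-X.diffTotal 3 u u' t x + s₃ x))))
      ≤ C * (hThreeSq (u - u') + (∫ x, s₀ x ^ 2) + ∫ x, s₃ x ^ 2) := by
  obtain ⟨C₁, hC₁, h₁⟩ := X.exists_weight_derivs hK
  obtain ⟨C₂, hC₂, h₂⟩ := X.exists_remainder_bound K
  obtain ⟨C₀, hC₀, h₀⟩ := X.exists_diffTotal_bound K (i := 0) (by norm_num)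
  have hC₁0 : 0 ≤ C₁ := zero_le_one.trans hC₁
  refine ⟨(2 + C₀) + 2 * (C₁ * C₁) + 10 * (C₁ * C₂ + C₁) , by positivity,
    fun u u' t hu hu' ht hN s₀ s₃ hs₀ hs₃ => ?_⟩
  obtain ⟨hwt, hwc, q₁, q₂, m₁, hp, hq, hq₁, hm, hb⟩ := h₁ u u' t hu hu' ht hN
  have hwC : ∀ x, |X.weight u t x| ≤ C₁ := fun x => by
    rw [abs_of_nonneg ((inv_nonneg.2 hC₁0).trans (hwt x).1)]; exact (hwt x).2
  set w := u - u' with hw_def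
  have hw : MemH 7 w := hu.memH.sub hu'.memH
  have hint : ∀ j ≤ 6, Integrable (fun x => iteratedDeriv j w x ^ 2) := fun j hj =>
    hw.integrable_sq (by omega)
  have hd : ∀ j < 6, ∀ x, HasDerivAt (iteratedDeriv j w) (iteratedDeriv (j + 1) w x) x :=
    fun j hj x => hw.hasDerivAt (by omega) x
  have hws : ∀ j ≤ 6, ∀ x, iteratedDeriv j w x = iteratedDeriv j u x - iteratedDeriv j u' x :=
    fun j hj x => hu.memH.iteratedDeriv_sub hu'.memH (by omega) x
  obtain ⟨-, hΔ₀, hΔ₀N⟩ := h₀ u u' t hu hu' ht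
  obtain ⟨C₃, -, h₃⟩ := X.exists_diffTotal_bound K (i := 3) (by norm_num)
  obtain ⟨-, hΔ₃, -⟩ := h₃ u u' t hu hu' ht
  have hW : MemLp (iteratedDeriv 3 w) 2 volume := hw.memLp 3 (by norm_num)
  have hw0 : MemLp (iteratedDeriv 0 w) 2 volume := hw.memLp 0 (by norm_num)
  -- The weighted remainder of the linearization, dominated by s without any derivative of w beyond
  -- the third.
  set ρ : ℝ → ℝ := fun x => X.weight u t x * iteratedDeriv 3 w x *
    (X.diffTotal 3 u u' t x - (X.p (jet 4 u x) x t * iteratedDeriv 6 w x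
      + X.coeffTwo u t x * iteratedDeriv 5 w x + X.coeffOne u u' t x * iteratedDeriv 4 w x)) with hρ
  set s : ℝ → ℝ := fun x => C₁ * C₂ * (iteratedDeriv 3 w x ^ 2
    + 4 * ∑ j ∈ Finset.range 4, iteratedDeriv j w x ^ 2) with hs
  have hρs : ∀ x, |ρ x| ≤ s x := by
    intro x
    have e1 := h₂ u u' t hu hu' ht x
    rw [← hws 6 (by norm_num), ← hws 5 (by norm_num), ← hws 4 (by norm_num),
      Finset.sum_congr rfl fun j hj => by
        rw [← hws j (by have := Finset.mem_range.1 hj; omega)]] at e1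
    set d := ∑ j ∈ Finset.range 4, |iteratedDeriv j w x| with hdd
    have hd0 : 0 ≤ d := Finset.sum_nonneg fun _ _ => abs_nonneg _
    have e2 : d ^ 2 ≤ 4 * ∑ j ∈ Finset.range 4, iteratedDeriv j w x ^ 2 := by
      simpa using sum_abs_sq_le 4 fun j => iteratedDeriv j w x
    have e3 : |iteratedDeriv 3 w x| * d ≤ iteratedDeriv 3 w x ^ 2 + d ^ 2 := by
      rw [← sq_abs (iteratedDeriv 3 w x)]
      nlinarith [sq_nonneg (|iteratedDeriv 3 w x| - d), abs_nonneg (iteratedDeriv 3 w x)]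
    calc |ρ x| ≤ C₁ * |iteratedDeriv 3 w x| * (C₂ * d) := by
          rw [hρ]
          simp only [abs_mul]
          exact mul_le_mul (mul_le_mul_of_nonneg_right (hwC x) (abs_nonneg _)) e1 (abs_nonneg _)
            (by positivity)
      _ = C₁ * C₂ * (|iteratedDeriv 3 w x| * d) := by ring
      _ ≤ s x := mul_le_mul_of_nonneg_left (by linarith) (by positivity)
  have hsum : Integrable (fun x => ∑ j ∈ Finset.range 4, iteratedDeriv j w x ^ 2) :=
    integrable_finsetSum _ fun j hj => hint j (by have := Finset.mem_range.1 hj; omega)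
  have hsi : Integrable s := ((hint 3 (by norm_num)).add (hsum.const_mul 4)).const_mul _
  have hsN : ∫ x, s x ≤ 5 * (C₁ * C₂) * hThreeSq w := by
    have e1 : ∫ x, s x = C₁ * C₂ * ((∫ x, iteratedDeriv 3 w x ^ 2) + 4 * hThreeSq w) := by
      rw [hThreeSq, ← integral_finsetSum _ fun j hj =>
        hint j (by have := Finset.mem_range.1 hj; omega), ← integral_const_mul, hs,
        integral_const_mul]
      congr 1
      exact integral_add (hint 3 (by norm_num)) (hsum.const_mul 4)
    have e2 := integral_le_hThreeSq w (j := 3) le_rfl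
    rw [e1]
    have : 0 ≤ C₁ * C₂ := by positivity
    nlinarith
  have hcΔ : Continuous (X.diffTotal 3 u u' t) :=
    (X.continuous_total le_rfl hu ht).sub (X.continuous_total le_rfl hu' ht)
  have hWΔ : Integrable (fun x => X.weight u t x * (iteratedDeriv 3 w x * X.diffTotal 3 u u' t x)) :=
    (hW.integrable_mul hΔ₃).bdd_mul hwc.aestronglyMeasurable (ae_of_all _ hwC)
  have hC₁sq : C₁ ≤ C₁ * C₁ := by nlinarith
  have hmulC : ∀ {a : ℝ} x, |a| ≤ C₁ → |X.weight u t x * a| ≤ C₁ * C₁ := fun x ha => by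
    rw [abs_mul]; exact mul_le_mul (hwC x) ha (abs_nonneg _) hC₁0
  have hid : ∀ x, iteratedDeriv 3 w x * (X.weight u t x * X.p (jet 4 u x) x t * iteratedDeriv 6 w x
      + X.weight u t x * X.coeffTwo u t x * iteratedDeriv 5 w x
      + X.weight u t x * X.coeffOne u u' t x * iteratedDeriv 4 w x) + ρ x
      = X.weight u t x * (iteratedDeriv 3 w x * X.diffTotal 3 u u' t x) := by
    intro x; rw [hρ]; ring
  have hρi : Integrable ρ := by
    refine hsi.mono' ?_ (ae_of_all _ hρs)
    have hcq : Continuous (fun x => X.weight u t x * X.coeffTwo u t x) :=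
      continuous_iff_continuousAt.2 fun x => (hq x).continuousAt
    have hcp : Continuous (fun x => X.weight u t x * X.p (jet 4 u x) x t) :=
      continuous_iff_continuousAt.2 fun x => (hp x).continuousAt
    have hcm : Continuous (fun x => X.weight u t x * X.coeffOne u u' t x) :=
      continuous_iff_continuousAt.2 fun x => (hm x).continuousAt
    have hcw : ∀ j ≤ 6, Continuous (iteratedDeriv j w) := fun j hj => hw.continuous (by omega)
    have : ρ = fun x => X.weight u t x * (iteratedDeriv 3 w x * X.diffTotal 3 u u' t x)
        - iteratedDeriv 3 w x * (X.weight u t x * X.p (jet 4 u x) x t * iteratedDeriv 6 w x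
      + X.weight u t x * X.coeffTwo u t x * iteratedDeriv 5 w x
      + X.weight u t x * X.coeffOne u u' t x * iteratedDeriv 4 w x) := by
      ext x; rw [← hid]; ring
    rw [this]
    exact ((hwc.mul ((hcw 3 (by norm_num)).mul hcΔ)).sub ((hcw 3 (by norm_num)).mul
      (((hcp.mul (hcw 6 le_rfl)).add (hcq.mul (hcw 5 (by norm_num)))).add
        (hcm.mul (hcw 4 (by norm_num)))))).aestronglyMeasurable
  have main := neg_integral_le_of_hasDerivAt (C := C₁ * C₁) (by positivity)
    (hd 3 (by norm_num)) (hd 4 (by norm_num)) (hd 5 (by norm_num)) hp hq hq₁ hm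
    (fun x => hmulC x (hb x).1) (fun x => hmulC x (hb x).2.1) (fun x => hmulC x (hb x).2.2.1)
    (fun x => (hb x).2.2.2.1.trans hC₁sq) (fun x => (hb x).2.2.2.2.1.trans hC₁sq)
    (fun x => (hb x).2.2.2.2.2.trans hC₁sq) (hint 3 (by norm_num)) (hint 4 (by norm_num))
    (hint 5 (by norm_num)) (hint 6 le_rfl) hρi hsi hρs
  rw [integral_congr_ae (ae_of_all _ hid)] at main
  have hs0i := hs₀.integrable_sq
  have hs3i := hs₃.integrable_sq
  have hΔi := hΔ₀.integrable_sq
  set G : ℝ → ℝ := fun x => 2 * (iteratedDeriv 0 w x * (-X.diffTotal 0 u u' t x + s₀ x))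
    + X.weight u t x * (2 * (iteratedDeriv 3 w x * s₃ x)) with hG
  set H : ℝ → ℝ := fun x => 2 * iteratedDeriv 0 w x ^ 2 + X.diffTotal 0 u u' t x ^ 2 + s₀ x ^ 2
    + C₁ * (iteratedDeriv 3 w x ^ 2 + s₃ x ^ 2) with hH
  have hGi : Integrable G :=
    ((hw0.integrable_mul (hΔ₀.neg.add hs₀)).const_mul 2).add
      (((hW.integrable_mul hs₃).const_mul 2).bdd_mul hwc.aestronglyMeasurable (ae_of_all _ hwC))
  have i0 : Integrable (fun x => 2 * iteratedDeriv 0 w x ^ 2) := (hint 0 (by norm_num)).const_mul 2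
  have i3 : Integrable (fun x => C₁ * (iteratedDeriv 3 w x ^ 2 + s₃ x ^ 2)) :=
    ((hint 3 (by norm_num)).add hs3i).const_mul C₁
  have hHi : Integrable H := ((i0.add hΔi).add hs0i).add i3
  have hGH : ∫ x, G x ≤ ∫ x, H x := by
    refine integral_mono hGi hHi fun x => ?_
    simp only [hG, hH]
    have e1 : X.weight u t x * (2 * (iteratedDeriv 3 w x * s₃ x))
        ≤ C₁ * (iteratedDeriv 3 w x ^ 2 + s₃ x ^ 2) := by
      have := (inv_nonneg.2 hC₁0).trans (hwt x).1
      calc _ ≤ X.weight u t x * (iteratedDeriv 3 w x ^ 2 + s₃ x ^ 2) :=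
            mul_le_mul_of_nonneg_left (by nlinarith [sq_nonneg (iteratedDeriv 3 w x - s₃ x)]) this
        _ ≤ _ := mul_le_mul_of_nonneg_right (hwt x).2 (by positivity)
    nlinarith [sq_nonneg (iteratedDeriv 0 w x + X.diffTotal 0 u u' t x),
      sq_nonneg (iteratedDeriv 0 w x - s₀ x)]
  have hHe : ∫ x, H x = 2 * (∫ x, iteratedDeriv 0 w x ^ 2) + (∫ x, X.diffTotal 0 u u' t x ^ 2)
      + (∫ x, s₀ x ^ 2) + C₁ * ((∫ x, iteratedDeriv 3 w x ^ 2) + ∫ x, s₃ x ^ 2) := by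
    have e1 : ∫ x, H x = (∫ x, (2 * iteratedDeriv 0 w x ^ 2 + X.diffTotal 0 u u' t x ^ 2
        + s₀ x ^ 2)) + ∫ x, C₁ * (iteratedDeriv 3 w x ^ 2 + s₃ x ^ 2) :=
      integral_add ((i0.add hΔi).add hs0i) i3
    have e2 : ∫ x, (2 * iteratedDeriv 0 w x ^ 2 + X.diffTotal 0 u u' t x ^ 2 + s₀ x ^ 2)
        = (∫ x, (2 * iteratedDeriv 0 w x ^ 2 + X.diffTotal 0 u u' t x ^ 2)) + ∫ x, s₀ x ^ 2 :=
      integral_add (i0.add hΔi) hs0i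
    rw [e1, e2, integral_add i0 hΔi, integral_const_mul, integral_const_mul,
      integral_add (hint 3 (by norm_num)) hs3i]
  have hsplit : ∫ x, (2 * (iteratedDeriv 0 w x * (-X.diffTotal 0 u u' t x + s₀ x))
        + X.weight u t x * (2 * (iteratedDeriv 3 w x * (-X.diffTotal 3 u u' t x + s₃ x))))
      = (∫ x, G x) + 2 * -∫ x, X.weight u t x * (iteratedDeriv 3 w x * X.diffTotal 3 u u' t x) := by
    have hneg : Integrable (fun x =>
        2 * -(X.weight u t x * (iteratedDeriv 3 w x * X.diffTotal 3 u u' t x))) :=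
      hWΔ.neg.const_mul 2
    rw [← integral_neg, ← integral_const_mul, ← integral_add hGi hneg]
    refine integral_congr_ae (ae_of_all _ fun x => ?_)
    simp only [hG]
    ring
  have n0 := integral_le_hThreeSq w (j := 0) (by norm_num)
  have n3 := integral_le_hThreeSq w (j := 3) le_rfl
  have nn := hThreeSq_nonneg w
  have p0 : 0 ≤ ∫ x, s₀ x ^ 2 := integral_nonneg fun _ => sq_nonneg _
  have p3 : 0 ≤ ∫ x, s₃ x ^ 2 := integral_nonneg fun _ => sq_nonneg _
  have q0 : ∫ x, X.diffTotal 0 u u' t x ^ 2 ≤ C₀ * hThreeSq w := by simpa [hThreeSq] using hΔ₀N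
  have r1 : C₁ * C₁ * (∫ x, iteratedDeriv 3 w x ^ 2) ≤ C₁ * C₁ * hThreeSq w :=
    mul_le_mul_of_nonneg_left n3 (by positivity)
  have r2 : C₁ * (∫ x, iteratedDeriv 3 w x ^ 2) ≤ C₁ * hThreeSq w :=
    mul_le_mul_of_nonneg_left n3 (by positivity)
  rw [hsplit]
  have t1 : 0 ≤ C₁ * hThreeSq w := by positivity
  have t2 : 0 ≤ (1 + C₀ + 2 * (C₁ * C₁) + 10 * (C₁ * C₂ + C₁)) * ∫ x, s₀ x ^ 2 := by positivity
  have t3 : 0 ≤ (2 + C₀ + 2 * (C₁ * C₁) + 10 * (C₁ * C₂) + 9 * C₁) * ∫ x, s₃ x ^ 2 := by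
    positivity
  have t4 : 0 ≤ C₁ * C₂ * hThreeSq w := by positivity
  nlinarith

end Expansion

/-! ### Functions that vanish to second order at `z = 0` -/

/-- The value and the z-gradient vanish at z = 0 for all t, so the same is true of their time
derivatives. Thus the gradient is O(‖z‖) and ∂_t g is O(‖z‖²), which gives the two terms of the
bound. -/
theorem IsJet.exists_quadratic_bound {d : ℕ} {g : (Fin d → ℝ) → ℝ → ℝ → ℝ}
    {D : ℕ → (Fin d → ℕ) → ℕ → (Fin d → ℝ) → ℝ → ℝ → ℝ} (hD : IsJet 2 0 g D)
    (h0 : ∀ x, ∀ t ∈ timeInterval, g 0 x t = 0 ∧ ∀ j, partialZ j g 0 x t = 0) (R : ℝ) :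
    ∃ C : ℝ, 0 ≤ C ∧ ∀ z z', ‖z‖ ≤ R → ‖z'‖ ≤ R → ∀ x, ∀ s ∈ timeInterval, ∀ t ∈ timeInterval,
      |g z x s - g z' x t| ≤ C * (|s - t| * ‖z‖ ^ 2 + (‖z‖ + ‖z'‖) * ‖z - z'‖) := by
  have hs1 : ∀ j : Fin d, ∑ i, (0 + Pi.single j 1 : Fin d → ℕ) i = 1 := fun j => by
    rw [sum_add_single]; simp
  have hz0 : ∀ x, ∀ t ∈ timeInterval, D 0 0 0 0 x t = 0 := fun x t ht => by
    rw [hD.zero _ _ _ ht]; exact (h0 x t ht).1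
  have hz1 : ∀ j x, ∀ t ∈ timeInterval, D 0 (0 + Pi.single j 1) 0 0 x t = 0 := fun j x t ht => by
    have h1 := hD.deriv_z 0 zero_le_one 0 0 (by simp) le_rfl j 0 x t ht
    rw [← h1.deriv, ← (h0 x t ht).2 j, partialZ]
    congr 1
    ext s
    exact hD.zero _ _ _ ht
  have hu : UniqueDiffOn ℝ timeInterval := uniqueDiffOn_Icc (by norm_num)
  -- For α = 1: a function of t that vanishes on the whole interval has zero derivative there, also
  -- at the endpoints.
  have hder : ∀ β : Fin d → ℕ, ∑ i, β i ≤ 2 → (∀ x, ∀ t ∈ timeInterval, D 0 β 0 0 x t = 0) →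
      ∀ α ≤ 1, ∀ x, ∀ t ∈ timeInterval, D α β 0 0 x t = 0 := by
    intro β hβ hv α hα x t ht
    interval_cases α
    · exact hv x t ht
    · have h1 := hD.deriv_t β 0 hβ le_rfl 0 x t ht
      have h2 : HasDerivWithinAt (fun s => D 0 β 0 0 x s) 0 timeInterval t :=
        (hasDerivWithinAt_const t timeInterval (0 : ℝ)).congr (fun s hs => hv x s hs) (hv x t ht)
      exact (hu t ht).eq_deriv _ h1 h2
  have hA : ∀ α ≤ 1, ∃ C : ℝ, 0 ≤ C ∧ ∀ z z', ‖z‖ ≤ R → ‖z'‖ ≤ R → ∀ x, ∀ t ∈ timeInterval,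
      |D α 0 0 z x t - D α 0 0 z' x t| ≤ C * ((‖z‖ + ‖z'‖) * ‖z - z'‖) := by
    intro α hα
    have h1 : ∀ j : Fin d, ∃ C : ℝ, 0 ≤ C ∧ _ := fun j =>
      hD.exists_lip_z hα (β := 0 + Pi.single j 1) (by rw [hs1]; norm_num) le_rfl R
    choose C hC0 hC using h1
    have hS : 0 ≤ ∑ j, C j := Finset.sum_nonneg fun j _ => hC0 j
    refine ⟨(∑ j, C j) * d, by positivity, fun z z' hz hz' x t ht => ?_⟩
    have hR : 0 ≤ R := (norm_nonneg z).trans hz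
    have h2 := abs_sub_sub_sum_mul_le (k := fun z => D α 0 0 z x t)
      (p := fun i z => D α (0 + Pi.single i 1) 0 z x t)
      (fun i z => hD.deriv_z α hα 0 0 (by simp) le_rfl i z x t ht) 0
      ((∑ j, C j) * (‖z‖ + ‖z'‖)) z' z
      (fun w hw i => by
        have hwn : ‖w‖ ≤ ‖z‖ + ‖z'‖ := norm_le_of_mem_uIcc (le_add_of_nonneg_left (norm_nonneg _))
          (le_add_of_nonneg_right (norm_nonneg _)) hw
        have h3 := hC i w 0 (norm_le_of_mem_uIcc hz' hz hw) (by simpa using hR) x t ht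
        rw [hder _ (by rw [hs1]; norm_num) (hz1 i) α hα x t ht, sub_zero, sub_zero] at h3
        simp only [Pi.zero_apply, sub_zero]
        exact h3.trans (mul_le_mul (Finset.single_le_sum (f := C) (fun i _ => hC0 i)
          (Finset.mem_univ i)) hwn (norm_nonneg _) hS))
    simp only [Pi.zero_apply, zero_mul, Finset.sum_const_zero, sub_zero] at h2
    refine h2.trans ?_
    calc _ ≤ (∑ j, C j) * (‖z‖ + ‖z'‖) * (d * ‖z - z'‖) :=
          mul_le_mul_of_nonneg_left (sum_abs_le_card_mul_norm (z - z')) (by positivity)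
      _ = _ := by ring
  obtain ⟨C, hC0, hC⟩ := hA 0 zero_le_one
  obtain ⟨C', hC0', hC'⟩ := hA 1 le_rfl
  refine ⟨C + C', by positivity, fun z z' hz hz' x s hs t ht => ?_⟩
  have hR : 0 ≤ R := (norm_nonneg z).trans hz
  have e1 : |D 0 0 0 z x s - D 0 0 0 z x t| ≤ C' * ‖z‖ ^ 2 * |s - t| :=
    (convex_Icc (-1 : ℝ) 1).norm_image_sub_le_of_norm_hasDerivWithin_le
      (fun s hs => hD.deriv_t 0 0 (by simp) le_rfl z x s hs)
      (fun s hs => by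
        have := hC' z 0 hz (by simpa using hR) x s hs
        rw [hder 0 (by simp) hz0 1 le_rfl x s hs] at this
        simp only [sub_zero, norm_zero, add_zero] at this
        rw [Real.norm_eq_abs]
        exact this.trans (le_of_eq (by ring))) ht hs
  have e2 := hC z z' hz hz' x t ht
  rw [← hD.zero z x s hs, ← hD.zero z' x t ht]
  have n1 : 0 ≤ |s - t| * ‖z‖ ^ 2 := by positivity
  have n2 : 0 ≤ (‖z‖ + ‖z'‖) * ‖z - z'‖ := by positivity
  calc _ = |(D 0 0 0 z x s - D 0 0 0 z x t) + (D 0 0 0 z x t - D 0 0 0 z' x t)| := by congr 1; ring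
    _ ≤ _ := (abs_add_le _ _).trans (add_le_add e1 e2)
    _ ≤ _ := by nlinarith [mul_nonneg hC0 n1, mul_nonneg hC0' n2]

/-! ### Compactly supported functions with prescribed jets -/

/-- Truncated Taylor polynomials: the monomials 1, y, y²/2 times a bump function equal to one near 0
and zero from distance 2 on, so that all derivatives vanish at distance 3. Linearity in a gives the
bound by ‖a‖. -/
theorem exists_contDiff_jet : ∃ C : ℝ, 0 ≤ C ∧ ∀ (a : Fin 3 → ℝ) (x₀ : ℝ), ∃ P : ℝ → ℝ,
    (∀ n : ℕ, ContDiff ℝ n P) ∧ HasCompactSupport P ∧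
    (∀ i < 4, ∀ x, |iteratedDeriv i P x| ≤ C * ‖a‖) ∧
    (∀ i : Fin 3, iteratedDeriv i P x₀ = a i) ∧ ∀ i, iteratedDeriv i P (x₀ + 3) = 0 := by
  let χ : ContDiffBump (0 : ℝ) := ⟨1, 2, one_pos, one_lt_two⟩
  let b : Fin 3 → ℝ := ![1, 1, 2⁻¹]
  let e : Fin 3 → ℝ → ℝ := fun j y => b j * y ^ (j : ℕ) * χ y
  have he : ∀ j, ∀ n : ℕ, ContDiff ℝ n (e j) := fun j n =>
    (contDiff_const.mul (contDiff_id.pow _)).mul χ.contDiff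
  have hes : ∀ j, HasCompactSupport (e j) := fun j => χ.hasCompactSupport.mul_left
  have hec : ∀ j i, Continuous (iteratedDeriv i (e j)) := fun j i =>
    (he j i).continuous_iteratedDeriv'
  have hes' : ∀ j i, HasCompactSupport (iteratedDeriv i (e j)) := by
    intro j i
    induction i with
    | zero => simpa using hes j
    | succ i ih => rw [iteratedDeriv_succ]; exact ih.deriv
  have hb : ∀ j i, ∃ C : ℝ, ∀ x, |iteratedDeriv i (e j) x| ≤ C := fun j i =>
    (hes' j i).exists_bound_of_continuous (hec j i)
  choose B hB using hb
  have hjet : ∀ j i : Fin 3, iteratedDeriv i (e j) 0 = if i = j then 1 else 0 := by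
    intro j i
    have h1 : e j =ᶠ[𝓝 0] fun y => b j * y ^ (j : ℕ) := by
      filter_upwards [χ.eventuallyEq_one] with y hy
      simp only [e, hy, Pi.one_apply, mul_one]
    rw [h1.iteratedDeriv_eq]
    fin_cases j <;> fin_cases i <;> simp [b, iteratedDeriv_succ, iteratedDeriv_zero]
  have hfar : ∀ j i, iteratedDeriv i (e j) 3 = 0 := by
    intro j i
    have h1 : e j =ᶠ[𝓝 3] fun _ => 0 := by
      filter_upwards [lt_mem_nhds (show (2 : ℝ) < 3 by norm_num)] with y hy
      simp only [e]
      rw [χ.zero_of_le_dist (by rw [Real.dist_eq, sub_zero, abs_of_pos (by linarith)]; exact hy.le),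
        mul_zero]
    rw [h1.iteratedDeriv_eq]
    simp
  refine ⟨∑ j, ∑ i ∈ Finset.range 4, |B j i|, by positivity, fun a x₀ => ?_⟩
  have hder : ∀ i x, iteratedDeriv i (fun y => ∑ j, a j * e j (y - x₀)) x
      = ∑ j, a j * iteratedDeriv i (e j) (x - x₀) := by
    intro i
    induction i with
    | zero => intro x; simp
    | succ i ih =>
      intro x
      rw [iteratedDeriv_succ, funext ih]
      refine (HasDerivAt.fun_sum fun j _ => ?_).deriv
      exact ((hasDerivAt_iteratedDeriv (he j (i + 1)) (Nat.lt_succ_self i)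
        (x - x₀)).comp_sub_const x x₀).const_mul (a j)
  refine ⟨fun y => ∑ j, a j * e j (y - x₀), fun n => ?_, ?_, fun i hi x => ?_, fun i => ?_,
    fun i => ?_⟩
  · exact ContDiff.sum fun j _ =>
      contDiff_const.mul ((he j n).comp (contDiff_id.sub contDiff_const))
  · refine HasCompactSupport.intro (isCompact_Icc (a := x₀ - 2) (b := x₀ + 2)) fun x hx => ?_
    refine Finset.sum_eq_zero fun j _ => ?_
    simp only [e]
    rw [χ.zero_of_le_dist, mul_zero, mul_zero]
    rw [Real.dist_eq, sub_zero]
    by_contra h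
    have := abs_lt.1 (not_le.1 h)
    exact hx ⟨by linarith [this.1], by linarith [this.2]⟩
  · rw [hder, Finset.sum_mul]
    refine (Finset.abs_sum_le_sum_abs _ _).trans (Finset.sum_le_sum fun j _ => ?_)
    rw [abs_mul, mul_comm]
    refine mul_le_mul ?_ (norm_le_pi_norm a j) (abs_nonneg _)
      (Finset.sum_nonneg fun _ _ => abs_nonneg _)
    exact ((hB j i _).trans (le_abs_self _)).trans (Finset.single_le_sum (f := fun i => |B j i|)
      (fun _ _ => abs_nonneg _) (Finset.mem_range.2 hi))
  · rw [hder, sub_self]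
    simp [hjet]
  · rw [hder, add_sub_cancel_left]
    simp [hfar]

/-- Comparing the monotone functions ∫b - g and ∫b + g requires no integrability of g'. In the
applications g' is given by g_H along a jet and the majorant b is a sum of squares. -/
theorem abs_sub_le_integral_of_hasDerivAt {g g' b : ℝ → ℝ} (hg : ∀ x, HasDerivAt g (g' x) x)
    (hb : Continuous b) (hbi : Integrable b) (h : ∀ x, |g' x| ≤ b x) (x : ℝ) :
    |g x - g 0| ≤ ∫ y, b y := by
  have hb0 : ∀ x, 0 ≤ b x := fun x => (abs_nonneg _).trans (h x)
  have hB : ∀ x, HasDerivAt (fun x => ∫ y in (0 : ℝ)..x, b y) (b x) x := fun x =>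
    intervalIntegral.integral_hasDerivAt_right (hb.intervalIntegrable _ _)
      (hb.stronglyMeasurableAtFilter _ _) hb.continuousAt
  have h1 : Monotone fun x => (∫ y in (0 : ℝ)..x, b y) - g x :=
    monotone_of_hasDerivAt_nonneg (fun x => (hB x).fun_sub (hg x))
      fun x => sub_nonneg.2 ((le_abs_self _).trans (h x))
  have h2 : Monotone fun x => (∫ y in (0 : ℝ)..x, b y) + g x :=
    monotone_of_hasDerivAt_nonneg (fun x => (hB x).fun_add (hg x))
      fun x => by have := (abs_le.1 (h x)).1; simp only [Pi.zero_apply]; linarith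
  have h3 : |∫ y in (0 : ℝ)..x, b y| ≤ ∫ y, b y := by
    have := intervalIntegral.norm_integral_le_integral_norm_uIoc (f := b) (a := 0) (b := x)
      (μ := volume)
    simp only [Real.norm_eq_abs, abs_of_nonneg (hb0 _)] at this
    exact this.trans (setIntegral_le_integral hbi (ae_of_all _ hb0))
  have h4 : |g x - g 0| ≤ |∫ y in (0 : ℝ)..x, b y| := by
    rcases le_total 0 x with hx | hx
    · have e1 := h1 hx
      have e2 := h2 hx
      simp only [intervalIntegral.integral_same] at e1 e2
      refine le_trans ?_ (le_abs_self _)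
      rw [abs_le]; constructor <;> linarith
    · have e1 := h1 hx
      have e2 := h2 hx
      simp only [intervalIntegral.integral_same] at e1 e2
      refine le_trans ?_ (neg_le_abs _)
      rw [abs_le]; constructor <;> linarith
  exact h4.trans h3

/-! ### Control of the phase by the structure of the diffusion ratio -/

theorem norm_sq_le_sum_sq {d : ℕ} (z : Fin d → ℝ) : ‖z‖ ^ 2 ≤ ∑ j, z j ^ 2 := by
  have h : ‖z‖ ≤ √(∑ j, z j ^ 2) := (pi_norm_le_iff_of_nonneg (Real.sqrt_nonneg _)).2 fun j => by
    rw [Real.norm_eq_abs]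
    exact Real.abs_le_sqrt (Finset.single_le_sum (f := fun j => z j ^ 2)
      (fun _ _ => sq_nonneg _) (Finset.mem_univ j))
  calc ‖z‖ ^ 2 ≤ √(∑ j, z j ^ 2) ^ 2 := pow_le_pow_left₀ (norm_nonneg _) h 2
    _ = _ := Real.sq_sqrt (Finset.sum_nonneg fun _ _ => sq_nonneg _)

/-- The structure of the modified diffusion ratio along functions in `H^7`. -/
structure RatioStructure (gD : (Fin 3 → ℝ) → ℝ → ℝ → ℝ) (gH : (Fin 4 → ℝ) → ℝ → ℝ → ℝ)
    (p r : (Fin 4 → ℝ) → ℝ → ℝ → ℝ) : Prop where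
  bdd : ∀ R : ℝ, ∃ C : ℝ, 0 ≤ C ∧ ∀ z, ‖z‖ ≤ R → ∀ x, ∀ t ∈ timeInterval, |gD z x t| ≤ C
  lip : ∀ R : ℝ, ∃ C : ℝ, 0 ≤ C ∧ ∀ z, ‖z‖ ≤ R → ∀ x, ∀ s ∈ timeInterval, ∀ t ∈ timeInterval,
    |gD z x s - gD z x t| ≤ C * |s - t|
  quad : ∀ R : ℝ, ∃ C : ℝ, 0 ≤ C ∧ ∀ z z', ‖z‖ ≤ R → ‖z'‖ ≤ R → ∀ x, ∀ s ∈ timeInterval,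
    ∀ t ∈ timeInterval,
      |gH z x s - gH z' x t| ≤ C * (|s - t| * ‖z‖ ^ 2 + (‖z‖ + ‖z'‖) * ‖z - z'‖)
  zero : ∀ x, ∀ t ∈ timeInterval, gH 0 x t = 0
  hasDerivAt : ∀ v, MemH 7 v → ∀ t ∈ timeInterval, ∀ x, p (jet 4 v x) x t ≠ 0 →
    HasDerivAt (fun y => gD (jet 3 v y) y t)
      (r (jet 4 v x) x t / p (jet 4 v x) x t - gH (jet 4 v x) x t) x

theorem ConditionA2.exists_ratioStructure {f : (Fin 4 → ℝ) → ℝ → ℝ → ℝ} (hf : ConditionA2 f)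
    (X : Expansion f) : ∃ gD gH, RatioStructure gD gH X.p X.r := by
  obtain ⟨gD, gH, ⟨D, hD⟩, ⟨H, hH⟩, h0, hv⟩ := hf
  refine ⟨gD, gH, fun R => ?_, fun R => ?_, fun R => hH.exists_quadratic_bound h0 R,
    fun x t ht => (h0 x t ht).1, fun v hvm t ht x hx => ?_⟩
  · obtain ⟨C, hC⟩ := hD.bounded 0 zero_le_one 0 0 (by simp) le_rfl R
    exact ⟨|C|, abs_nonneg _, fun z hz x t ht => by
      rw [← hD.zero z x t ht]; exact (hC z hz x t ht).trans (le_abs_self _)⟩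
  · obtain ⟨C, h, hC⟩ := hD.exists_lip_t (β := 0) (γ := 0) (by simp) le_rfl R
    exact ⟨C, h, fun z hz x s hs t ht => by
      rw [← hD.zero z x t ht, ← hD.zero z x s hs]; exact hC z hz x s hs t ht⟩
  · rw [← X.partial_p _ _ t ht] at hx ⊢
    rw [← X.partial_r _ _ t ht]
    exact hv v hvm t ht x hx

theorem abs_div_sub_div_le {r₁ r₂ p₁ p₂ m B δ ω : ℝ} (hm : 0 < m) (h₁ : m ≤ |p₁|) (h₂ : m ≤ |p₂|)
    (hr : |r₁| ≤ B) (hd : |r₂ - r₁| ≤ δ) (hp : |p₂ - p₁| ≤ ω) :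
    |r₂ / p₂ - r₁ / p₁| ≤ δ * m⁻¹ + B * ω * (m⁻¹ * m⁻¹) := by
  have e1 : p₁ ≠ 0 := abs_pos.1 (hm.trans_le h₁)
  have e2 : p₂ ≠ 0 := abs_pos.1 (hm.trans_le h₂)
  have i1 : |p₁|⁻¹ ≤ m⁻¹ := inv_anti₀ hm h₁
  have i2 : |p₂|⁻¹ ≤ m⁻¹ := inv_anti₀ hm h₂
  have hm' : 0 ≤ m⁻¹ := (inv_pos.2 hm).le
  have : r₂ / p₂ - r₁ / p₁ = (r₂ - r₁) * p₂⁻¹ + r₁ * -(p₂ - p₁) * (p₁⁻¹ * p₂⁻¹) := by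
    field_simp; ring
  rw [this]
  refine (abs_add_le _ _).trans (add_le_add ?_ ?_)
  · rw [abs_mul, abs_inv]
    exact mul_le_mul hd i2 (by positivity) ((abs_nonneg _).trans hd)
  · simp only [abs_mul, abs_inv, abs_neg]
    have hB := (abs_nonneg _).trans hr
    have hω := (abs_nonneg _).trans hp
    gcongr

namespace RatioStructure

variable {f : (Fin 4 → ℝ) → ℝ → ℝ → ℝ} {X : Expansion f} {gD : (Fin 3 → ℝ) → ℝ → ℝ → ℝ}
  {gH : (Fin 4 → ℝ) → ℝ → ℝ → ℝ}

/-- Although only continuity of `g_D` in `z` is assumed, `g_D` is Lipschitz in `z` near jets at which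
the dispersion does not degenerate: two jets can be joined to a common jet by two functions, along
which the diffusion ratio is controlled. -/
theorem exists_lip_z (h : RatioStructure gD gH X.p X.r) {K : ℝ} (hK : 0 < K) :
    ∃ C : ℝ, 0 ≤ C ∧ ∀ v t, HighBound K v → t ∈ timeInterval →
      (∀ x, K⁻¹ ≤ |X.p (jet 4 v x) x t|) → ∀ x₀ (ζ : Fin 3 → ℝ), ‖ζ‖ ≤ K →
        |gD ζ x₀ t - gD (jet 3 v x₀) x₀ t| ≤ C * ‖ζ - jet 3 v x₀‖ := by
  obtain ⟨E, hE, hP⟩ := exists_contDiff_jet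
  set R := K + E * (2 * K) with hR
  obtain ⟨Bp, hBp, hp, hpl⟩ := X.symb_p.unifLip.exists_bound R
  obtain ⟨Br, hBr, hr, hrl⟩ := X.symb_r.unifLip.exists_bound R
  obtain ⟨Bq, hBq, hq⟩ := h.quad R
  obtain ⟨B, hB, hb⟩ := h.bdd K
  -- Half of the lower bound on |p|: this much non-degeneracy survives the perturbation by P as long
  -- as it is small.
  set m := K⁻¹ / 2 with hm
  have hm0 : 0 < m := by positivity
  set CD := Br * E * m⁻¹ + Br * (Bp * E) * (m⁻¹ * m⁻¹) + Bq * (2 * R) * E with hCD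
  have hR0 : 0 ≤ R := by positivity
  refine ⟨3 * CD + 2 * B * (m⁻¹ * (Bp * E)), by positivity, fun v t hv ht hlow x₀ ζ hζ => ?_⟩
  set a := jet 3 v x₀ - ζ with ha
  have hjet3 : ‖jet 3 v x₀‖ ≤ K := norm_jet_le hK.le fun j hj => hv.le j (by omega) x₀
  have ha2 : ‖a‖ ≤ 2 * K := (norm_sub_le _ _).trans (by linarith)
  have han : ‖ζ - jet 3 v x₀‖ = ‖a‖ := by rw [ha, norm_sub_rev]
  rw [han]
  obtain ⟨P, hPs, hPc, hPb, hPx, hPf⟩ := hP a x₀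
  -- If ‖a‖ is small, v - P is still non-degenerate and (A2) applies to it. Otherwise ‖a‖ is bounded
  -- below and the trivial bound 2B is already of the form C ‖a‖.
  rcases le_or_gt (Bp * (E * ‖a‖)) m with hsmall | hbig
  · have hPm : MemH 7 P := memH_of_contDiff_of_hasCompactSupport hPs hPc
    have hv2 : MemH 7 (v - P) := hv.memH.sub hPm
    have hsub : ∀ j < 7, ∀ x, iteratedDeriv j (v - P) x = iteratedDeriv j v x - iteratedDeriv j P x :=
      fun j hj x => hv.memH.iteratedDeriv_sub hPm hj x
    have hj4 : ∀ x, ‖jet 4 (v - P) x - jet 4 v x‖ ≤ E * ‖a‖ := fun x => by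
      refine (pi_norm_le_iff_of_nonneg (by positivity)).2 fun j => ?_
      simp only [Pi.sub_apply, jet]
      rw [hsub j (by omega), sub_sub_cancel_left, norm_neg]
      exact hPb j j.2 x
    have hn1 : ∀ x, ‖jet 4 v x‖ ≤ K := fun x => norm_jet_le hK.le fun j hj => hv.le j (by omega) x
    have hKR : K ≤ R := by rw [hR]; nlinarith
    have hn1' : ∀ x, ‖jet 4 v x‖ ≤ R := fun x => (hn1 x).trans hKR
    have hn2 : ∀ x, ‖jet 4 (v - P) x‖ ≤ R := fun x => by
      have h1 := norm_sub_norm_le (jet 4 (v - P) x) (jet 4 v x)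
      have h2 := hj4 x
      have h3 := hn1 x
      have h4 : E * ‖a‖ ≤ E * (2 * K) := mul_le_mul_of_nonneg_left ha2 hE
      linarith
    have hdp : ∀ x, |X.p (jet 4 (v - P) x) x t - X.p (jet 4 v x) x t| ≤ Bp * (E * ‖a‖) := fun x => by
      refine (hpl _ _ (hn2 x) (hn1' x) x x t ht t ht).trans ?_
      simp only [sub_self, abs_zero, add_zero]
      exact mul_le_mul_of_nonneg_left (hj4 x) hBp
    have hdr : ∀ x, |X.r (jet 4 (v - P) x) x t - X.r (jet 4 v x) x t| ≤ Br * (E * ‖a‖) := fun x => by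
      refine (hrl _ _ (hn2 x) (hn1' x) x x t ht t ht).trans ?_
      simp only [sub_self, abs_zero, add_zero]
      exact mul_le_mul_of_nonneg_left (hj4 x) hBr
    have hlow1 : ∀ x, m ≤ |X.p (jet 4 v x) x t| := fun x => by
      have := hlow x
      have : 0 < K⁻¹ := by positivity
      rw [hm]; linarith
    have hlow2 : ∀ x, m ≤ |X.p (jet 4 (v - P) x) x t| := fun x => by
      have h1 := hlow x
      have h2 := hdp x
      have h3 := abs_sub_abs_le_abs_sub (X.p (jet 4 v x) x t) (X.p (jet 4 (v - P) x) x t)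
      rw [abs_sub_comm] at h2
      have h4 : K⁻¹ = 2 * m := by rw [hm]; ring
      linarith
    have hdH : ∀ x, |gH (jet 4 (v - P) x) x t - gH (jet 4 v x) x t|
        ≤ Bq * (2 * R) * (E * ‖a‖) := fun x => by
      refine (hq _ _ (hn2 x) (hn1' x) x t ht t ht).trans ?_
      rw [sub_self, abs_zero, zero_mul, zero_add, mul_assoc]
      refine mul_le_mul_of_nonneg_left ?_ hBq
      refine mul_le_mul ?_ (hj4 x) (norm_nonneg _) (by positivity)
      linarith [hn2 x, hn1' x]
    have hd : ∀ x, HasDerivAt (fun y => gD (jet 3 (v - P) y) y t - gD (jet 3 v y) y t) _ x :=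
      fun x => (h.hasDerivAt _ hv2 t ht x (abs_pos.1 (hm0.trans_le (hlow2 x)))).fun_sub
        (h.hasDerivAt _ hv.memH t ht x (abs_pos.1 (hm0.trans_le (hlow1 x))))
    -- The functions y ↦ g_D along v - P and along v coincide at x₀ + 3, and their derivatives
    -- differ by O(‖a‖) because r, p and g_H are Lipschitz; so the difference at x₀ is at most 3
    -- times that.
    have hmv := (convex_univ (𝕜 := ℝ) (E := ℝ)).norm_image_sub_le_of_norm_hasDerivWithin_le
      (C := CD * ‖a‖) (fun x _ => (hd x).hasDerivWithinAt) (fun x _ => by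
        have e1 := abs_div_sub_div_le hm0 (hlow1 x) (hlow2 x) (hr _ (hn1' x) x t ht) (hdr x) (hdp x)
        have e2 := hdH x
        have e3 := (abs_add_le _ _).trans (add_le_add e1 ((abs_neg _).trans_le e2))
        rw [Real.norm_eq_abs]
        refine le_trans (le_of_eq ?_) (e3.trans (le_of_eq ?_))
        · congr 1; ring
        · rw [hCD]; ring) (mem_univ (x₀ + 3)) (mem_univ x₀)
    have hx0 : jet 3 (v - P) x₀ = ζ := by
      ext j
      have : iteratedDeriv j (v - P) x₀ = iteratedDeriv j v x₀ - a j := by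
        rw [hsub j (by omega), hPx]
      simp only [jet]
      rw [this, ha, Pi.sub_apply]
      simp [jet]
    have hx3 : jet 3 (v - P) (x₀ + 3) = jet 3 v (x₀ + 3) := by
      ext j
      simp only [jet]
      rw [hsub j (by omega), hPf, sub_zero]
    rw [hx0, hx3, sub_self, sub_zero, Real.norm_eq_abs] at hmv
    refine hmv.trans ?_
    have : ‖x₀ - (x₀ + 3)‖ = 3 := by rw [sub_add_cancel_left, norm_neg]; norm_num
    rw [this]
    have : 0 ≤ 2 * B * (m⁻¹ * (Bp * E)) * ‖a‖ := by positivity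
    linarith
  · have h1 : |gD ζ x₀ t - gD (jet 3 v x₀) x₀ t| ≤ 2 * B := by
      refine (abs_sub _ _).trans ?_
      linarith [hb ζ hζ x₀ t ht, hb _ hjet3 x₀ t ht]
    have h2 : 1 ≤ m⁻¹ * (Bp * E) * ‖a‖ := by
      have : m⁻¹ * m ≤ m⁻¹ * (Bp * (E * ‖a‖)) := mul_le_mul_of_nonneg_left hbig.le (by positivity)
      rw [inv_mul_cancel₀ hm0.ne'] at this
      linarith
    have h3 : 0 ≤ 3 * CD * ‖a‖ := by positivity
    have h4 : 2 * B * 1 ≤ 2 * B * (m⁻¹ * (Bp * E) * ‖a‖) := mul_le_mul_of_nonneg_left h2 (by positivity)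
    linarith

theorem continuous_sum_sq {v : ℝ → ℝ} (hv : MemH 7 v) :
    Continuous (fun x => ∑ j : Fin 4, iteratedDeriv j v x ^ 2) :=
  continuous_finsetSum _ fun j _ => (hv.continuous (by omega)).pow 2

theorem integrable_sum_sq {v : ℝ → ℝ} (hv : MemH 7 v) :
    Integrable (fun x => ∑ j : Fin 4, iteratedDeriv j v x ^ 2) :=
  integrable_finsetSum _ fun j _ => hv.integrable_sq (by omega)

theorem integral_sum_sq {v : ℝ → ℝ} (hv : MemH 7 v) :
    ∫ x, ∑ j : Fin 4, iteratedDeriv j v x ^ 2 = hThreeSq v := by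
  rw [integral_finsetSum _ fun j _ => hv.integrable_sq (by omega), hThreeSq,
    Fin.sum_univ_eq_sum_range (fun j => ∫ x, iteratedDeriv j v x ^ 2)]

/-- The phase minus g_D has derivative g_H, which is bounded by a multiple of the sum of squares of
the 3-jet; the integral of that sum is the squared H^3 norm. -/
theorem exists_phase_bound (h : RatioStructure gD gH X.p X.r) {K : ℝ} (hK : 0 < K) :
    ∃ C : ℝ, 0 ≤ C ∧ ∀ v t, HighBound K v → hThreeSq v ≤ K → t ∈ timeInterval →
      (∀ x, K⁻¹ ≤ |X.p (jet 4 v x) x t|) → ∀ x, |X.phase v t x| ≤ C := by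
  obtain ⟨Bq, hBq, hq⟩ := h.quad K
  obtain ⟨B, hB, hb⟩ := h.bdd K
  refine ⟨2 * B + Bq * K, by positivity, fun v t hv hL ht hlow x => ?_⟩
  have hne : ∀ x, X.p (jet 4 v x) x t ≠ 0 := fun x =>
    abs_pos.1 ((inv_pos.2 hK).trans_le (hlow x))
  have hj3 : ∀ x, ‖jet 3 v x‖ ≤ K := fun x => norm_jet_le hK.le fun j hj => hv.le j (by omega) x
  have hj4 : ∀ x, ‖jet 4 v x‖ ≤ K := fun x => norm_jet_le hK.le fun j hj => hv.le j (by omega) x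
  have h1 := abs_sub_le_integral_of_hasDerivAt
    (g := fun x => X.phase v t x - gD (jet 3 v x) x t)
    (b := fun x => Bq * ∑ j : Fin 4, iteratedDeriv j v x ^ 2)
    (fun x => (X.hasDerivAt_phase (hv.contDiff.of_le (by norm_num)) ht hne x).fun_sub
      (h.hasDerivAt v hv.memH t ht x (hne x)))
    (continuous_const.mul (continuous_sum_sq hv.memH)) ((integrable_sum_sq hv.memH).const_mul _)
    (fun x => by
      rw [sub_sub_cancel]
      have := hq (jet 4 v x) 0 (hj4 x) (by simpa using hK.le) x t ht t ht
      rw [h.zero x t ht, sub_self, abs_zero, zero_mul, zero_add, sub_zero, sub_zero, norm_zero,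
        add_zero, ← sq] at this
      exact this.trans (mul_le_mul_of_nonneg_left (norm_sq_le_sum_sq _) hBq)) x
  rw [integral_const_mul, integral_sum_sq hv.memH] at h1
  have h2 : X.phase v t 0 = 0 := intervalIntegral.integral_same
  rw [h2] at h1
  have h3 := abs_le.1 h1
  have h4 := abs_le.1 (hb _ (hj3 x) x t ht)
  have h5 := abs_le.1 (hb _ (hj3 0) 0 t ht)
  have h6 : Bq * hThreeSq v ≤ Bq * K := mul_le_mul_of_nonneg_left hL hBq
  rw [abs_le]
  constructor <;> linarith [h3.1, h3.2, h4.1, h4.2, h5.1, h5.2]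

/-- The parameter δ measures the time gap and the distance of v and v' at once, both in H^3 and in
the supremum norm. The g_D parts are compared by the Lipschitz bounds in t and z, the g_H parts by
the quadratic bound integrated over ℝ. -/
theorem exists_phase_lip (h : RatioStructure gD gH X.p X.r) {K : ℝ} (hK : 0 < K) :
    ∃ C : ℝ, 0 ≤ C ∧ ∀ v v' s t δ, 0 < δ → HighBound K v → HighBound K v' → hThreeSq v ≤ K →
      hThreeSq v' ≤ K → s ∈ timeInterval → t ∈ timeInterval →
      (∀ x, K⁻¹ ≤ |X.p (jet 4 v x) x s|) → (∀ x, K⁻¹ ≤ |X.p (jet 4 v' x) x t|) →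
      |s - t| ≤ δ → (∀ j ≤ 3, ∀ x, |iteratedDeriv j (v - v') x| ≤ δ) →
      hThreeSq (v - v') ≤ δ ^ 2 → ∀ x, |X.phase v s x - X.phase v' t x| ≤ C * δ := by
  obtain ⟨Bq, hBq, hq⟩ := h.quad K
  obtain ⟨B, hB, hb⟩ := h.lip K
  obtain ⟨Bz, hBz, hz⟩ := h.exists_lip_z hK
  refine ⟨2 * (B + Bz) + Bq * (4 * K + 1), by positivity,
    fun v v' s t δ hδ hv hv' hL hL' hs ht hlow hlow' hst hw hwL x => ?_⟩
  have hwm : MemH 7 (v - v') := hv.memH.sub hv'.memH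
  have hne : ∀ x, X.p (jet 4 v x) x s ≠ 0 := fun x =>
    abs_pos.1 ((inv_pos.2 hK).trans_le (hlow x))
  have hne' : ∀ x, X.p (jet 4 v' x) x t ≠ 0 := fun x =>
    abs_pos.1 ((inv_pos.2 hK).trans_le (hlow' x))
  have hj : ∀ {d : ℕ} {v : ℝ → ℝ}, d ≤ 6 → HighBound K v → ∀ x, ‖jet d v x‖ ≤ K :=
    fun hd hv x => norm_jet_le hK.le fun j hj => hv.le j (by omega) x
  have hsub : ∀ j ≤ 6, ∀ x, iteratedDeriv j v x - iteratedDeriv j v' x = iteratedDeriv j (v - v') x :=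
    fun j hj x => (hv.memH.iteratedDeriv_sub hv'.memH (by omega) x).symm
  have hgD : ∀ x, |gD (jet 3 v x) x s - gD (jet 3 v' x) x t| ≤ (B + Bz) * δ := fun x => by
    have e1 := (hb _ (hj (by norm_num) hv x) x s hs t ht).trans (mul_le_mul_of_nonneg_left hst hB)
    have e2 : ‖jet 3 v x - jet 3 v' x‖ ≤ δ := (pi_norm_le_iff_of_nonneg hδ.le).2 fun j => by
      simp only [Pi.sub_apply, jet]
      rw [hsub j (by omega)]
      exact hw j (by omega) x
    have e3 := (hz v' t hv' ht hlow' x _ (hj (by norm_num) hv x)).trans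
      (mul_le_mul_of_nonneg_left e2 hBz)
    calc _ = |(gD (jet 3 v x) x s - gD (jet 3 v x) x t)
          + (gD (jet 3 v x) x t - gD (jet 3 v' x) x t)| := by congr 1; ring
      _ ≤ _ := (abs_add_le _ _).trans (add_le_add e1 e3)
      _ = _ := by ring
  have h1 := abs_sub_le_integral_of_hasDerivAt
    (g := fun x => (X.phase v s x - gD (jet 3 v x) x s) - (X.phase v' t x - gD (jet 3 v' x) x t))
    (b := fun x => Bq * (2 * δ * (∑ j : Fin 4, iteratedDeriv j v x ^ 2)
      + 2 * δ * (∑ j : Fin 4, iteratedDeriv j v' x ^ 2)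
      + δ⁻¹ * ∑ j : Fin 4, iteratedDeriv j (v - v') x ^ 2))
    (fun x => ((X.hasDerivAt_phase (hv.contDiff.of_le (by norm_num)) hs hne x).fun_sub
      (h.hasDerivAt v hv.memH s hs x (hne x))).fun_sub
      ((X.hasDerivAt_phase (hv'.contDiff.of_le (by norm_num)) ht hne' x).fun_sub
      (h.hasDerivAt v' hv'.memH t ht x (hne' x))))
    (continuous_const.mul (((continuous_const.mul (continuous_sum_sq hv.memH)).add
      (continuous_const.mul (continuous_sum_sq hv'.memH))).add
      (continuous_const.mul (continuous_sum_sq hwm))))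
    (((((integrable_sum_sq hv.memH).const_mul _).add
      ((integrable_sum_sq hv'.memH).const_mul _)).add
      ((integrable_sum_sq hwm).const_mul _)).const_mul _)
    (fun x => by
      rw [sub_sub_cancel, sub_sub_cancel]
      have e1 := hq _ _ (hj (by norm_num) hv x) (hj (by norm_num) hv' x) x s hs t ht
      refine e1.trans (mul_le_mul_of_nonneg_left ?_ hBq)
      have n1 := norm_sq_le_sum_sq (jet 4 v x)
      have n2 := norm_sq_le_sum_sq (jet 4 v' x)
      have n3 := norm_sq_le_sum_sq (jet 4 v x - jet 4 v' x)
      have n4 : ∀ j : Fin 4, (jet 4 v x - jet 4 v' x) j = iteratedDeriv j (v - v') x := fun j => by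
        rw [← hsub j (by omega)]; rfl
      simp only [n4] at n3
      simp only [jet] at n1 n2
      set a := ‖jet 4 v x‖ with ha
      set b := ‖jet 4 v' x‖ with hb
      set c := ‖jet 4 v x - jet 4 v' x‖ with hc
      have m1 : |s - t| * a ^ 2 ≤ δ * a ^ 2 := mul_le_mul_of_nonneg_right hst (sq_nonneg _)
      -- Young's inequality scaled by δ: since the integral of c² will be at most of order δ², both
      -- terms integrate to O(δ).
      have m2 : (a + b) * c ≤ δ * (a ^ 2 + b ^ 2) + δ⁻¹ * c ^ 2 := by
        have k1 : 0 ≤ δ * ((a - δ⁻¹ * c / 2) ^ 2 + (b - δ⁻¹ * c / 2) ^ 2) := by positivity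
        have k2 : δ * ((a - δ⁻¹ * c / 2) ^ 2 + (b - δ⁻¹ * c / 2) ^ 2)
            = δ * (a ^ 2 + b ^ 2) + δ⁻¹ * c ^ 2 / 2 - (a + b) * c := by
          field_simp; ring
        have k3 : 0 ≤ δ⁻¹ * c ^ 2 := by positivity
        linarith
      have m3 := mul_le_mul_of_nonneg_left n1 hδ.le
      have m4 := mul_le_mul_of_nonneg_left n2 hδ.le
      have m5 := mul_le_mul_of_nonneg_left n3 (inv_pos.2 hδ).le
      have m6 : 0 ≤ δ * b ^ 2 := by positivity
      linarith) x
  have hint : ∫ x, Bq * (2 * δ * (∑ j : Fin 4, iteratedDeriv j v x ^ 2)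
      + 2 * δ * (∑ j : Fin 4, iteratedDeriv j v' x ^ 2)
      + δ⁻¹ * ∑ j : Fin 4, iteratedDeriv j (v - v') x ^ 2)
      = Bq * (2 * δ * hThreeSq v + 2 * δ * hThreeSq v' + δ⁻¹ * hThreeSq (v - v')) := by
    have i1 := (integrable_sum_sq hv.memH).const_mul (2 * δ)
    have i2 := (integrable_sum_sq hv'.memH).const_mul (2 * δ)
    have i3 := (integrable_sum_sq hwm).const_mul δ⁻¹
    have e1 : ∫ x, ((2 * δ * (∑ j : Fin 4, iteratedDeriv j v x ^ 2)
      + 2 * δ * (∑ j : Fin 4, iteratedDeriv j v' x ^ 2))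
      + δ⁻¹ * ∑ j : Fin 4, iteratedDeriv j (v - v') x ^ 2)
      = (∫ x, (2 * δ * (∑ j : Fin 4, iteratedDeriv j v x ^ 2)
        + 2 * δ * (∑ j : Fin 4, iteratedDeriv j v' x ^ 2)))
        + ∫ x, (δ⁻¹ * ∑ j : Fin 4, iteratedDeriv j (v - v') x ^ 2) :=
      integral_add (i1.add i2) i3
    rw [integral_const_mul, e1, integral_add i1 i2, integral_const_mul, integral_const_mul,
      integral_const_mul, integral_sum_sq hv.memH, integral_sum_sq hv'.memH, integral_sum_sq hwm]
  rw [hint] at h1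
  have h2 : X.phase v s 0 = 0 := intervalIntegral.integral_same
  have h2' : X.phase v' t 0 = 0 := intervalIntegral.integral_same
  rw [h2, h2'] at h1
  have h3 : Bq * (2 * δ * hThreeSq v + 2 * δ * hThreeSq v' + δ⁻¹ * hThreeSq (v - v'))
      ≤ Bq * ((4 * K + 1) * δ) := by
    refine mul_le_mul_of_nonneg_left ?_ hBq
    have k1 : δ⁻¹ * hThreeSq (v - v') ≤ δ := by
      refine (mul_le_mul_of_nonneg_left hwL (inv_pos.2 hδ).le).trans (le_of_eq ?_)
      field_simp
    have k2 := mul_le_mul_of_nonneg_left hL hδ.le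
    have k3 := mul_le_mul_of_nonneg_left hL' hδ.le
    linarith
  have h4 := abs_le.1 (h1.trans h3)
  have h5 := abs_le.1 (hgD x)
  have h6 := abs_le.1 (hgD 0)
  rw [abs_le]
  constructor <;> linarith [h4.1, h4.2, h5.1, h5.2, h6.1, h6.2]

end RatioStructure

/-! ### Calculus in `(t, x)` -/

theorem continuousOn_slice {T : ℝ} {R : ℝ → ℝ → ℝ}
    (hR : ContinuousOn (fun p : ℝ × ℝ => R p.1 p.2) (Icc 0 T ×ˢ univ)) (x : ℝ) :
    ContinuousOn (fun t => R t x) (Icc 0 T) :=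
  hR.comp (continuous_id.prodMk continuous_const).continuousOn fun _ ht => ⟨ht, trivial⟩

theorem integral_eq_sub_of_hasDerivWithinAt_Icc {T a b : ℝ} {g R : ℝ → ℝ} (ha : a ∈ Icc 0 T)
    (hb : b ∈ Icc 0 T) (hab : a ≤ b)
    (h : ∀ t ∈ Icc 0 T, HasDerivWithinAt g (R t) (Icc 0 T) t) (hR : ContinuousOn R (Icc 0 T)) :
    ∫ τ in a..b, R τ = g b - g a := by
  have hsub : Icc a b ⊆ Icc 0 T := Icc_subset_Icc ha.1 hb.2
  refine intervalIntegral.integral_eq_sub_of_hasDerivAt_of_le hab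
    (fun t ht => ((h t (hsub ht)).continuousWithinAt).mono hsub) (fun t ht => ?_)
    (ContinuousOn.intervalIntegrable_of_Icc hab (hR.mono hsub))
  exact (h t (hsub (Ioo_subset_Icc_self ht))).hasDerivAt
    (Icc_mem_nhds (ha.1.trans_lt ht.1) (ht.2.trans_le hb.2))

/-- Exchange of ∂_t and ∂_x without assuming that the mixed derivative exists: integrate the
evolution in time, differentiate in x under the integral, then differentiate in time again. It
passes from the equation to the equations for ∂_x^j u. -/
theorem hasDerivWithinAt_deriv {T : ℝ} {g g' R R' : ℝ → ℝ → ℝ}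
    (h : ∀ t ∈ Icc 0 T, ∀ x, HasDerivWithinAt (fun s => g s x) (R t x) (Icc 0 T) t)
    (hg : ∀ t ∈ Icc 0 T, ∀ x, HasDerivAt (g t) (g' t x) x)
    (hR : ∀ t ∈ Icc 0 T, ∀ x, HasDerivAt (R t) (R' t x) x)
    (cR : ContinuousOn (fun p : ℝ × ℝ => R p.1 p.2) (Icc 0 T ×ˢ univ))
    (cR' : ContinuousOn (fun p : ℝ × ℝ => R' p.1 p.2) (Icc 0 T ×ˢ univ)) :
    ∀ t ∈ Icc 0 T, ∀ x, HasDerivWithinAt (fun s => g' s x) (R' t x) (Icc 0 T) t := by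
  have key : ∀ t ∈ Icc 0 T, ∀ x, g' t x = g' 0 x + ∫ τ in (0 : ℝ)..t, R' τ x := by
    intro t ht x₀
    have hT : (0 : ℝ) ∈ Icc 0 T := ⟨le_rfl, ht.1.trans ht.2⟩
    have hsub : Icc 0 t ⊆ Icc 0 T := Icc_subset_Icc_right ht.2
    have hI : ∀ x, ∫ τ in (0 : ℝ)..t, R τ x = g t x - g 0 x := fun x =>
      integral_eq_sub_of_hasDerivWithinAt_Icc hT ht ht.1 (fun s hs => h s hs x)
        (continuousOn_slice cR x)
    have hii : ∀ {Q : ℝ → ℝ → ℝ}, ContinuousOn (fun p : ℝ × ℝ => Q p.1 p.2) (Icc 0 T ×ˢ univ) →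
        ∀ x, IntervalIntegrable (fun τ => Q τ x) volume 0 t := fun hQ x =>
      ContinuousOn.intervalIntegrable_of_Icc ht.1 ((continuousOn_slice hQ x).mono hsub)
    obtain ⟨C, hC⟩ := (isCompact_Icc.prod (isCompact_closedBall x₀ 1)).exists_bound_of_continuousOn
      (cR'.mono (prod_mono_right (subset_univ (Metric.closedBall x₀ 1))))
    have hio : ∀ τ, τ ∈ uIoc 0 t → τ ∈ Icc 0 T := fun τ hτ => by
      rw [uIoc_of_le ht.1] at hτ
      exact hsub ⟨hτ.1.le, hτ.2⟩
    have h1 := (intervalIntegral.hasDerivAt_integral_of_dominated_loc_of_deriv_le (μ := volume)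
      (F := fun x τ => R τ x) (F' := fun x τ => R' τ x) (x₀ := x₀) (s := Metric.ball x₀ 1)
      (bound := fun _ => C) (Metric.ball_mem_nhds x₀ one_pos)
      (Eventually.of_forall fun x => (intervalIntegrable_iff.1 (hii cR x)).aestronglyMeasurable)
      (hii cR x₀) (intervalIntegrable_iff.1 (hii cR' x₀)).aestronglyMeasurable
      (ae_of_all _ fun τ hτ x hx => hC (τ, x) ⟨hio τ hτ, Metric.ball_subset_closedBall hx⟩)
      intervalIntegrable_const
      (ae_of_all _ fun τ hτ x _ => hR τ (hio τ hτ) x)).2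
    have h2 : HasDerivAt (fun x => ∫ τ in (0 : ℝ)..t, R τ x) (g' t x₀ - g' 0 x₀) x₀ := by
      rw [funext hI]
      exact (hg t ht x₀).sub (hg 0 hT x₀)
    have := h1.unique h2
    linarith
  intro t ht x
  -- The fundamental theorem of calculus within a closed interval, endpoints included, finds this
  -- membership by instance search.
  have : Fact (t ∈ Icc 0 T) := ⟨ht⟩
  have hc := continuousOn_slice cR' x
  have h1 : HasDerivWithinAt (fun s => ∫ τ in (0 : ℝ)..s, R' τ x) (R' t x) (Icc 0 T) t :=
    intervalIntegral.integral_hasDerivWithinAt_right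
      (ContinuousOn.intervalIntegrable_of_Icc ht.1 (hc.mono (Icc_subset_Icc_right ht.2)))
      (hc.stronglyMeasurableAtFilter_nhdsWithin measurableSet_Icc t) (hc t ht)
  exact (h1.const_add (g' 0 x)).congr (fun s hs => key s hs x) (key t ht x)

theorem integrable_uncurry_of_continuousOn {T a b B : ℝ} {F : ℝ → ℝ → ℝ} (ha : a ∈ Icc 0 T)
    (hb : b ∈ Icc 0 T) (hab : a ≤ b)
    (hF : ContinuousOn (fun p : ℝ × ℝ => F p.1 p.2) (Icc 0 T ×ˢ univ))
    (hi : ∀ τ ∈ Icc 0 T, Integrable (F τ)) (hB : ∀ τ ∈ Icc 0 T, ∫ x, |F τ x| ≤ B) :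
    Integrable (Function.uncurry F) ((volume.restrict (uIoc a b)).prod volume) := by
  rw [uIoc_of_le hab]
  have hsub : Ioc a b ⊆ Icc 0 T := fun τ hτ => ⟨ha.1.trans hτ.1.le, hτ.2.trans hb.2⟩
  have hm : AEStronglyMeasurable (Function.uncurry F)
      ((volume.restrict (Ioc a b)).prod volume) := by
    have : (volume.restrict (Ioc a b)).prod (volume : Measure ℝ)
        = (volume.prod volume).restrict (Ioc a b ×ˢ univ) := by
      rw [← Measure.prod_restrict, Measure.restrict_univ]
    rw [this]
    exact (hF.mono (prod_mono_left hsub)).aestronglyMeasurable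
      (measurableSet_Ioc.prod MeasurableSet.univ)
  have hae : ∀ᵐ τ ∂(volume.restrict (Ioc a b)), τ ∈ Icc 0 T := by
    filter_upwards [ae_restrict_mem measurableSet_Ioc] with τ hτ using hsub hτ
  rw [integrable_prod_iff hm]
  refine ⟨hae.mono fun τ hτ => hi τ hτ, ?_⟩
  refine Integrable.mono' (g := fun _ => B) (integrable_const _) hm.norm.integral_prod_right' ?_
  filter_upwards [hae] with τ hτ
  rw [Real.norm_of_nonneg (integral_nonneg fun _ => norm_nonneg _)]
  exact hB τ hτ

theorem sq_integral_le {a b : ℝ} (hab : a ≤ b) {R : ℝ → ℝ} (hR : ContinuousOn R (Icc a b)) :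
    (∫ τ in a..b, R τ) ^ 2 ≤ (b - a) * ∫ τ in a..b, R τ ^ 2 := by
  rcases hab.eq_or_lt with rfl | hlt
  · simp
  have hi : IntervalIntegrable R volume a b := ContinuousOn.intervalIntegrable_of_Icc hab hR
  have hi2 : IntervalIntegrable (fun τ => R τ ^ 2) volume a b :=
    ContinuousOn.intervalIntegrable_of_Icc hab (hR.pow 2)
  set h := ∫ τ in a..b, R τ with hh
  -- c is the mean of R; nonnegativity of its variance is the Cauchy–Schwarz inequality.
  set c := h / (b - a) with hc
  have hba : 0 < b - a := sub_pos.2 hlt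
  have h0 : 0 ≤ ∫ τ in a..b, (R τ - c) ^ 2 :=
    intervalIntegral.integral_nonneg hab fun _ _ => sq_nonneg _
  have h1 : ∫ τ in a..b, (R τ - c) ^ 2 = (∫ τ in a..b, R τ ^ 2) - 2 * c * h + c ^ 2 * (b - a) := by
    have : ∀ τ, (R τ - c) ^ 2 = R τ ^ 2 - 2 * c * R τ + c ^ 2 := fun τ => by ring
    simp only [this]
    rw [intervalIntegral.integral_add (hi2.sub (hi.const_mul _)) intervalIntegrable_const,
      intervalIntegral.integral_sub hi2 (hi.const_mul _), intervalIntegral.integral_const_mul,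
      intervalIntegral.integral_const, smul_eq_mul]
    ring
  rw [h1] at h0
  have h2 : c * (b - a) = h := by rw [hc]; field_simp
  nlinarith

/-- Minkowski's inequality for the increment g b - g a = ∫ R dτ, obtained from Cauchy–Schwarz in
time followed by Fubini. -/
theorem integral_sq_sub_le {T a b B : ℝ} {g R : ℝ → ℝ → ℝ} (ha : a ∈ Icc 0 T)
    (hb : b ∈ Icc 0 T) (hab : a ≤ b)
    (h : ∀ t ∈ Icc 0 T, ∀ x, HasDerivWithinAt (fun s => g s x) (R t x) (Icc 0 T) t)
    (hR : ContinuousOn (fun p : ℝ × ℝ => R p.1 p.2) (Icc 0 T ×ˢ univ))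
    (hi : ∀ τ ∈ Icc 0 T, Integrable fun x => R τ x ^ 2)
    (hB : ∀ τ ∈ Icc 0 T, ∫ x, R τ x ^ 2 ≤ B) (hg : Integrable fun x => (g b x - g a x) ^ 2) :
    ∫ x, (g b x - g a x) ^ 2 ≤ (b - a) ^ 2 * B := by
  have hsub : Icc a b ⊆ Icc 0 T := Icc_subset_Icc ha.1 hb.2
  have hF := integrable_uncurry_of_continuousOn (B := B) (F := fun τ x => R τ x ^ 2) ha hb hab
    (hR.pow 2) hi (fun τ hτ => by simpa only [abs_pow, sq_abs] using hB τ hτ)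
  have h1 : ∀ x, (g b x - g a x) ^ 2 ≤ (b - a) * ∫ τ in a..b, R τ x ^ 2 := fun x => by
    rw [← integral_eq_sub_of_hasDerivWithinAt_Icc ha hb hab (fun s hs => h s hs x)
      (continuousOn_slice hR x)]
    exact sq_integral_le hab ((continuousOn_slice hR x).mono hsub)
  have hint : Integrable (fun x => (b - a) * ∫ τ in a..b, R τ x ^ 2) := by
    have := hF.integral_prod_right
    simp only [Function.uncurry, uIoc_of_le hab] at this
    simp only [intervalIntegral.integral_of_le hab]
    exact this.const_mul _
  refine (integral_mono hg hint h1).trans ?_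
  rw [integral_const_mul, ← intervalIntegral_integral_swap hF, sq, mul_assoc]
  refine mul_le_mul_of_nonneg_left ?_ (sub_nonneg.2 hab)
  have hc : ∫ τ in a..b, B = (b - a) * B := by
    rw [intervalIntegral.integral_const, smul_eq_mul]
  rw [← hc]
  have hii : IntervalIntegrable (fun τ => ∫ x, R τ x ^ 2) volume a b := by
    rw [intervalIntegrable_iff]
    exact hF.integral_prod_left
  exact intervalIntegral.integral_mono_on hab hii intervalIntegrable_const
    fun τ hτ => hB τ (hsub hτ)

/-! ### Continuity in time of the derivatives -/

theorem hNorm_mono {k l : ℕ} (h : k ≤ l) (g : ℝ → ℝ) : hNorm k g ≤ hNorm l g :=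
  ENNReal.rpow_le_rpow (Finset.sum_le_sum_of_subset (Finset.range_mono (by omega))) (by norm_num)

/-- Continuity in H^k is uniform in x for derivatives below the top order, by Sobolev embedding;
together with continuity in x at fixed t this gives joint continuity. -/
theorem MemCH.continuousOn {k : ℕ} {T : ℝ} {u : ℝ → ℝ → ℝ} (hu : MemCH k T u) {j : ℕ} (hj : j < k) :
    ContinuousOn (fun p : ℝ × ℝ => iteratedDeriv j (u p.1) p.2) (Icc 0 T ×ˢ univ) := by
  rintro ⟨t, x⟩ ⟨ht, -⟩
  rw [Metric.continuousWithinAt_iff']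
  intro η hη
  have h1 : ∀ᶠ s in 𝓝[Icc 0 T] t, hNorm k (u s - u t) < ENNReal.ofReal (η / 4) :=
    (hu.tendsto t ht).eventually (gt_mem_nhds (by simpa using hη))
  have h2 : ∀ᶠ y in 𝓝 x, |iteratedDeriv j (u t) y - iteratedDeriv j (u t) x| < η / 2 := by
    have := Metric.tendsto_nhds.1 (((hu.memH t ht).continuous hj).tendsto x) (η / 2) (by positivity)
    simpa only [Real.dist_eq] using this
  have h3 : ∀ᶠ p : ℝ × ℝ in 𝓝[Icc 0 T ×ˢ univ] (t, x),
      (p.1 ∈ Icc 0 T ∧ hNorm k (u p.1 - u t) < ENNReal.ofReal (η / 4)) ∧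
      |iteratedDeriv j (u t) p.2 - iteratedDeriv j (u t) x| < η / 2 := by
    rw [nhdsWithin_prod_eq, nhdsWithin_univ]
    exact (eventually_mem_nhdsWithin.and h1).prod_mk h2
  filter_upwards [h3] with p hp
  obtain ⟨⟨hpT, hp1⟩, hp2⟩ := hp
  have h4 := ((hu.memH _ hpT).sub (hu.memH t ht)).abs_le (by positivity) hp1.le hj p.2
  rw [(hu.memH _ hpT).iteratedDeriv_sub (hu.memH t ht) hj] at h4
  rw [Real.dist_eq]
  calc _ = |(iteratedDeriv j (u p.1) p.2 - iteratedDeriv j (u t) p.2)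
        + (iteratedDeriv j (u t) p.2 - iteratedDeriv j (u t) x)| := by congr 1; ring
    _ ≤ _ := abs_add_le _ _
    _ < η := by linarith

theorem hThreeSq_le_of_forall {w : ℝ → ℝ} {B : ℝ} (h : ∀ j ≤ 3, ∫ x, iteratedDeriv j w x ^ 2 ≤ B) :
    hThreeSq w ≤ 4 * B := by
  have := Finset.sum_le_sum (s := Finset.range 4) (f := fun j => ∫ x, iteratedDeriv j w x ^ 2)
    (g := fun _ => B) fun j hj => h j (by have := Finset.mem_range.1 hj; omega)
  simpa [hThreeSq] using this

theorem Icc_subset_timeInterval {T : ℝ} (hT : T ≤ 1) : Icc 0 T ⊆ timeInterval :=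
  Icc_subset_Icc (by norm_num) hT

theorem MemCH.mono {k l : ℕ} {T : ℝ} {u : ℝ → ℝ → ℝ} (hu : MemCH k T u) (h : l ≤ k) :
    MemCH l T u :=
  ⟨fun t ht => (hu.memH t ht).mono h, fun t ht => tendsto_of_tendsto_of_tendsto_of_le_of_le
    tendsto_const_nhds (hu.tendsto t ht) (fun _ => zero_le) fun _ => hNorm_mono h _⟩

theorem IsSolution.memCH_seven {f : (Fin 4 → ℝ) → ℝ → ℝ → ℝ} {ε : ℝ≥0} {T : ℝ} {u₀ : ℝ → ℝ}
    {u : ℝ → ℝ → ℝ} (h : IsSolution f ε T u₀ u) : MemCH 7 T u :=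
  h.mem.mono (by split_ifs <;> norm_num)

theorem IsSolution.memCH_eight {f : (Fin 4 → ℝ) → ℝ → ℝ → ℝ} {ε : ℝ≥0} {T : ℝ} {u₀ : ℝ → ℝ}
    {u : ℝ → ℝ → ℝ} (h : IsSolution f ε T u₀ u) (hε : ε ≠ 0) : MemCH 8 T u := by
  have := h.mem
  rwa [if_neg hε] at this

/-! ### Uniform bounds along solutions -/

namespace Expansion

variable {f : (Fin 4 → ℝ) → ℝ → ℝ → ℝ} (X : Expansion f)

/-- The time derivative of `∂_x^j u` along the regularized equation. -/
noncomputable def rate (ε : ℝ≥0) (u : ℝ → ℝ → ℝ) (j : ℕ) (t x : ℝ) : ℝ :=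
  -X.total j (jets (u t) x) x t - (ε : ℝ) * iteratedDeriv (4 + j) (u t) x

/-- A solution of the regularized equation on `[0,T]` with bounds in `H^7`. -/
structure Flow (K T : ℝ) (ε : ℝ≥0) (u : ℝ → ℝ → ℝ) : Prop where
  le_one : T ≤ 1
  high : ∀ t ∈ Icc 0 T, HighBound K (u t)
  hThreeSq_le : ∀ t ∈ Icc 0 T, hThreeSq (u t) ≤ K
  sq_le : ∀ t ∈ Icc 0 T, ∀ j ≤ 7, ∫ x, iteratedDeriv j (u t) x ^ 2 ≤ K
  visc_sq_le : ∀ t ∈ Icc 0 T, ∀ j ≤ 3, ∫ x, ((ε : ℝ) * iteratedDeriv (4 + j) (u t) x) ^ 2 ≤ K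
  visc_le : ∀ t ∈ Icc 0 T, ∀ j ≤ 3, ∀ x, |(ε : ℝ) * iteratedDeriv (4 + j) (u t) x| ≤ K
  cont : ∀ j ≤ 6, ContinuousOn (fun p : ℝ × ℝ => iteratedDeriv j (u p.1) p.2) (Icc 0 T ×ˢ univ)
  cont_rate : ∀ j ≤ 3, ContinuousOn (fun p : ℝ × ℝ => X.rate ε u j p.1 p.2) (Icc 0 T ×ˢ univ)
  deriv : ∀ j ≤ 3, ∀ t ∈ Icc 0 T, ∀ x,
    HasDerivWithinAt (fun s => iteratedDeriv j (u s) x) (X.rate ε u j t x) (Icc 0 T) t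

theorem Flow.mono {X : Expansion f} {K K' T : ℝ} {ε : ℝ≥0} {u : ℝ → ℝ → ℝ}
    (h : X.Flow K T ε u) (hK : K ≤ K') : X.Flow K' T ε u where
  le_one := h.le_one
  high t ht := ⟨(h.high t ht).memH, fun j hj x => ((h.high t ht).le j hj x).trans hK⟩
  hThreeSq_le t ht := (h.hThreeSq_le t ht).trans hK
  sq_le t ht j hj := (h.sq_le t ht j hj).trans hK
  visc_sq_le t ht j hj := (h.visc_sq_le t ht j hj).trans hK
  visc_le t ht j hj x := (h.visc_le t ht j hj x).trans hK
  cont := h.cont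
  cont_rate := h.cont_rate
  deriv := h.deriv

/-- In the constant, 2N comes from Sobolev embedding and 4N² from the four squares in the H^3 norm.
The bound on ε times the H^8 norm serves to control ε ∂_x^7 u pointwise and to bound the viscous
terms in L² without any bound on ε itself. -/
theorem flow_of_isSolution {ε : ℝ≥0} {T N : ℝ} {u₀ : ℝ → ℝ} {u : ℝ → ℝ → ℝ}
    (h : IsSolution f ε T u₀ u) (hT : T ≤ 1) (hN : 0 < N)
    (h7 : ∀ t ∈ Icc 0 T, hNorm 7 (u t) ≤ ENNReal.ofReal N)
    (h8 : ε ≠ 0 → ∀ t ∈ Icc 0 T, ε * hNorm 8 (u t) ≤ ENNReal.ofReal N) :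
    X.Flow (2 * N + 4 * N ^ 2) T ε u := by
  have hm7 := h.memCH_seven
  have hI := Icc_subset_timeInterval hT
  have hN2 : 0 < N ^ 2 := by positivity
  have h8' : ε ≠ 0 → ∀ t ∈ Icc 0 T, hNorm 8 (u t) ≤ ENNReal.ofReal (N / ε) := by
    intro hε t ht
    have hε' : (0 : ℝ) < ε := by exact_mod_cast pos_iff_ne_zero.2 hε
    rw [ENNReal.ofReal_div_of_pos hε', ENNReal.ofReal_coe_nnreal,
      ENNReal.le_div_iff_mul_le (Or.inl (by exact_mod_cast hε)) (Or.inl ENNReal.coe_ne_top),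
      mul_comm]
    exact h8 hε t ht
  have hsq : ∀ t ∈ Icc 0 T, ∀ j ≤ 7, ∫ x, iteratedDeriv j (u t) x ^ 2 ≤ N ^ 2 :=
    fun t ht j hj => (hm7.memH t ht).integral_sq_le hN.le (h7 t ht) hj
  have high : ∀ t ∈ Icc 0 T, HighBound (2 * N + 4 * N ^ 2) (u t) := fun t ht =>
    ⟨hm7.memH t ht, fun j hj x =>
      ((hm7.memH t ht).abs_le hN (h7 t ht) (by omega) x).trans (by linarith)⟩
  have cont : ∀ j ≤ 6,
      ContinuousOn (fun p : ℝ × ℝ => iteratedDeriv j (u p.1) p.2) (Icc 0 T ×ˢ univ) :=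
    fun j hj => hm7.continuousOn (by omega)
  have cont_visc : ∀ j ≤ 7, ContinuousOn (fun p : ℝ × ℝ => (ε : ℝ) * iteratedDeriv j (u p.1) p.2)
      (Icc 0 T ×ˢ univ) := by
    intro j hj
    by_cases hε : ε = 0
    · simpa [hε] using continuousOn_const
    · exact continuousOn_const.mul ((h.memCH_eight hε).continuousOn (by omega))
  have cont_rate : ∀ j ≤ 3,
      ContinuousOn (fun p : ℝ × ℝ => X.rate ε u j p.1 p.2) (Icc 0 T ×ˢ univ) := fun j hj =>
    ((X.continuousOn_total hj (Y := fun p : ℝ × ℝ => jets (u p.1) p.2)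
      (fun i hi => cont i (by omega)) continuousOn_snd continuousOn_fst
      fun p hp => hI hp.1).neg).sub (cont_visc (4 + j) (by omega))
  have deriv_rate : ∀ j < 3, ∀ t ∈ Icc 0 T, ∀ x,
      HasDerivAt (X.rate ε u j t) (X.rate ε u (j + 1) t x) x := by
    intro j hj t ht x
    refine (X.hasDerivAt_total hj (hI ht) (high t ht).contDiff x).neg.sub ?_
    by_cases hε : ε = 0
    · simpa [hε] using hasDerivAt_const x (0 : ℝ)
    · exact (((h.memCH_eight hε).memH t ht).hasDerivAt (by omega) x).const_mul _
  have deriv : ∀ j ≤ 3, ∀ t ∈ Icc 0 T, ∀ x,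
      HasDerivWithinAt (fun s => iteratedDeriv j (u s) x) (X.rate ε u j t x) (Icc 0 T) t := by
    intro j
    induction j with
    | zero =>
      intro _ t ht x
      simp only [iteratedDeriv_zero]
      exact h.equation t ht x
    | succ j ih =>
      intro hj
      exact hasDerivWithinAt_deriv (ih (by omega))
        (fun t ht x => (hm7.memH t ht).hasDerivAt (by omega) x) (deriv_rate j (by omega))
        (cont_rate j (by omega)) (cont_rate (j + 1) hj)
  refine ⟨hT, high, fun t ht => ?_, fun t ht j hj => (hsq t ht j hj).trans (by linarith),
    fun t ht j hj => ?_, fun t ht j hj x => ?_, cont, cont_rate, deriv⟩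
  · exact (hThreeSq_le_of_forall fun j hj => hsq t ht j (by omega)).trans (by linarith)
  · by_cases hε : ε = 0
    · simp only [hε, NNReal.coe_zero, zero_mul]
      simp only [ne_eq, OfNat.ofNat_ne_zero, not_false_eq_true, zero_pow, integral_zero]
      positivity
    · have hε' : (0 : ℝ) < ε := by exact_mod_cast pos_iff_ne_zero.2 hε
      have := ((h.memCH_eight hε).memH t ht).integral_sq_le (by positivity) (h8' hε t ht)
        (j := 4 + j) (by omega)
      simp only [mul_pow]
      rw [integral_const_mul]
      calc _ ≤ (ε : ℝ) ^ 2 * (N / ε) ^ 2 := mul_le_mul_of_nonneg_left this (sq_nonneg _)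
        _ = N ^ 2 := by field_simp
        _ ≤ _ := by linarith
  · by_cases hε : ε = 0
    · simp only [hε, NNReal.coe_zero, zero_mul, abs_zero]
      positivity
    · have hε' : (0 : ℝ) < ε := by exact_mod_cast pos_iff_ne_zero.2 hε
      have := ((h.memCH_eight hε).memH t ht).abs_le (by positivity) (h8' hε t ht)
        (j := 4 + j) (by omega) x
      rw [abs_mul, abs_of_pos hε']
      calc _ ≤ (ε : ℝ) * (2 * (N / ε)) := mul_le_mul_of_nonneg_left this hε'.le
        _ = 2 * N := by field_simp
        _ ≤ _ := by linarith

theorem total_zero (hf : ConditionA3 f) {i : ℕ} (hi : i ≤ 3) {t : ℝ} (ht : t ∈ timeInterval)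
    (x : ℝ) : X.total i (jets 0 x) x t = 0 := by
  induction i generalizing x with
  | zero =>
    have : (fun j : Fin 4 => jets 0 x j) = 0 := by ext j; simp [jets]
    simp only [total, this]
    exact hf x t ht
  | succ i ih =>
    have h := X.hasDerivAt_total (i := i) (by omega) ht (u := 0) contDiff_const x
    rw [funext fun x => ih (by omega) x] at h
    exact h.unique (hasDerivAt_const x 0)

/-- By (A3) the total derivatives of f vanish along the zero function, so the difference estimates
with u' = 0 bound the total derivatives themselves, in L² as well as pointwise. -/
theorem exists_rate_bound (hf : ConditionA3 f) (K : ℝ) : ∃ C : ℝ, 1 ≤ C ∧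
    ∀ T ε u, X.Flow K T ε u → ∀ j ≤ 3, ∀ t ∈ Icc 0 T, (∀ x, |X.rate ε u j t x| ≤ C) ∧
      MemLp (X.rate ε u j t) 2 volume ∧ ∫ x, X.rate ε u j t x ^ 2 ≤ C := by
  have hone : ∀ j ≤ 3, ∃ C : ℝ, ∀ T ε u, X.Flow K T ε u → ∀ t ∈ Icc 0 T,
      (∀ x, |X.rate ε u j t x| ≤ C) ∧
      MemLp (X.rate ε u j t) 2 volume ∧ ∫ x, X.rate ε u j t x ^ 2 ≤ C := by
    intro j hj
    obtain ⟨C, hC, h⟩ := X.exists_diffTotal_bound K hj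
    refine ⟨max (C * ((j + 4 : ℕ) * K) + K) (2 * (C * ((j + 4 : ℕ) * K)) + 2 * K),
      fun T ε u hu t ht => ?_⟩
    have hK : 0 ≤ K := (abs_nonneg _).trans ((hu.high t ht).le 0 (by norm_num) 0)
    have hz : HighBound K 0 := ⟨MemH.zero 7, fun j _ x => by simpa using hK⟩
    have hI := Icc_subset_timeInterval hu.le_one ht
    obtain ⟨h1, h2, h3⟩ := h (u t) 0 t (hu.high t ht) hz hI
    have e : X.diffTotal j (u t) 0 t = fun x => X.total j (jets (u t) x) x t := by
      ext x; rw [diffTotal, X.total_zero hf hj hI, sub_zero]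
    rw [e] at h1 h2 h3
    simp only [sub_zero] at h1 h3
    have hv : MemLp (fun x => (ε : ℝ) * iteratedDeriv (4 + j) (u t) x) 2 volume :=
      ((hu.high t ht).memH.memLp (4 + j) (by omega)).const_mul _
    have hR : MemLp (X.rate ε u j t) 2 volume := h2.neg.sub hv
    refine ⟨fun x => le_max_of_le_left ?_, hR, le_max_of_le_right ?_⟩
    · have e1 := h1 x
      have e2 := hu.visc_le t ht j hj x
      have e3 : ∑ i ∈ Finset.range (j + 4), |iteratedDeriv i (u t) x| ≤ (j + 4 : ℕ) * K := by
        simpa using Finset.sum_le_sum (s := Finset.range (j + 4))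
          (f := fun i => |iteratedDeriv i (u t) x|) (g := fun _ => K)
          fun i hi => (hu.high t ht).le i (by have := Finset.mem_range.1 hi; omega) x
      calc |X.rate ε u j t x| ≤ |-X.total j (jets (u t) x) x t|
            + |(ε : ℝ) * iteratedDeriv (4 + j) (u t) x| := abs_sub _ _
        _ ≤ _ := by rw [abs_neg]; exact add_le_add (e1.trans (mul_le_mul_of_nonneg_left e3 hC)) e2
    · have e2 := hu.visc_sq_le t ht j hj
      have e3 : ∑ i ∈ Finset.range (j + 4), ∫ x, iteratedDeriv i (u t) x ^ 2
          ≤ (j + 4 : ℕ) * K := by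
        simpa using Finset.sum_le_sum (s := Finset.range (j + 4))
          (f := fun i => ∫ x, iteratedDeriv i (u t) x ^ 2) (g := fun _ => K)
          fun i hi => hu.sq_le t ht i (by have := Finset.mem_range.1 hi; omega)
      have e4 := h3.trans (mul_le_mul_of_nonneg_left e3 hC)
      have e5 : ∫ x, X.rate ε u j t x ^ 2 ≤ ∫ x, (2 * X.total j (jets (u t) x) x t ^ 2
          + 2 * ((ε : ℝ) * iteratedDeriv (4 + j) (u t) x) ^ 2) := by
        refine integral_mono hR.integrable_sq ((h2.integrable_sq.const_mul 2).add
          (hv.integrable_sq.const_mul 2)) fun x => ?_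
        simp only [rate]
        nlinarith [sq_nonneg (X.total j (jets (u t) x) x t
          - (ε : ℝ) * iteratedDeriv (4 + j) (u t) x)]
      rw [integral_add (h2.integrable_sq.const_mul 2) (hv.integrable_sq.const_mul 2),
        integral_const_mul, integral_const_mul] at e5
      linarith
  choose! C hC using hone
  refine ⟨1 + ∑ j ∈ Finset.range 4, |C j|,
    le_add_of_nonneg_right (Finset.sum_nonneg fun _ _ => abs_nonneg _),
    fun T ε u hu j hj t ht => ?_⟩
  have hle : C j ≤ 1 + ∑ j ∈ Finset.range 4, |C j| :=
    ((le_abs_self _).trans (Finset.single_le_sum (f := fun j => |C j|) (fun _ _ => abs_nonneg _)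
      (Finset.mem_range.2 (by omega)))).trans (le_add_of_nonneg_left zero_le_one)
  obtain ⟨h1, h2, h3⟩ := hC j hj T ε u hu t ht
  exact ⟨fun x => (h1 x).trans hle, h2, h3.trans hle⟩

theorem exists_time_lip (hf : ConditionA3 f) (K : ℝ) : ∃ C : ℝ, 1 ≤ C ∧
    ∀ T ε u, X.Flow K T ε u → ∀ t ∈ Icc 0 T, ∀ s ∈ Icc 0 T, t ≤ s →
      (∀ j ≤ 3, ∀ x, |iteratedDeriv j (u s - u t) x| ≤ C * (s - t)) ∧
      hThreeSq (u s - u t) ≤ (C * (s - t)) ^ 2 := by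
  obtain ⟨C, hC, h⟩ := X.exists_rate_bound hf K
  -- The squared H^3 norm of the increment is at most 4C (s - t)², and 4C ≤ (4C)² because C ≥ 1.
  refine ⟨4 * C, by linarith, fun T ε u hu t ht s hs hts => ?_⟩
  have hst : 0 ≤ s - t := sub_nonneg.2 hts
  have hms := (hu.high s hs).memH
  have hmt := (hu.high t ht).memH
  have hdiff : ∀ j ≤ 3, iteratedDeriv j (u s - u t)
      = fun x => iteratedDeriv j (u s) x - iteratedDeriv j (u t) x := fun j hj => by
    ext x; exact hms.iteratedDeriv_sub hmt (by omega) x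
  constructor
  · intro j hj x
    rw [hdiff j hj]
    have := (convex_Icc 0 T).norm_image_sub_le_of_norm_hasDerivWithin_le
      (fun τ hτ => hu.deriv j hj τ hτ x) (fun τ hτ => (h T ε u hu j hj τ hτ).1 x) ht hs
    rw [Real.norm_eq_abs, Real.norm_of_nonneg hst] at this
    exact this.trans (mul_le_mul_of_nonneg_right (by linarith) hst)
  · have : ∀ j ≤ 3, ∫ x, iteratedDeriv j (u s - u t) x ^ 2 ≤ (s - t) ^ 2 * C := by
      intro j hj
      have hi := (hms.sub hmt).integrable_sq (j := j) (by omega)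
      rw [hdiff j hj] at hi ⊢
      exact integral_sq_sub_le ht hs hts (hu.deriv j hj) (hu.cont_rate j hj)
        (fun τ hτ => (h T ε u hu j hj τ hτ).2.1.integrable_sq)
        (fun τ hτ => (h T ε u hu j hj τ hτ).2.2) hi
    refine (hThreeSq_le_of_forall this).trans ?_
    nlinarith [mul_nonneg (sq_nonneg (s - t)) (by nlinarith : 0 ≤ 16 * C ^ 2 - 4 * C)]

end Expansion

/-! ### Time dependence of the weight, and the energy -/

theorem abs_exp_sub_exp_le {a b m : ℝ} (ha : a ≤ m) (hb : b ≤ m) :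
    |Real.exp a - Real.exp b| ≤ Real.exp m * |a - b| := by
  have key : ∀ {a b : ℝ}, a ≤ m → Real.exp a - Real.exp b ≤ Real.exp m * |a - b| := by
    intro a b ha
    have h1 := Real.add_one_le_exp (b - a)
    have h2 : Real.exp b = Real.exp a * Real.exp (b - a) := by rw [← Real.exp_add]; ring_nf
    have h3 : Real.exp a * (a - b) ≤ Real.exp m * |a - b| :=
      (mul_le_mul_of_nonneg_left (le_abs_self _) (Real.exp_pos a).le).trans
        (mul_le_mul_of_nonneg_right (Real.exp_le_exp.2 ha) (abs_nonneg _))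
    have h4 := Real.exp_pos a
    nlinarith
  rw [abs_le]
  have := key (b := a) hb
  rw [abs_sub_comm] at this
  exact ⟨by linarith, key ha⟩

theorem hThreeSq_le_add {a b c : ℝ → ℝ} (ha : MemH 7 a) (hb : MemH 7 b) (hc : MemH 7 c)
    (h : ∀ j ≤ 3, ∀ x, |iteratedDeriv j a x| ≤ |iteratedDeriv j b x| + |iteratedDeriv j c x|) :
    hThreeSq a ≤ 2 * hThreeSq b + 2 * hThreeSq c := by
  simp only [hThreeSq, Finset.mul_sum]
  rw [← Finset.sum_add_distrib]
  refine Finset.sum_le_sum fun j hj => ?_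
  have hj' : j ≤ 3 := by have := Finset.mem_range.1 hj; omega
  have ib := (hb.integrable_sq (j := j) (by omega)).const_mul 2
  have ic := (hc.integrable_sq (j := j) (by omega)).const_mul 2
  rw [← integral_const_mul, ← integral_const_mul, ← integral_add ib ic]
  refine integral_mono (ha.integrable_sq (by omega)) (ib.add ic) fun x => ?_
  have h1 := h j hj' x
  simp only
  rw [← sq_abs (iteratedDeriv j a x), ← sq_abs (iteratedDeriv j b x), ← sq_abs (iteratedDeriv j c x)]
  nlinarith [abs_nonneg (iteratedDeriv j a x), abs_nonneg (iteratedDeriv j b x),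
    abs_nonneg (iteratedDeriv j c x),
    sq_nonneg (|iteratedDeriv j b x| - |iteratedDeriv j c x|)]

theorem hThreeSq_sub_le {b c : ℝ → ℝ} (hb : MemH 7 b) (hc : MemH 7 c) :
    hThreeSq (b - c) ≤ 2 * hThreeSq b + 2 * hThreeSq c :=
  hThreeSq_le_add (hb.sub hc) hb hc fun j hj x => by
    rw [hb.iteratedDeriv_sub hc (by omega)]; exact abs_sub _ _

theorem hThreeSq_le_sub_add {a c : ℝ → ℝ} (ha : MemH 7 a) (hc : MemH 7 c) :
    hThreeSq a ≤ 2 * hThreeSq (a - c) + 2 * hThreeSq c :=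
  hThreeSq_le_add ha (ha.sub hc) hc fun j hj x => by
    rw [ha.iteratedDeriv_sub hc (by omega)]
    calc _ = |(iteratedDeriv j a x - iteratedDeriv j c x) + iteratedDeriv j c x| := by
          congr 1; ring
      _ ≤ _ := abs_add_le _ _

theorem two_mul_abs_mul_le (a b : ℝ) : |2 * (a * b)| ≤ a ^ 2 + b ^ 2 := by
  rw [abs_le]
  constructor <;> nlinarith [sq_nonneg (a + b), sq_nonneg (a - b)]

theorem integral_abs_mul_le {φ a R : ℝ → ℝ} {D : ℝ} (hφ : Continuous φ)
    (hφD : ∀ x, |φ x| ≤ D) (ma : MemLp a 2 volume) (mR : MemLp R 2 volume) :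
    Integrable (fun x => φ x * (2 * (a x * R x))) ∧
    ∫ x, |φ x * (2 * (a x * R x))| ≤ D * ((∫ x, a x ^ 2) + ∫ x, R x ^ 2) := by
  have hi : Integrable (fun x => φ x * (2 * (a x * R x))) :=
    ((ma.integrable_mul mR).const_mul 2).bdd_mul hφ.aestronglyMeasurable (ae_of_all _ hφD)
  refine ⟨hi, ?_⟩
  rw [← integral_add ma.integrable_sq mR.integrable_sq, ← integral_const_mul]
  refine integral_mono hi.abs ((ma.integrable_sq.add mR.integrable_sq).const_mul D) fun x => ?_
  simp only [abs_mul (φ x)]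
  exact mul_le_mul (hφD x) (two_mul_abs_mul_le _ _) (abs_nonneg _) ((abs_nonneg _).trans (hφD x))

/-- Evolution of a quadratic energy with a time-independent weight φ, in integrated form: the
fundamental theorem of calculus at each x, then Fubini. -/
theorem integral_mul_sq_sub {T t s B D : ℝ} {a R : ℝ → ℝ → ℝ} {φ : ℝ → ℝ} (ht : t ∈ Icc 0 T)
    (hs : s ∈ Icc 0 T) (hts : t ≤ s) (hφ : Continuous φ) (hφD : ∀ x, |φ x| ≤ D)
    (h : ∀ t ∈ Icc 0 T, ∀ x, HasDerivWithinAt (fun s => a s x) (R t x) (Icc 0 T) t)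
    (ca : ContinuousOn (fun p : ℝ × ℝ => a p.1 p.2) (Icc 0 T ×ˢ univ))
    (cR : ContinuousOn (fun p : ℝ × ℝ => R p.1 p.2) (Icc 0 T ×ˢ univ))
    (ma : ∀ τ ∈ Icc 0 T, MemLp (a τ) 2 volume) (mR : ∀ τ ∈ Icc 0 T, MemLp (R τ) 2 volume)
    (hB : ∀ τ ∈ Icc 0 T, (∫ x, a τ x ^ 2) + ∫ x, R τ x ^ 2 ≤ B) :
    (∫ x, φ x * a s x ^ 2) - ∫ x, φ x * a t x ^ 2
      = ∫ τ in t..s, ∫ x, φ x * (2 * (a τ x * R τ x)) ∧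
    IntervalIntegrable (fun τ => ∫ x, φ x * (2 * (a τ x * R τ x))) volume t s := by
  have hF := integrable_uncurry_of_continuousOn (B := D * B)
    (F := fun τ x => φ x * (2 * (a τ x * R τ x))) ht hs hts
    (((hφ.comp continuous_snd).continuousOn).mul (continuousOn_const.mul (ca.mul cR)))
    (fun τ hτ => (integral_abs_mul_le hφ hφD (ma τ hτ) (mR τ hτ)).1)
    (fun τ hτ => (integral_abs_mul_le hφ hφD (ma τ hτ) (mR τ hτ)).2.trans
      (mul_le_mul_of_nonneg_left (hB τ hτ) ((abs_nonneg _).trans (hφD 0))))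
  constructor
  · rw [intervalIntegral_integral_swap hF, ← integral_sub
      ((ma s hs).integrable_sq.bdd_mul hφ.aestronglyMeasurable (ae_of_all _ hφD))
      ((ma t ht).integrable_sq.bdd_mul hφ.aestronglyMeasurable (ae_of_all _ hφD))]
    refine integral_congr_ae (ae_of_all _ fun x => ?_)
    simp only
    rw [← mul_sub, intervalIntegral.integral_const_mul]
    congr 1
    refine (integral_eq_sub_of_hasDerivWithinAt_Icc (g := fun τ => a τ x ^ 2)
      (R := fun τ => 2 * (a τ x * R τ x)) ht hs hts
      (fun τ hτ => ((h τ hτ x).pow 2).congr_deriv ?_)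
      (continuousOn_const.mul ((continuousOn_slice ca x).mul (continuousOn_slice cR x)))).symm
    simp only [Nat.cast_ofNat, Nat.add_one_sub_one, pow_one]
    ring
  · rw [intervalIntegrable_iff]
    exact hF.integral_prod_left

namespace Expansion

variable {f : (Fin 4 → ℝ) → ℝ → ℝ → ℝ} (X : Expansion f)

/-- The solution moves at bounded speed in H^3 and in the first three derivatives pointwise;
`RatioStructure.exists_phase_lip` with δ = Ct (s - t) transfers this to the phase. -/
theorem exists_weight_lip {gD : (Fin 3 → ℝ) → ℝ → ℝ → ℝ} {gH : (Fin 4 → ℝ) → ℝ → ℝ → ℝ}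
    (hf : ConditionA3 f) (hr : RatioStructure gD gH X.p X.r) {K : ℝ} (hK : 0 < K) :
    ∃ C : ℝ, 0 ≤ C ∧ ∀ T ε u, X.Flow K T ε u → (∀ t ∈ Icc 0 T, X.NonDegenerate K (u t) t) →
      ∀ t ∈ Icc 0 T, ∀ s ∈ Icc 0 T, t ≤ s →
        ∀ x, |X.weight (u s) s x - X.weight (u t) t x| ≤ C * (s - t) := by
  obtain ⟨Ct, hCt, h₁⟩ := X.exists_time_lip hf K
  obtain ⟨Cp, hCp, h₂⟩ := hr.exists_phase_lip hK
  obtain ⟨B, hB⟩ := X.symb_p.unifLip.bdd K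
  obtain ⟨L, hL, h₃⟩ := X.symb_p.unifLip.lip K
  refine ⟨|B| * (Real.exp K * (Cp * Ct)) + L * (Ct + 1) * Real.exp K, by positivity,
    fun T ε u hu hN t ht s hs hts x => ?_⟩
  rcases hts.eq_or_lt with rfl | hlt
  · simp
  have hst : 0 < s - t := sub_pos.2 hlt
  have hI := Icc_subset_timeInterval hu.le_one
  obtain ⟨e1, e2⟩ := h₁ T ε u hu t ht s hs hts
  have hms := (hu.high s hs).memH
  have hmt := (hu.high t ht).memH
  have hj : ∀ τ ∈ Icc 0 T, ‖jet 4 (u τ) x‖ ≤ K := fun τ hτ =>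
    norm_jet_le hK.le fun j hj => (hu.high τ hτ).le j (by omega) x
  have hp : |X.phase (u s) s x - X.phase (u t) t x| ≤ Cp * (Ct * (s - t)) :=
    h₂ (u s) (u t) s t (Ct * (s - t)) (by positivity) (hu.high s hs) (hu.high t ht)
      (hu.hThreeSq_le s hs) (hu.hThreeSq_le t ht) (hI hs) (hI ht) (hN s hs).inv_le
      (hN t ht).inv_le (by rw [abs_of_pos hst]; nlinarith) e1 e2 x
  have hle : ∀ τ ∈ Icc 0 T, 2 / 3 * X.phase (u τ) τ x ≤ K := fun τ hτ => by
    have := (abs_le.1 ((hN τ hτ).phase_le x)).2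
    linarith
  have hexp := abs_exp_sub_exp_le (hle s hs) (hle t ht)
  have hexp' : |Real.exp (2 / 3 * X.phase (u s) s x) - Real.exp (2 / 3 * X.phase (u t) t x)|
      ≤ Real.exp K * (Cp * Ct) * (s - t) := by
    refine hexp.trans ?_
    rw [← mul_sub, abs_mul, abs_of_pos (by norm_num : (0 : ℝ) < 2 / 3), mul_assoc]
    refine mul_le_mul_of_nonneg_left ?_ (Real.exp_pos K).le
    linarith [abs_nonneg (X.phase (u s) s x - X.phase (u t) t x)]
  have hjet : ‖jet 4 (u s) x - jet 4 (u t) x‖ ≤ Ct * (s - t) :=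
    (pi_norm_le_iff_of_nonneg (by positivity)).2 fun j => by
      simp only [Pi.sub_apply, jet]
      rw [← hms.iteratedDeriv_sub hmt (by omega)]
      exact e1 j (by omega) x
  have hpl : |(|X.p (jet 4 (u s) x) x s| - |X.p (jet 4 (u t) x) x t|)|
      ≤ L * (Ct + 1) * (s - t) := by
    refine (abs_abs_sub_abs_le_abs_sub _ _).trans ((h₃ _ _ (hj s hs) (hj t ht) x x s (hI hs) t
      (hI ht)).trans ?_)
    rw [sub_self, abs_zero, add_zero, abs_of_pos hst, mul_assoc]
    exact mul_le_mul_of_nonneg_left (by linarith) hL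
  have hpB : |X.p (jet 4 (u s) x) x s| ≤ |B| := (hB _ (hj s hs) x s (hI hs)).trans (le_abs_self B)
  calc |X.weight (u s) s x - X.weight (u t) t x|
      = |(|X.p (jet 4 (u s) x) x s| * (Real.exp (2 / 3 * X.phase (u s) s x)
          - Real.exp (2 / 3 * X.phase (u t) t x))
        + (|X.p (jet 4 (u s) x) x s| - |X.p (jet 4 (u t) x) x t|)
          * Real.exp (2 / 3 * X.phase (u t) t x))| := by
        simp only [weight]; congr 1; ring
    _ ≤ |B| * (Real.exp K * (Cp * Ct) * (s - t)) + L * (Ct + 1) * (s - t) * Real.exp K := by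
        refine (abs_add_le _ _).trans (add_le_add ?_ ?_)
        · rw [abs_mul, abs_abs]
          exact mul_le_mul hpB hexp' (abs_nonneg _) (abs_nonneg _)
        · rw [abs_mul, abs_of_pos (Real.exp_pos _)]
          exact mul_le_mul hpl (Real.exp_le_exp.2 (hle t ht)) (Real.exp_pos _).le (by positivity)
    _ = _ := by ring

/-- The energy of the difference of two solutions. -/
noncomputable def energy (u u' : ℝ → ℝ → ℝ) (t : ℝ) : ℝ :=
  (∫ x, iteratedDeriv 0 (u t - u' t) x ^ 2)
    + ∫ x, X.weight (u t) t x * iteratedDeriv 3 (u t - u' t) x ^ 2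

theorem exists_energy_equiv {K : ℝ} (hK : 0 < K) : ∃ C : ℝ, 1 ≤ C ∧
    ∀ u u' t, HighBound K (u t) → HighBound K (u' t) → t ∈ timeInterval →
      X.NonDegenerate K (u t) t → (∀ x, 0 ≤ X.weight (u t) t x ∧ X.weight (u t) t x ≤ C) ∧
      Continuous (X.weight (u t) t) ∧
      hThreeSq (u t - u' t) ≤ C * X.energy u u' t ∧ X.energy u u' t ≤ C * hThreeSq (u t - u' t) := by
  obtain ⟨C, hC, h⟩ := X.exists_weight_derivs hK
  have hC0 : 0 < C := by linarith
  refine ⟨2 * C, by linarith, fun u u' t hu hu' ht hN => ?_⟩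
  obtain ⟨hw, hwc, -⟩ := h (u t) (u' t) t hu hu' ht hN
  have hm := hu.memH.sub hu'.memH
  have hw0 : ∀ x, 0 ≤ X.weight (u t) t x := fun x => (inv_nonneg.2 hC0.le).trans (hw x).1
  have hi := hm.integrable_sq (j := 3) (by norm_num)
  have hiw : Integrable fun x => X.weight (u t) t x * iteratedDeriv 3 (u t - u' t) x ^ 2 :=
    hi.bdd_mul (c := C) hwc.aestronglyMeasurable (ae_of_all _ fun x => by
      rw [Real.norm_of_nonneg (hw0 x)]; exact (hw x).2)
  have h1 : ∫ x, iteratedDeriv 3 (u t - u' t) x ^ 2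
      ≤ C * ∫ x, X.weight (u t) t x * iteratedDeriv 3 (u t - u' t) x ^ 2 := by
    rw [← integral_const_mul]
    refine integral_mono hi (hiw.const_mul C) fun x => ?_
    simp only
    rw [← mul_assoc]
    refine le_mul_of_one_le_left (sq_nonneg _) ?_
    calc (1 : ℝ) = C * C⁻¹ := (mul_inv_cancel₀ hC0.ne').symm
      _ ≤ _ := mul_le_mul_of_nonneg_left (hw x).1 hC0.le
  have h2 : ∫ x, X.weight (u t) t x * iteratedDeriv 3 (u t - u' t) x ^ 2
      ≤ C * ∫ x, iteratedDeriv 3 (u t - u' t) x ^ 2 := by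
    rw [← integral_const_mul]
    exact integral_mono hiw (hi.const_mul C) fun x =>
      mul_le_mul_of_nonneg_right (hw x).2 (sq_nonneg _)
  have n0 : 0 ≤ ∫ x, iteratedDeriv 0 (u t - u' t) x ^ 2 := integral_nonneg fun _ => sq_nonneg _
  have l0 := integral_le_hThreeSq (u t - u' t) (j := 0) (by norm_num)
  have l3 := integral_le_hThreeSq (u t - u' t) (j := 3) le_rfl
  refine ⟨fun x => ⟨hw0 x, by linarith [(hw x).2]⟩, hwc, ?_, ?_⟩
  · refine hm.hThreeSq_le.trans ?_
    simp only [energy]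
    nlinarith
  · simp only [energy]
    nlinarith [mul_le_mul_of_nonneg_left l3 hC0.le, hThreeSq_nonneg (u t - u' t)]

end Expansion

/-! ### Growth of the energy of a difference -/

namespace Expansion

variable {f : (Fin 4 → ℝ) → ℝ → ℝ → ℝ} (X : Expansion f)

theorem neg_diffTotal_add (ε ε' : ℝ≥0) (u u' : ℝ → ℝ → ℝ) (j : ℕ) (t x : ℝ) :
    X.rate ε u j t x - X.rate ε' u' j t x = -X.diffTotal j (u t) (u' t) t x
      + ((ε' : ℝ) * iteratedDeriv (4 + j) (u' t) x - (ε : ℝ) * iteratedDeriv (4 + j) (u t) x) := by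
  simp only [rate, diffTotal]; ring

theorem Flow.visc_sub {X : Expansion f} {K T : ℝ} {ε ε' : ℝ≥0} {u u' : ℝ → ℝ → ℝ}
    (hu : X.Flow K T ε u) (hu' : X.Flow K T ε' u') {t : ℝ} (ht : t ∈ Icc 0 T) {j : ℕ}
    (hj : j ≤ 3) :
    MemLp (fun x => (ε' : ℝ) * iteratedDeriv (4 + j) (u' t) x
      - (ε : ℝ) * iteratedDeriv (4 + j) (u t) x) 2 volume ∧
    ∫ x, ((ε' : ℝ) * iteratedDeriv (4 + j) (u' t) x
      - (ε : ℝ) * iteratedDeriv (4 + j) (u t) x) ^ 2 ≤ 2 * K * ((ε : ℝ) + ε') ^ 2 := by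
  have m := (hu.high t ht).memH.memLp (4 + j) (by omega)
  have m' := (hu'.high t ht).memH.memLp (4 + j) (by omega)
  have hm := (m'.const_mul (ε' : ℝ)).sub (m.const_mul (ε : ℝ))
  refine ⟨hm, ?_⟩
  have i := m.integrable_sq.const_mul (2 * (ε : ℝ) ^ 2)
  have i' := m'.integrable_sq.const_mul (2 * (ε' : ℝ) ^ 2)
  have h : ∫ x, ((ε' : ℝ) * iteratedDeriv (4 + j) (u' t) x
      - (ε : ℝ) * iteratedDeriv (4 + j) (u t) x) ^ 2
      ≤ ∫ x, (2 * (ε : ℝ) ^ 2 * iteratedDeriv (4 + j) (u t) x ^ 2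
        + 2 * (ε' : ℝ) ^ 2 * iteratedDeriv (4 + j) (u' t) x ^ 2) := by
    refine integral_mono hm.integrable_sq (i.add i') fun x => ?_
    simp only
    nlinarith [sq_nonneg ((ε' : ℝ) * iteratedDeriv (4 + j) (u' t) x
      + (ε : ℝ) * iteratedDeriv (4 + j) (u t) x)]
  rw [integral_add i i', integral_const_mul, integral_const_mul] at h
  have k := mul_le_mul_of_nonneg_left (hu.sq_le t ht (4 + j) (by omega))
    (by positivity : 0 ≤ 2 * (ε : ℝ) ^ 2)
  have k' := mul_le_mul_of_nonneg_left (hu'.sq_le t ht (4 + j) (by omega))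
    (by positivity : 0 ≤ 2 * (ε' : ℝ) ^ 2)
  have hK : 0 ≤ K := (hThreeSq_nonneg _).trans (hu.hThreeSq_le t ht)
  have : 0 ≤ K * ((ε : ℝ) * ε') := by positivity
  nlinarith

/-- The difference of two flows in the energy space, with bounds that depend only on `K`. -/
theorem exists_diff_bound (hf : ConditionA3 f) {K : ℝ} (hK : 0 < K) : ∃ C : ℝ, 1 ≤ C ∧
    ∀ T ε ε' u u', X.Flow K T ε u → X.Flow K T ε' u' →
      (∀ j ≤ 3, ∀ t ∈ Icc 0 T, MemLp (fun x => X.rate ε u j t x - X.rate ε' u' j t x) 2 volume ∧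
        (∫ x, iteratedDeriv j (u t - u' t) x ^ 2)
          + ∫ x, (X.rate ε u j t x - X.rate ε' u' j t x) ^ 2 ≤ C) ∧
      ∀ t ∈ Icc 0 T, hThreeSq (u t - u' t) ≤ C ∧ ∀ s ∈ Icc 0 T, t ≤ s →
        hThreeSq (u s - u' s) ≤ 2 * hThreeSq (u t - u' t) + C * (s - t) := by
  obtain ⟨Cr, hCr, h₁⟩ := X.exists_rate_bound hf K
  obtain ⟨Ct, hCt, h₂⟩ := X.exists_time_lip hf K
  refine ⟨4 * K + 4 * Cr + 8 * Ct ^ 2, by nlinarith, fun T ε ε' u u' hu hu' => ?_⟩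
  have hH : ∀ t ∈ Icc 0 T, hThreeSq (u t - u' t) ≤ 4 * K := fun t ht => by
    have := hThreeSq_sub_le (hu.high t ht).memH (hu'.high t ht).memH
    have := hu.hThreeSq_le t ht
    have := hu'.hThreeSq_le t ht
    linarith
  refine ⟨fun j hj t ht => ?_, fun t ht => ⟨(hH t ht).trans (by nlinarith), fun s hs hts => ?_⟩⟩
  · obtain ⟨-, m, b⟩ := h₁ T ε u hu j hj t ht
    obtain ⟨-, m', b'⟩ := h₁ T ε' u' hu' j hj t ht
    have hm := m.sub m'
    refine ⟨hm, ?_⟩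
    have h : ∫ x, (X.rate ε u j t x - X.rate ε' u' j t x) ^ 2
        ≤ ∫ x, (2 * X.rate ε u j t x ^ 2 + 2 * X.rate ε' u' j t x ^ 2) := by
      refine integral_mono hm.integrable_sq ((m.integrable_sq.const_mul 2).add
        (m'.integrable_sq.const_mul 2)) fun x => ?_
      simp only
      nlinarith [sq_nonneg (X.rate ε u j t x + X.rate ε' u' j t x)]
    rw [integral_add (m.integrable_sq.const_mul 2) (m'.integrable_sq.const_mul 2),
      integral_const_mul, integral_const_mul] at h
    have := (integral_le_hThreeSq (u t - u' t) hj).trans (hH t ht)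
    nlinarith [sq_nonneg Ct]
  · have ms := (hu.high s hs).memH
    have ms' := (hu'.high s hs).memH
    have mt := (hu.high t ht).memH
    have mt' := (hu'.high t ht).memH
    have e1 := hThreeSq_le_sub_add (ms.sub ms') (mt.sub mt')
    -- The increment of w is bounded by the separate increments of u and u'. Their squares are O((s
    -- - t)²), hence O(s - t) because the times lie in an interval of length at most one.
    have e2 : u s - u' s - (u t - u' t) = (u s - u t) - (u' s - u' t) := by abel
    have e3 := hThreeSq_sub_le (ms.sub mt) (ms'.sub mt')
    have e4 := (h₂ T ε u hu t ht s hs hts).2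
    have e5 := (h₂ T ε' u' hu' t ht s hs hts).2
    rw [e2] at e1
    have e6 : 0 ≤ s - t := sub_nonneg.2 hts
    have e7 : s - t ≤ 1 := by linarith [hs.2, ht.1, hu.le_one]
    have e8 : (s - t) ^ 2 ≤ s - t := by nlinarith
    have e9 : Ct ^ 2 * (s - t) ^ 2 ≤ Ct ^ 2 * (s - t) :=
      mul_le_mul_of_nonneg_left e8 (sq_nonneg _)
    have e10 : 0 ≤ (K + Cr) * (s - t) := by positivity
    nlinarith

/-- The weight is frozen at time t. Its change over [t, s] costs O(s - t) times the squared H^3 norm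
of w(s), and thawing it inside the time integral, where the cancellation needs the weight of time τ,
costs O((s - t)²) in total. -/
theorem exists_energy_growth {gD : (Fin 3 → ℝ) → ℝ → ℝ → ℝ} {gH : (Fin 4 → ℝ) → ℝ → ℝ → ℝ}
    (hf : ConditionA3 f) (hr : RatioStructure gD gH X.p X.r) {K : ℝ} (hK : 0 < K) :
    ∃ C : ℝ, 0 ≤ C ∧ ∀ T ε ε' u u', X.Flow K T ε u → X.Flow K T ε' u' →
      (∀ t ∈ Icc 0 T, X.NonDegenerate K (u t) t) →
      ∀ t ∈ Icc 0 T, ∀ s ∈ Icc 0 T, t ≤ s →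
        |X.energy u u' s - X.energy u u' t| ≤ C * (s - t) ∧
        X.energy u u' s - X.energy u u' t
          ≤ (s - t) * (C * X.energy u u' t + C * ((ε : ℝ) + ε') ^ 2) + C * (s - t) ^ 2 := by
  obtain ⟨Lw, hLw, hlip⟩ := X.exists_weight_lip hf hr hK
  obtain ⟨Cw, hCw, hequiv⟩ := X.exists_energy_equiv hK
  obtain ⟨Ce, hCe, henergy⟩ := X.exists_energy_bound hK
  obtain ⟨B, hB, hdiff⟩ := X.exists_diff_bound hf hK
  have hCw0 : 0 ≤ Cw := by linarith
  have hB0 : 0 ≤ B := by linarith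
  refine ⟨B + (Lw + Cw) * B + (2 * (Lw + Ce) * Cw + 4 * K * Ce + (2 * Lw + Ce) * B), by positivity,
    fun T ε ε' u u' hu hu' hN t ht s hs hts => ?_⟩
  obtain ⟨hd, hH⟩ := hdiff T ε ε' u u' hu hu'
  have hI := Icc_subset_timeInterval hu.le_one
  have hsub : Icc t s ⊆ Icc 0 T := Icc_subset_Icc ht.1 hs.2
  have hst : 0 ≤ s - t := sub_nonneg.2 hts
  have hE := fun τ (hτ : τ ∈ Icc 0 T) =>
    hequiv u u' τ (hu.high τ hτ) (hu'.high τ hτ) (hI hτ) (hN τ hτ)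
  have hm := fun τ (hτ : τ ∈ Icc 0 T) => (hu.high τ hτ).memH.sub (hu'.high τ hτ).memH
  have hiter : ∀ j ≤ 3, ∀ τ ∈ Icc 0 T, ∀ x, iteratedDeriv j (u τ - u' τ) x
      = iteratedDeriv j (u τ) x - iteratedDeriv j (u' τ) x := fun j hj τ hτ x =>
    (hu.high τ hτ).memH.iteratedDeriv_sub (hu'.high τ hτ).memH (by omega) x
  set a : ℕ → ℝ → ℝ → ℝ := fun j τ x => iteratedDeriv j (u τ - u' τ) x with ha
  set ρ : ℕ → ℝ → ℝ → ℝ := fun j τ x => X.rate ε u j τ x - X.rate ε' u' j τ x with hρ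
  have dv : ∀ j ≤ 3, ∀ τ ∈ Icc 0 T, ∀ x,
      HasDerivWithinAt (fun σ => a j σ x) (ρ j τ x) (Icc 0 T) τ := fun j hj τ hτ x =>
    ((hu.deriv j hj τ hτ x).sub (hu'.deriv j hj τ hτ x)).congr
      (fun σ hσ => hiter j hj σ hσ x) (hiter j hj τ hτ x)
  have ca : ∀ j ≤ 3, ContinuousOn (fun p : ℝ × ℝ => a j p.1 p.2) (Icc 0 T ×ˢ univ) := fun j hj =>
    ((hu.cont j (by omega)).sub (hu'.cont j (by omega))).congr
      fun p hp => hiter j hj p.1 hp.1 p.2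
  have cρ : ∀ j ≤ 3, ContinuousOn (fun p : ℝ × ℝ => ρ j p.1 p.2) (Icc 0 T ×ˢ univ) := fun j hj =>
    (hu.cont_rate j hj).sub (hu'.cont_rate j hj)
  have ma : ∀ j ≤ 3, ∀ τ ∈ Icc 0 T, MemLp (a j τ) 2 volume := fun j hj τ hτ =>
    (hm τ hτ).memLp j (by omega)
  have hw1 : ∀ τ ∈ Icc 0 T, ∀ x, |X.weight (u τ) τ x| ≤ Cw := fun τ hτ x => by
    rw [abs_of_nonneg ((hE τ hτ).1 x).1]; exact ((hE τ hτ).1 x).2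
  obtain ⟨i0, ii0⟩ := integral_mul_sq_sub (φ := fun _ => 1) (D := 1) ht hs hts continuous_const
    (fun _ => by simp) (dv 0 (by norm_num)) (ca 0 (by norm_num)) (cρ 0 (by norm_num))
    (ma 0 (by norm_num)) (fun τ hτ => (hd 0 (by norm_num) τ hτ).1)
    (fun τ hτ => (hd 0 (by norm_num) τ hτ).2)
  obtain ⟨i3, ii3⟩ := integral_mul_sq_sub (φ := X.weight (u t) t) (D := Cw) ht hs hts
    (hE t ht).2.1 (hw1 t ht) (dv 3 le_rfl) (ca 3 le_rfl) (cρ 3 le_rfl)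
    (ma 3 le_rfl) (fun τ hτ => (hd 3 le_rfl τ hτ).1) (fun τ hτ => (hd 3 le_rfl τ hτ).2)
  simp only [one_mul] at i0 ii0
  set φ : ℝ → ℝ → ℝ := fun τ => X.weight (u τ) τ with hφ
  have b0 : ∀ τ ∈ Icc 0 T, |∫ x, 2 * (a 0 τ x * ρ 0 τ x)| ≤ B := fun τ hτ => by
    have := (integral_abs_mul_le (φ := fun _ => 1) (D := 1) continuous_const (fun _ => by simp)
      (ma 0 (by norm_num) τ hτ) (hd 0 (by norm_num) τ hτ).1).2
    simp only [one_mul] at this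
    exact (abs_integral_le_integral_abs).trans (this.trans (hd 0 (by norm_num) τ hτ).2)
  have b3 : ∀ τ ∈ Icc 0 T, |∫ x, φ t x * (2 * (a 3 τ x * ρ 3 τ x))| ≤ Cw * B := fun τ hτ =>
    (abs_integral_le_integral_abs).trans ((integral_abs_mul_le (hE t ht).2.1 (hw1 t ht)
      (ma 3 le_rfl τ hτ) (hd 3 le_rfl τ hτ).1).2.trans
        (mul_le_mul_of_nonneg_left (hd 3 le_rfl τ hτ).2 hCw0))
  have hwi : ∀ τ ∈ Icc 0 T, ∀ σ ∈ Icc 0 T, Integrable fun x => φ τ x * a 3 σ x ^ 2 :=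
    fun τ hτ σ hσ => (ma 3 le_rfl σ hσ).integrable_sq.bdd_mul (hE τ hτ).2.1.aestronglyMeasurable
      (ae_of_all _ (hw1 τ hτ))
  have hsplit : X.energy u u' s - X.energy u u' t = (∫ x, (φ s x - φ t x) * a 3 s x ^ 2)
      + ∫ τ in t..s, ((∫ x, 2 * (a 0 τ x * ρ 0 τ x))
        + ∫ x, φ t x * (2 * (a 3 τ x * ρ 3 τ x))) := by
    rw [intervalIntegral.integral_add ii0 ii3, ← i0, ← i3]
    simp only [sub_mul]
    rw [integral_sub (hwi s hs s hs) (hwi t ht s hs)]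
    simp only [energy, ha, hφ]
    ring
  have hfirst : |∫ x, (φ s x - φ t x) * a 3 s x ^ 2|
      ≤ Lw * (s - t) * hThreeSq (u s - u' s) := by
    refine (abs_integral_le_integral_abs).trans ?_
    refine le_trans (b := Lw * (s - t) * ∫ x, a 3 s x ^ 2) ?_
      (mul_le_mul_of_nonneg_left (integral_le_hThreeSq _ le_rfl) (by positivity))
    rw [← integral_const_mul]
    refine integral_mono (g := fun x => Lw * (s - t) * a 3 s x ^ 2) ?_
      ((ma 3 le_rfl s hs).integrable_sq.const_mul _) fun x => ?_
    · simp only [sub_mul]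
      exact ((hwi s hs s hs).sub (hwi t ht s hs)).abs
    · simp only [abs_mul, abs_of_nonneg (sq_nonneg (a 3 s x))]
      exact mul_le_mul_of_nonneg_right (hlip T ε u hu hN t ht s hs hts x) (sq_nonneg _)
  constructor
  · rw [hsplit]
    have e1 := hfirst.trans (mul_le_mul_of_nonneg_left (hH s hs).1 (by positivity))
    have e2 := intervalIntegral.norm_integral_le_of_norm_le_const (a := t) (b := s)
      (C := B + Cw * B)
      (f := fun τ => (∫ x, 2 * (a 0 τ x * ρ 0 τ x)) + ∫ x, φ t x * (2 * (a 3 τ x * ρ 3 τ x)))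
      fun τ hτ => by
        rw [uIoc_of_le hts] at hτ
        have hτT := hsub (Ioc_subset_Icc_self hτ)
        exact (abs_add_le _ _).trans (add_le_add (b0 τ hτT) (b3 τ hτT))
    rw [Real.norm_eq_abs, abs_of_nonneg hst] at e2
    refine (abs_add_le _ _).trans ((add_le_add e1 e2).trans ?_)
    have : 0 ≤ (2 * (Lw + Ce) * Cw + 4 * K * Ce + (2 * Lw + Ce) * B) * (s - t) := by positivity
    nlinarith
  · have hpt : ∀ τ ∈ Icc t s, (∫ x, 2 * (a 0 τ x * ρ 0 τ x))
        + ∫ x, φ t x * (2 * (a 3 τ x * ρ 3 τ x))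
        ≤ Ce * (2 * hThreeSq (u t - u' t) + B * (s - t) + 4 * K * ((ε : ℝ) + ε') ^ 2)
          + Lw * (s - t) * B := by
      intro τ hτ
      have hτT := hsub hτ
      obtain ⟨m₀, n₀⟩ := hu.visc_sub hu' hτT (j := 0) (by norm_num)
      obtain ⟨m₃, n₃⟩ := hu.visc_sub hu' hτT (j := 3) le_rfl
      have k1 := henergy (u τ) (u' τ) τ (hu.high τ hτT) (hu'.high τ hτT) (hI hτT) (hN τ hτT)
        _ _ m₀ m₃
      simp only [← X.neg_diffTotal_add ε ε' u u'] at k1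
      have j0 := (integral_abs_mul_le (φ := fun _ => 1) (D := 1) continuous_const (fun _ => by simp)
        (ma 0 (by norm_num) τ hτT) (hd 0 (by norm_num) τ hτT).1).1
      simp only [one_mul] at j0
      have j3 := fun σ (hσ : σ ∈ Icc 0 T) => (integral_abs_mul_le (hE σ hσ).2.1 (hw1 σ hσ)
        (ma 3 le_rfl τ hτT) (hd 3 le_rfl τ hτT).1).1
      have k2 : (∫ x, 2 * (a 0 τ x * ρ 0 τ x)) + ∫ x, φ τ x * (2 * (a 3 τ x * ρ 3 τ x))
          ≤ Ce * (hThreeSq (u τ - u' τ) + 2 * K * ((ε : ℝ) + ε') ^ 2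
            + 2 * K * ((ε : ℝ) + ε') ^ 2) := by
        rw [← integral_add j0 (j3 τ hτT)]
        exact k1.trans (mul_le_mul_of_nonneg_left (by linarith) hCe)
      have hlip' : ∀ x, |φ t x - φ τ x| ≤ Lw * (s - t) := fun x => by
        rw [abs_sub_comm]
        exact (hlip T ε u hu hN t ht τ hτT hτ.1 x).trans
          (mul_le_mul_of_nonneg_left (by linarith [hτ.2]) hLw)
      -- Passing from the weight at time τ, to which the energy bound applies, back to the frozen
      -- one at time t.
      have k3 : |∫ x, (φ t x - φ τ x) * (2 * (a 3 τ x * ρ 3 τ x))| ≤ Lw * (s - t) * B :=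
        (abs_integral_le_integral_abs).trans ((integral_abs_mul_le
          ((hE t ht).2.1.sub (hE τ hτT).2.1) hlip'
          (ma 3 le_rfl τ hτT) (hd 3 le_rfl τ hτT).1).2.trans
          (mul_le_mul_of_nonneg_left (hd 3 le_rfl τ hτT).2 (by positivity)))
      have k4 : ∫ x, (φ t x - φ τ x) * (2 * (a 3 τ x * ρ 3 τ x))
          = (∫ x, φ t x * (2 * (a 3 τ x * ρ 3 τ x)))
            - ∫ x, φ τ x * (2 * (a 3 τ x * ρ 3 τ x)) := by
        simp only [sub_mul]
        exact integral_sub (j3 t ht) (j3 τ hτT)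
      have k5 := (le_abs_self _).trans k3
      rw [k4] at k5
      have k6 : hThreeSq (u τ - u' τ) ≤ 2 * hThreeSq (u t - u' t) + B * (s - t) :=
        ((hH t ht).2 τ hτT hτ.1).trans (by nlinarith [hτ.2])
      nlinarith [mul_le_mul_of_nonneg_left k6 hCe]
    have hint : ∫ τ in t..s, ((∫ x, 2 * (a 0 τ x * ρ 0 τ x))
        + ∫ x, φ t x * (2 * (a 3 τ x * ρ 3 τ x)))
        ≤ (s - t) * (Ce * (2 * hThreeSq (u t - u' t) + B * (s - t) + 4 * K * ((ε : ℝ) + ε') ^ 2)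
          + Lw * (s - t) * B) := by
      refine (intervalIntegral.integral_mono_on hts (ii0.add ii3) intervalIntegrable_const
        hpt).trans (le_of_eq ?_)
      rw [intervalIntegral.integral_const, smul_eq_mul]
    have e1 := (le_abs_self _).trans hfirst
    have e2 := (hH t ht).2 s hs hts
    have e3 := (hE t ht).2.2.1
    have e0 : 0 ≤ X.energy u u' t := by
      have := (hThreeSq_nonneg _).trans e3
      exact nonneg_of_mul_nonneg_right this (by linarith)
    rw [hsplit]
    have e4 : Lw * (s - t) * hThreeSq (u s - u' s)
        ≤ Lw * (s - t) * (2 * (Cw * X.energy u u' t) + B * (s - t)) :=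
      mul_le_mul_of_nonneg_left (by linarith) (by positivity)
    have e5 : (s - t) * Ce * hThreeSq (u t - u' t) ≤ (s - t) * Ce * (Cw * X.energy u u' t) :=
      mul_le_mul_of_nonneg_left e3 (by positivity)
    set D := (ε : ℝ) + ε' with hD
    have p1 : 0 ≤ (s - t) * ((B + (Lw + Cw) * B + 4 * K * Ce + (2 * Lw + Ce) * B)
      * X.energy u u' t) := by positivity
    have p2 : 0 ≤ (s - t) * ((B + (Lw + Cw) * B + 2 * (Lw + Ce) * Cw + (2 * Lw + Ce) * B) * D ^ 2) := by
      positivity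
    have p3 : 0 ≤ (B + (Lw + Cw) * B + (2 * (Lw + Ce) * Cw + 4 * K * Ce)) * (s - t) ^ 2 := by
      positivity
    linarith

end Expansion

/-- Grönwall's inequality for E + D: after division by s - t the quadratic error vanishes in the
limit, so difference quotients from the right are eventually below any r > A (E + D). The Lipschitz
bound is used only for continuity. -/
theorem le_exp_mul_of_growth {T A B D : ℝ} {E : ℝ → ℝ} (hA : 0 ≤ A) (hD : 0 ≤ D)
    (hlip : ∀ t ∈ Icc 0 T, ∀ s ∈ Icc 0 T, t ≤ s → |E s - E t| ≤ B * (s - t))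
    (hgrow : ∀ t ∈ Icc 0 T, ∀ s ∈ Icc 0 T, t ≤ s →
      E s - E t ≤ (s - t) * (A * E t + A * D) + B * (s - t) ^ 2)
    (h0 : 0 ≤ E 0) {t : ℝ} (ht : t ∈ Icc 0 T) (hT : T ≤ 1) :
    E t ≤ Real.exp A * (E 0 + D) := by
  have h0T : (0 : ℝ) ∈ Icc 0 T := ⟨le_rfl, ht.1.trans ht.2⟩
  have hcont : ContinuousOn E (Icc 0 T) := by
    have hB : 0 ≤ |B| := abs_nonneg B
    refine (LipschitzOnWith.of_dist_le_mul (K := ⟨|B|, hB⟩) fun x hx y hy => ?_).continuousOn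
    rw [Real.dist_eq, Real.dist_eq]
    change |E x - E y| ≤ |B| * |x - y|
    rcases le_total x y with h | h
    · rw [abs_sub_comm, abs_sub_comm x]
      refine (hlip x hx y hy h).trans ?_
      rw [abs_of_nonneg (sub_nonneg.2 h)]
      exact mul_le_mul_of_nonneg_right (le_abs_self B) (sub_nonneg.2 h)
    · refine (hlip y hy x hx h).trans ?_
      rw [abs_of_nonneg (sub_nonneg.2 h)]
      exact mul_le_mul_of_nonneg_right (le_abs_self B) (sub_nonneg.2 h)
  have hg := le_gronwallBound_of_liminf_deriv_right_le (f := fun t => E t + D) (δ := E 0 + D)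
    (K := A) (ε := 0) (f' := fun t => A * (E t + D)) (hcont.add continuousOn_const)
    (fun x hx r hr => ?_) le_rfl (fun x _ => (add_zero _).ge) t ht
  · rw [gronwallBound_ε0, sub_zero, mul_comm] at hg
    have h1 : Real.exp (A * t) ≤ Real.exp A :=
      Real.exp_le_exp.2 (mul_le_of_le_one_right hA (ht.2.trans hT))
    have := mul_le_mul_of_nonneg_right h1 (by linarith : 0 ≤ E 0 + D)
    linarith
  · refine Eventually.frequently ?_
    have hlim : Tendsto (fun z => A * (E x + D) + B * (z - x)) (𝓝[>] x)
        (𝓝 (A * (E x + D) + B * (x - x))) :=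
      ((continuous_const.add (continuous_const.mul (continuous_id.sub continuous_const))).tendsto
        x).mono_left nhdsWithin_le_nhds
    rw [sub_self, mul_zero, add_zero] at hlim
    filter_upwards [hlim.eventually (gt_mem_nhds hr), Ioo_mem_nhdsGT hx.2] with z hz hzx
    have hzx' : 0 < z - x := sub_pos.2 hzx.1
    refine lt_of_le_of_lt ?_ hz
    rw [inv_mul_le_iff₀ hzx']
    have := hgrow x ⟨hx.1, hx.2.le⟩ z ⟨hx.1.trans hzx.1.le, hzx.2.le⟩ hzx.1.le
    linarith

/-! ### The closed estimate in H^3 -/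

namespace Expansion

variable {f : (Fin 4 → ℝ) → ℝ → ℝ → ℝ} (X : Expansion f)

theorem exists_hThreeSq_growth {gD : (Fin 3 → ℝ) → ℝ → ℝ → ℝ} {gH : (Fin 4 → ℝ) → ℝ → ℝ → ℝ}
    (hf : ConditionA3 f) (hr : RatioStructure gD gH X.p X.r) {K : ℝ} (hK : 0 < K) :
    ∃ C : ℝ, 0 ≤ C ∧ ∀ T ε ε' u u', X.Flow K T ε u → X.Flow K T ε' u' →
      (∀ t ∈ Icc 0 T, X.NonDegenerate K (u t) t) →
      ∀ t ∈ Icc 0 T, hThreeSq (u t - u' t) ≤ C * (hThreeSq (u 0 - u' 0) + ((ε : ℝ) + ε') ^ 2) := by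
  obtain ⟨A, hA, hgrow⟩ := X.exists_energy_growth hf hr hK
  obtain ⟨B, hB, hequiv⟩ := X.exists_energy_equiv hK
  have hB0 : 0 ≤ B := by linarith
  refine ⟨B * (Real.exp A * B), by positivity, fun T ε ε' u u' hu hu' hN t ht => ?_⟩
  have hI := Icc_subset_timeInterval hu.le_one
  have hE := fun τ (hτ : τ ∈ Icc 0 T) =>
    (hequiv u u' τ (hu.high τ hτ) (hu'.high τ hτ) (hI hτ) (hN τ hτ)).2.2
  have h0 : (0 : ℝ) ∈ Icc 0 T := ⟨le_rfl, ht.1.trans ht.2⟩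
  have e0 : 0 ≤ X.energy u u' 0 :=
    nonneg_of_mul_nonneg_right ((hThreeSq_nonneg _).trans (hE 0 h0).1) (by linarith)
  have h1 := le_exp_mul_of_growth hA (sq_nonneg ((ε : ℝ) + ε'))
    (fun t ht s hs hts => (hgrow T ε ε' u u' hu hu' hN t ht s hs hts).1)
    (fun t ht s hs hts => (hgrow T ε ε' u u' hu hu' hN t ht s hs hts).2) e0 ht hu.le_one
  have h2 : X.energy u u' 0 + ((ε : ℝ) + ε') ^ 2
      ≤ B * (hThreeSq (u 0 - u' 0) + ((ε : ℝ) + ε') ^ 2) := by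
    nlinarith [(hE 0 h0).2, sq_nonneg ((ε : ℝ) + ε')]
  calc _ ≤ B * X.energy u u' t := (hE t ht).1
    _ ≤ B * (Real.exp A * (B * (hThreeSq (u 0 - u' 0) + ((ε : ℝ) + ε') ^ 2))) :=
      mul_le_mul_of_nonneg_left (h1.trans (mul_le_mul_of_nonneg_left h2 (Real.exp_pos A).le)) hB0
    _ = _ := by ring

/-- The essential supremum gives the lower bound almost everywhere; the set where it holds is closed
by continuity and dense, hence everything. -/
theorem inv_le_of_dispersion_le {t N : ℝ} {v : ℝ → ℝ} (hv : MemH 7 v) (ht : t ∈ timeInterval)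
    (hN : 0 < N) (h : dispersion f t v ≤ ENNReal.ofReal N) (x : ℝ) :
    N⁻¹ ≤ |X.p (jet 4 v x) x t| := by
  have hae : ∀ᵐ x, N⁻¹ ≤ |X.p (jet 4 v x) x t| := by
    filter_upwards [ENNReal.ae_le_essSup fun x => ‖partialZ 3 f (jet 4 v x) x t‖ₑ⁻¹] with x hx
    have h1 := hx.trans h
    rw [X.partial_p _ _ _ ht, ENNReal.inv_le_iff_inv_le, ← ENNReal.ofReal_inv_of_pos hN,
      Real.enorm_eq_ofReal_abs, ENNReal.ofReal_le_ofReal_iff (abs_nonneg _)] at h1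
    exact h1
  have hc : Continuous fun x => |X.p (jet 4 v x) x t| :=
    (continuous_iff_continuousAt.2 fun x =>
      (X.deriv_p t ht v (hv.mono (l := 5) (by norm_num)).contDiff x).continuousAt).abs
  have hclosed : IsClosed {x | N⁻¹ ≤ |X.p (jet 4 v x) x t|} := isClosed_le continuous_const hc
  have hdense : Dense {x | N⁻¹ ≤ |X.p (jet 4 v x) x t|} := Measure.dense_of_ae hae
  exact (hclosed.closure_eq.subset (hdense x) :)

end Expansion

/-- The difference of two solutions with bounded norms, one of them non-degenerate, is
controlled in `H^3` by the initial difference and by the regularization parameters. -/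
theorem exists_hThreeSq_sub_le {f : (Fin 4 → ℝ) → ℝ → ℝ → ℝ} (hA1 : ConditionA1 f)
    (hA2 : ConditionA2 f) (hA3 : ConditionA3 f) {N : ℝ} (hN : 0 < N) : ∃ C : ℝ, 0 ≤ C ∧
    ∀ T ≤ 1, ∀ (ε ε' : ℝ≥0) (u₀ u₀' : ℝ → ℝ) (u u' : ℝ → ℝ → ℝ),
      IsSolution f ε T u₀ u → IsSolution f ε' T u₀' u' →
      (∀ t ∈ Icc 0 T, hNorm 7 (u t) ≤ ENNReal.ofReal N) →
      (∀ t ∈ Icc 0 T, hNorm 7 (u' t) ≤ ENNReal.ofReal N) →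
      (ε ≠ 0 → ∀ t ∈ Icc 0 T, ε * hNorm 8 (u t) ≤ ENNReal.ofReal N) →
      (ε' ≠ 0 → ∀ t ∈ Icc 0 T, ε' * hNorm 8 (u' t) ≤ ENNReal.ofReal N) →
      (∀ t ∈ Icc 0 T, dispersion f t (u t) ≤ ENNReal.ofReal N) →
      ∀ t ∈ Icc 0 T, hThreeSq (u t - u' t)
        ≤ C * (hThreeSq (u₀ - u₀') + ((ε : ℝ) + ε') ^ 2) := by
  obtain ⟨X⟩ := hA1.nonempty_expansion
  obtain ⟨gD, gH, hr⟩ := hA2.exists_ratioStructure X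
  have hL : 0 < 2 * N + 4 * N ^ 2 := by positivity
  have hNL : N ≤ 2 * N + 4 * N ^ 2 := by nlinarith [sq_nonneg N]
  set L := 2 * N + 4 * N ^ 2
  -- The phase bound P depends on L, so non-degeneracy is first stated at level L and the final
  -- estimate uses max L P.
  obtain ⟨P, -, hP⟩ := hr.exists_phase_bound hL
  have hLK : L ≤ max L P := le_max_left _ _
  obtain ⟨C, hC, h⟩ := X.exists_hThreeSq_growth hA3 hr (lt_max_of_lt_left hL : 0 < max L P)
  refine ⟨C, hC, fun T hT ε ε' u₀ u₀' u u' hu hu' h7 h7' h8 h8' hd t ht => ?_⟩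
  have hfl := X.flow_of_isSolution hu hT hN h7 h8
  have hfl' := X.flow_of_isSolution hu' hT hN h7' h8'
  have hI := Icc_subset_timeInterval hT
  have hlow : ∀ τ ∈ Icc 0 T, ∀ x, L⁻¹ ≤ |X.p (jet 4 (u τ) x) x τ| := fun τ hτ x =>
    (inv_anti₀ hN hNL).trans
      (X.inv_le_of_dispersion_le (hfl.high τ hτ).memH (hI hτ) hN (hd τ hτ) x)
  have := h T ε ε' u u' (hfl.mono hLK) (hfl'.mono hLK) (fun τ hτ =>
    ⟨fun x => (inv_anti₀ hL hLK).trans (hlow τ hτ x),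
      fun x => (hP (u τ) τ (hfl.high τ hτ) (hfl.hThreeSq_le τ hτ) (hI hτ) (hlow τ hτ) x).trans
        (le_max_right _ _)⟩) t ht
  rwa [hu.initial, hu'.initial] at this

theorem MemH.hNorm_three_eq {k : ℕ} {w : ℝ → ℝ} (hw : MemH k w) (hk : 3 ≤ k) :
    hNorm 3 w = ENNReal.ofReal √(hThreeSq w) :=
  (hw.mono hk).hNorm_eq

theorem hNorm_three_le {C δ : ℝ} {w w₀ : ℝ → ℝ} (hw : MemH 7 w) (hw₀ : MemH 7 w₀) (hC : 0 ≤ C)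
    (hδ : 0 ≤ δ) (h : hThreeSq w ≤ C * (hThreeSq w₀ + δ ^ 2)) :
    hNorm 3 w ≤ ENNReal.ofReal √C * (hNorm 3 w₀ + ENNReal.ofReal δ) := by
  rw [hw.hNorm_three_eq (by norm_num), hw₀.hNorm_three_eq (by norm_num),
    ← ENNReal.ofReal_add (Real.sqrt_nonneg _) hδ, ← ENNReal.ofReal_mul (Real.sqrt_nonneg _)]
  refine ENNReal.ofReal_le_ofReal ((Real.sqrt_le_sqrt h).trans ?_)
  rw [Real.sqrt_mul hC]
  refine mul_le_mul_of_nonneg_left ?_ (Real.sqrt_nonneg _)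
  rw [Real.sqrt_le_left (by positivity)]
  have h1 := Real.sq_sqrt (hThreeSq_nonneg w₀)
  have h2 := Real.sqrt_nonneg (hThreeSq w₀)
  nlinarith [mul_nonneg h2 hδ]

/-- Continuity gives a bound near each time, and compactness of [0,T] a common one. Uniqueness needs
it because no bound on the norms is assumed there. -/
theorem MemCH.exists_hNorm_le {k : ℕ} {T : ℝ} {u : ℝ → ℝ → ℝ} (hu : MemCH k T u) :
    ∃ N : ℝ, ∀ t ∈ Icc 0 T, hNorm k (u t) ≤ ENNReal.ofReal N := by
  suffices h : ∃ N : ℝ, ∀ t ∈ Icc 0 T, t ∈ Icc 0 T → hNorm k (u t) ≤ ENNReal.ofReal N by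
    obtain ⟨N, hN⟩ := h
    exact ⟨N, fun t ht => hN t ht ht⟩
  refine isCompact_Icc.induction_on (p := fun S => ∃ N : ℝ, ∀ t ∈ S, t ∈ Icc 0 T →
    hNorm k (u t) ≤ ENNReal.ofReal N) ⟨0, by simp⟩ ?_ ?_ fun t ht => ?_
  · rintro S S' hS ⟨N, hN⟩
    exact ⟨N, fun t ht => hN t (hS ht)⟩
  · rintro S S' ⟨N, hN⟩ ⟨N', hN'⟩
    refine ⟨max N N', fun t ht htT => ?_⟩
    rcases ht with ht | ht
    · exact (hN t ht htT).trans (ENNReal.ofReal_le_ofReal (le_max_left _ _))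
    · exact (hN' t ht htT).trans (ENNReal.ofReal_le_ofReal (le_max_right _ _))
  · have h1 : ∀ᶠ s in 𝓝[Icc 0 T] t, hNorm k (u s - u t) < ENNReal.ofReal 1 :=
      (hu.tendsto t ht).eventually (gt_mem_nhds (by simp))
    refine ⟨_, h1, √(2 * (∑ j ∈ Finset.range (k + 1), ∫ x, iteratedDeriv j (u t) x ^ 2)
      + 2 * (k + 1 : ℕ)), fun s hs hsT => ?_⟩
    have ms := hu.memH s hsT
    have mt := hu.memH t ht
    rw [ms.hNorm_eq]
    refine ENNReal.ofReal_le_ofReal (Real.sqrt_le_sqrt ?_)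
    rw [Finset.mul_sum]
    have : (2 * (k + 1 : ℕ) : ℝ) = ∑ j ∈ Finset.range (k + 1), (2 : ℝ) := by simp [mul_comm]
    rw [this, ← Finset.sum_add_distrib]
    refine Finset.sum_le_sum fun j hj => ?_
    have hjk : j ≤ k := Nat.lt_succ_iff.1 (Finset.mem_range.1 hj)
    have hd := (ms.sub mt).integral_sq_le zero_le_one (le_of_lt hs) hjk
    have it := (mt.integrable_sq hjk).const_mul 2
    have id := ((ms.sub mt).integrable_sq hjk).const_mul 2
    have h2 : ∫ x, iteratedDeriv j (u s) x ^ 2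
        ≤ ∫ x, (2 * iteratedDeriv j (u t) x ^ 2 + 2 * iteratedDeriv j (u s - u t) x ^ 2) := by
      refine integral_mono_ae (ms.integrable_sq hjk) (it.add id) ?_
      filter_upwards [ms.ae_iteratedDeriv_sub mt hjk] with x hx
      simp only [hx, Pi.sub_apply]
      nlinarith [sq_nonneg (2 * iteratedDeriv j (u t) x - iteratedDeriv j (u s) x)]
    rw [integral_add it id, integral_const_mul, integral_const_mul] at h2
    linarith

end DispersiveFlow

/-! ### The proposition -/

open DispersiveFlow in
theorem proposition6p1 (f : (Fin 4 → ℝ) → ℝ → ℝ → ℝ)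
    (hA1 : ConditionA1 f) (hA2 : ConditionA2 f) (hA3 : ConditionA3 f) :
    (∃ (C : ℝ≥0 → ℝ≥0) (T₁ : ℝ≥0 → ℝ), Monotone C ∧ (∀ M, 0 < T₁ M) ∧
      ∀ (T : ℝ), 0 < T → T ≤ 1 → ∀ (ε ε' : ℝ≥0) (u₀ u₀' : ℝ → ℝ) (u u' : ℝ → ℝ → ℝ),
        IsSolution f ε T u₀ u → IsSolution f ε' T u₀' u' →
        ∀ M : ℝ≥0, max (controlNorm f ε u T) (controlNorm f ε' u' T) ≤ M →
          supHNorm 3 T (u - u')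
              ≤ C M * ENNReal.ofReal T * supHNorm 3 T (u - u')
                + (ε + ε') * C M + C M * hNorm 3 (u₀ - u₀') ∧
          supHNorm 3 (min T (T₁ M)) (u - u')
              ≤ 2 * (ε + ε') * C M + C M * hNorm 3 (u₀ - u₀')) ∧
    ∀ (T : ℝ), 0 < T → T ≤ 1 → ∀ (u₀ : ℝ → ℝ) (u u' : ℝ → ℝ → ℝ),
      IsSolution f 0 T u₀ u → IsSolution f 0 T u₀ u' → lowNorm f u T < ⊤ →
        ∀ t ∈ Icc 0 T, u t = u' t := by
  refine ⟨?_, fun T hT0 hT1 u₀ u u' hu hu' hlow t ht => ?_⟩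
  -- The constants of the integer levels n + 1 are summed up to n = ⌈M⌉, which makes the result
  -- monotone in M and dominates the constant of the level used. The square root passes from squared
  -- norms to norms.
  · choose c hc0 hc using fun n : ℕ =>
      exists_hThreeSq_sub_le hA1 hA2 hA3 (N := (n + 1 : ℕ)) (by positivity)
    refine ⟨fun M => ∑ n ∈ Finset.range (⌈M⌉₊ + 1), (√(c n)).toNNReal, fun _ => 1,
      fun M M' hM => ?_, fun _ => one_pos, ?_⟩
    · exact Finset.sum_le_sum_of_subset
        (Finset.range_mono (Nat.add_le_add_right (Nat.ceil_mono hM) 1))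
    intro T hT0 hT1 ε ε' u₀ u₀' u u' hu hu' M hM
    have hTT : T ∈ Icc 0 T := ⟨hT0.le, le_rfl⟩
    have hMN : (M : ℝ≥0∞) ≤ ENNReal.ofReal (⌈M⌉₊ + 1 : ℕ) := by
      rw [ENNReal.ofReal_natCast]
      have : M ≤ (⌈M⌉₊ + 1 : ℕ) := (Nat.le_ceil M).trans (by simp)
      exact_mod_cast this
    have hctrl : ∀ {δ : ℝ≥0} {v : ℝ → ℝ → ℝ}, controlNorm f δ v T ≤ M →
        (∀ t ∈ Icc 0 T, hNorm 7 (v t) ≤ ENNReal.ofReal (⌈M⌉₊ + 1 : ℕ)) ∧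
        (∀ t ∈ Icc 0 T, δ * hNorm 8 (v t) ≤ ENNReal.ofReal (⌈M⌉₊ + 1 : ℕ)) ∧
        ∀ t ∈ Icc 0 T, dispersion f t (v t) ≤ ENNReal.ofReal (⌈M⌉₊ + 1 : ℕ) := by
      intro δ v hv
      have h1 : highNorm δ v T + lowNorm f v T ≤ ENNReal.ofReal (⌈M⌉₊ + 1 : ℕ) :=
        (le_iSup₂ (f := fun τ (_ : τ ∈ Icc 0 T) => highNorm δ v τ + lowNorm f v τ) T hTT).trans
          (hv.trans hMN)
      have h2 := le_self_add.trans h1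
      refine ⟨fun t ht => ?_, fun t ht => ?_, fun t ht => ?_⟩
      · exact ((le_iSup₂ (f := fun t (_ : t ∈ Icc 0 T) => hNorm 7 (v t)) t ht).trans
          le_self_add).trans h2
      · exact ((mul_le_mul_right (le_iSup₂ (f := fun t (_ : t ∈ Icc 0 T) => hNorm 8 (v t)) t ht)
          _).trans le_add_self).trans h2
      · exact ((le_max_right _ _).trans (le_iSup₂ (f := fun t (_ : t ∈ Icc 0 T) =>
          max (hNorm 4 (v t)) (dispersion f t (v t))) t ht)).trans (le_add_self.trans h1)
    obtain ⟨k7, k8, kd⟩ := hctrl ((le_max_left _ _).trans hM)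
    obtain ⟨k7', k8', -⟩ := hctrl ((le_max_right _ _).trans hM)
    set C : ℝ≥0 := ∑ n ∈ Finset.range (⌈M⌉₊ + 1), (√(c n)).toNNReal with hC
    have hcC : ENNReal.ofReal √(c ⌈M⌉₊) ≤ C :=
      ENNReal.coe_le_coe.2 (Finset.single_le_sum (f := fun n => (√(c n)).toNNReal)
        (fun _ _ => zero_le) (Finset.self_mem_range_succ _))
    have h0 : (0 : ℝ) ∈ Icc 0 T := ⟨le_rfl, hT0.le⟩
    have hw := fun t (ht : t ∈ Icc 0 T) =>
      (hu.memCH_seven.memH t ht).sub (hu'.memCH_seven.memH t ht)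
    have hsup : supHNorm 3 T (u - u') ≤ (ε + ε') * C + C * hNorm 3 (u₀ - u₀') := by
      refine iSup₂_le fun t ht => ?_
      have h1 := hc ⌈M⌉₊ T hT1 ε ε' u₀ u₀' u u' hu hu' k7 k7' (fun _ => k8) (fun _ => k8') kd t ht
      have h2 := hNorm_three_le (δ := (ε : ℝ) + ε') (hw t ht)
        (by simpa only [hu.initial, hu'.initial] using hw 0 h0) (hc0 _) (by positivity) h1
      have h3 : ENNReal.ofReal ((ε : ℝ) + ε') = ε + ε' := by
        rw [ENNReal.ofReal_add ε.coe_nonneg ε'.coe_nonneg, ENNReal.ofReal_coe_nnreal, ENNReal.ofReal_coe_nnreal]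
      rw [h3] at h2
      refine h2.trans ((mul_le_mul_left hcC _).trans (le_of_eq ?_))
      ring
    refine ⟨hsup.trans ?_, ?_⟩
    -- The bound without the term C(M) T ‖u - u'‖ already holds on all of [0,T], so that term is
    -- merely added.
    · rw [add_assoc]
      exact le_add_self
    · refine le_trans (iSup₂_le fun t ht => ?_) (hsup.trans (add_le_add_left ?_ _))
      · exact le_iSup₂ (f := fun t (_ : t ∈ Icc 0 T) => hNorm 3 ((u - u') t)) t
          ⟨ht.1, ht.2.trans (min_le_left _ _)⟩
      · rw [mul_assoc]
        exact le_mul_of_one_le_left' one_le_two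
  · obtain ⟨N, hN⟩ := hu.memCH_seven.exists_hNorm_le
    obtain ⟨N', hN'⟩ := hu'.memCH_seven.exists_hNorm_le
    -- One level for both solutions and for the dispersion of u; the 1 ensures positivity.
    set L := max 1 (max (max N N') (lowNorm f u T).toReal) with hL
    have hL0 : 0 < L := lt_max_of_lt_left one_pos
    obtain ⟨C, hC, h⟩ := exists_hThreeSq_sub_le hA1 hA2 hA3 hL0
    have hd : ∀ t ∈ Icc 0 T, dispersion f t (u t) ≤ ENNReal.ofReal L := fun t ht => by
      refine ((le_max_right _ _).trans (le_iSup₂ (f := fun t (_ : t ∈ Icc 0 T) =>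
          max (hNorm 4 (u t)) (dispersion f t (u t))) t ht)).trans ?_
      change lowNorm f u T ≤ _
      rw [← ENNReal.ofReal_toReal hlow.ne]
      exact ENNReal.ofReal_le_ofReal ((le_max_right _ _).trans (le_max_right _ _))
    have h1 := h T hT1 0 0 u₀ u₀ u u' hu hu'
      (fun t ht => (hN t ht).trans (ENNReal.ofReal_le_ofReal
        (((le_max_left _ _).trans (le_max_left _ _)).trans (le_max_right _ _))))
      (fun t ht => (hN' t ht).trans (ENNReal.ofReal_le_ofReal
        (((le_max_right _ _).trans (le_max_left _ _)).trans (le_max_right _ _))))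
      (fun h => absurd rfl h) (fun h => absurd rfl h) hd t ht
    have h2 : hThreeSq (u₀ - u₀) = 0 := by simp [hThreeSq]
    rw [h2] at h1
    have hw := (hu.memCH_seven.memH t ht).sub (hu'.memCH_seven.memH t ht)
    have h3 : hNorm 3 (u t - u' t) = 0 := by
      rw [hw.hNorm_three_eq (by norm_num), Real.sqrt_eq_zero_of_nonpos (by simpa using h1),
        ENNReal.ofReal_zero]
    ext x
    -- The embedding estimate asks for a positive bound on the norm, so η/2 is used and η tends to
    -- zero.
    have h4 : |u t x - u' t x| ≤ 0 := le_of_forall_pos_le_add fun η hη => by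
      have := (hw.mono (l := 3) (by norm_num)).abs_le (half_pos hη) (by rw [h3]; exact zero_le)
        (j := 0) (by norm_num) x
      simp only [iteratedDeriv_zero, Pi.sub_apply] at this
      linarith
    exact sub_eq_zero.1 (abs_nonpos_iff.1 h4)
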